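/- **Setting.** Fix $\alpha>0$. Let $\widetilde{\mathbb C^*}$ be the universal cover of $\mathbb C\setminus\{0\}$. For $E,\ell\in\mathbb C$ with $\Re\ell>-\frac12$ consider $$\psi''(x)=\Big(x^{2\alpha}+\frac{\ell(\ell+1)}{x^2}-E\Big)\psi(x),\qquad x\in\widetilde{\mathbb C^*}. \tag{1}$$ Add to $\widetilde{\mathbb C^*}$ the boundary points $0$ and $\infty_k$ ($k\in\mathbb Z$): $x\to0$ means $|x|\to0$ with $\arg x$ bounded; $x\to\infty_k$ means $|x|\to\infty$ with $|\arg x-\frac{k\pi}{\alpha+1}|\le\frac{\pi-\varepsilon}{2\alpha+2}$ for some $\varepsilon>0$. For a basis $(\psi,\phi)$ of solutions of (1) and a boundary point $x_a$, the asymptotic value is $W_a=\lim_{x\to x_a}\psi(x)/\phi(x)\in\overline{\mathbb C}$. For four distinct boundary points $x_a,x_b,x_c,x_d$ the Fock–Goncharov coordinate is $$R_{(a,b,c,d)}=\frac{(W_a-W_b)(W_c-W_d)}{(W_a-W_d)(W_b-W_c)},$$ which does not depend on the basis; $R_{(a,b,c,d)}(\nu,\hbar)$ denotes its value for $E=\nu\hbar^{-\frac{2\alpha}{\alpha+1}}$,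 $\ell=\hbar^{-1}-\frac12$. Let $V(x)=V(x;\nu,1)=x^{2\alpha}-\nu+x^{-2}$ and $$F=\frac1{\sqrt V}\Big[\frac1{4x^2}+\frac{-4V''V+5(V')^2}{16V^2}\Big].$$ Let $N\subset\mathbb C$. A family ($\nu\in N$) of *strictly admissible curves* from $x_a$ to $x_b$ consists, for each $\nu\in N$, of a smooth injective curve $\gamma_\nu:(0,1)\to\widetilde{\mathbb C^*}\setminus\{V=0\}$ converging to $x_a$ as $t\to0$ and to $x_b$ as $t\to1$, together with the continuous branch of $\sqrt V$ along it, such that $\Re\int\sqrt V\,dx$ is strictly increasing along $\gamma_\nu$ and tends to $+\infty$ as $t\to 1$, and $|F(\gamma_\nu(t))||\dot\gamma_\nu(t)|\le h(t)$ for some $h\in L^1([0,1])$ independent of $\nu\in N$. The quadrilateral $x_ax_bx_cx_d$ is *WKB-admissible* for $\nu\in N$ if there are such families along its four oriented sides $ab,bc,cd,da$ (a WKB-realization). The *loop* $\gamma$ of a realization is the homotopy class in $\widetilde{\mathbb C^*}\setminus\{V=0\}$ of the closed curve which follows the sides $ab,bc,cd,da$ except near the vertices, where each side is joined to the next one inside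 a small neighbourhood of the vertex ($\{|x|<r\}$ at $0$, $\{|x|>r^{-1},\ |\arg x-\frac{k\pi}{\alpha+1}|<\frac{\pi}{2\alpha+2}\}$ at $\infty_k$) free of zeros of $V$. In $\oint_\gamma\sqrt V\,dx$ the branch is the one, continuous along the loop, for which $\Re\int\sqrt V\,dx$ decreases along $ab$ and $cd$ and increases along $bc$ and $da$. Finally $\mathrm{ind}_\gamma(V)$ is the number of zeros of $V$ encircled by $\gamma$, counted with multiplicity and orientation. **Theorem.** Let $x_ax_bx_cx_d$ be WKB-admissible for $\nu\in N$, and assume that $W_a\ne W_c$ or $W_b\ne W_d$ for the values of $\hbar$ considered. Let $\gamma$ be the loop associated to a realization. 1. There are $C_N>0$, $\hbar_0>0$ such that for all $\nu\in N$ and $0<\hbar<\hbar_0$ the coordinate $R_{(a,b,c,d)}(\nu,\hbar)$ is finite and $$\Big|R_{(a,b,c,d)}(\nu,\hbar)\,e^{\hbar^{-1}\oint_\gamma\sqrt{V(x;\nu,1)}\,dx}+e^{-\frac{i\pi}2\mathrm{ind}_\gamma(V)}\Big|\le C_N\,\hbar .$$ 2. Let $0\le\theta_0<\frac\pi2$ and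 suppose that for all $|\theta|\le\theta_0$ and all $\nu\in N$ the function $\Re\, e^{-i\theta}\int^x\sqrt{V}\,dx$ is strictly increasing along the four sides (each with its own branch, as in the definition of strictly admissible curves). Then there are $C_{N,\theta_0}>0$, $\hbar_0>0$ such that for all $\nu\in N$ and all complex $\hbar\neq0$ with $|\hbar|<\hbar_0$, $|\arg\hbar|\le\theta_0$, the same estimate holds with right-hand side $C_{N,\theta_0}|\hbar|$. 3. In particular, if all four sides are horizontal trajectories ($\Im\int\sqrt V\,dx$ constant along them), the conclusion of 2 holds for every $\theta_0\in[0,\frac\pi2)$. The constants depend on $\alpha$, $N$, the quadrilateral (and $\theta_0$), not on the realization. -/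

import Mathlib

open Set Filter Topology
open scoped ContDiff

namespace WKB

noncomputable section

/-! ### The universal cover of the punctured plane

A point `x` of the universal cover of `ℂ \ {0}` is represented by its logarithm `w = log x`, which
ranges over all of `ℂ`: so `|x| = exp (re w)`, `arg x = im w`, and `x ^ β = exp (β w)`. -/

/-- The derivative `d/dx = e ^ (-w) d/dw` of a function on the universal cover. -/
def ddx (f : ℂ → ℂ) (w : ℂ) : ℂ := Complex.exp (-w) * deriv f w

/-- The potential `U(x; E, ℓ) = x ^ (2 α) + ℓ (ℓ + 1) / x ^ 2 - E`. -/
def potential (α : ℝ) (E ℓ : ℂ) (w : ℂ) : ℂ :=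
  Complex.exp (2 * α * w) + ℓ * (ℓ + 1) / Complex.exp w ^ 2 - E

/-- `ψ` is a (global, holomorphic) solution of the anharmonic oscillator `ψ'' = U ψ`. -/
def IsSolution (α : ℝ) (E ℓ : ℂ) (ψ : ℂ → ℂ) : Prop :=
  Differentiable ℂ ψ ∧ ∀ w, ddx (ddx ψ) w = potential α E ℓ w * ψ w

/-- `(ψ, φ)` is a basis of solutions of the anharmonic oscillator. -/
def IsSolutionBasis (α : ℝ) (E ℓ : ℂ) (ψ φ : ℂ → ℂ) : Prop :=
  IsSolution α E ℓ ψ ∧ IsSolution α E ℓ φ ∧ LinearIndependent ℂ ![ψ, φ]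

/-! ### Boundary points, asymptotic values, Fock–Goncharov coordinates -/

/-- The boundary points `0` and `∞_k`, `k ∈ ℤ`, of the universal cover. -/
inductive Vertex : Type
  | zero : Vertex
  | infty (k : ℤ) : Vertex

/-- Convergence to a boundary point: `x → 0` means `|x| → 0` with `arg x` bounded, and `x → ∞_k`
means `|x| → ∞` while `|arg x - k π / (α + 1)| ≤ (π - ε) / (2 α + 2)` for some `ε > 0`. -/
def vertexFilter (α : ℝ) : Vertex → Filter ℂ
  | Vertex.zero => ⨆ B : ℝ, comap Complex.re atBot ⊓ 𝓟 {w : ℂ | |w.im| ≤ B}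
  | Vertex.infty k => ⨆ (ε : ℝ) (_ : 0 < ε), comap Complex.re atTop ⊓
      𝓟 {w : ℂ | |w.im - k * Real.pi / (α + 1)| ≤ (Real.pi - ε) / (2 * α + 2)}

/-- The quotient `p / q` as a point of the Riemann sphere (for `p`, `q` not both zero). -/
def quot (p q : ℂ) : OnePoint ℂ := if q = 0 then OnePoint.infty else ((p / q : ℂ) : OnePoint ℂ)

/-- `W` is the asymptotic value at the boundary point `a` of the pair `(ψ, φ)`:
the limit of `ψ(x) / φ(x)` in the Riemann sphere as `x → a`. -/
def IsAsymptoticValue (α : ℝ) (a : Vertex) (ψ φ : ℂ → ℂ) (W : OnePoint ℂ) : Prop :=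
  Tendsto (fun w => quot (ψ w) (φ w)) (vertexFilter α a) (𝓝 W)

/-- Homogeneous coordinates of a point of the Riemann sphere. -/
def homCoord : OnePoint ℂ → ℂ × ℂ
  | none => (1, 0)
  | some z => (z, 1)

/-- The difference `p - q` in homogeneous coordinates; equal to `p - q` if both are finite. -/
def bracket (p q : OnePoint ℂ) : ℂ :=
  (homCoord p).1 * (homCoord q).2 - (homCoord q).1 * (homCoord p).2

/-- The cross-ratio `(A - B) (C - D) / ((A - D) (B - C))` of four points of the Riemann sphere,
at least three of which are distinct. -/
def crossRatio (A B C D : OnePoint ℂ) : OnePoint ℂ :=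
  quot (bracket A B * bracket C D) (bracket A D * bracket B C)

/-! ### The reduced potential and strictly admissible curves, at `ħ = 1` -/

/-- The reduced potential `V(x; ν, 1) = x ^ (2 α) - ν + 1 / x ^ 2`. -/
def redV (α : ℝ) (ν : ℂ) (w : ℂ) : ℂ :=
  Complex.exp (2 * α * w) - ν + 1 / Complex.exp w ^ 2

/-- The forcing term
`F = (V - U + (-4 V'' V + 5 V' ^ 2) / (16 V ^ 2)) / √V` with `V - U = 1 / (4 x ^ 2)`,
where `r` is the chosen value of `√V`. -/
def forcing (α : ℝ) (ν : ℂ) (w r : ℂ) : ℂ :=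
  (1 / (4 * Complex.exp w ^ 2) +
    (-4 * ddx (ddx (redV α ν)) w * redV α ν w + 5 * ddx (redV α ν) w ^ 2) /
      (16 * redV α ν w ^ 2)) / r

/-- The integral `∫ √V dx` over `[s, t]` along the curve `x = exp (γ τ)`, where `r` is a branch of
`√V` along the curve and `dx = exp (γ τ) γ'(τ) dτ`. -/
def action (γ r : ℝ → ℂ) (s t : ℝ) : ℂ :=
  ∫ τ in s..t, r τ * (Complex.exp (γ τ) * deriv γ τ)

/-- A family, indexed by `ν ∈ N`, of strictly admissible curves from `a` to `b`. The branch `r` of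
`√V` along the curve is the one for which `Re ∫ √V dx` increases from `a` to `b`. -/
structure StrictlyAdmissible (α : ℝ) (N : Set ℂ) (a b : Vertex) where
  /-- the (logarithm of the) curve -/
  γ : ℂ → ℝ → ℂ
  /-- the branch of `√V` along the curve -/
  r : ℂ → ℝ → ℂ
  smooth : ∀ ν ∈ N, ContDiffOn ℝ ∞ (γ ν) (Ioo 0 1)
  injective : ∀ ν ∈ N, InjOn (γ ν) (Ioo 0 1)
  start : ∀ ν ∈ N, Tendsto (γ ν) (𝓝[>] 0) (vertexFilter α a)
  finish : ∀ ν ∈ N, Tendsto (γ ν) (𝓝[<] 1) (vertexFilter α b)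
  ne_zero : ∀ ν ∈ N, ∀ t ∈ Ioo (0 : ℝ) 1, redV α ν (γ ν t) ≠ 0
  branch_continuous : ∀ ν ∈ N, ContinuousOn (r ν) (Ioo 0 1)
  branch_sq : ∀ ν ∈ N, ∀ t ∈ Ioo (0 : ℝ) 1, r ν t ^ 2 = redV α ν (γ ν t)
  /-- `|F dx|` is integrable along the curves, uniformly in `ν ∈ N` -/
  integrable : ∃ h : ℝ → ℝ, MeasureTheory.IntegrableOn h (Icc 0 1) ∧
    ∀ ν ∈ N, ∀ t ∈ Ioo (0 : ℝ) 1,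
      ‖forcing α ν (γ ν t) (r ν t)‖ * ‖Complex.exp (γ ν t) * deriv (γ ν) t‖ ≤ h t
  strictMono : ∀ ν ∈ N, ∀ s ∈ Ioo (0 : ℝ) 1, ∀ t ∈ Ioo (0 : ℝ) 1, s < t →
    0 < (action (γ ν) (r ν) s t).re
  levinson : ∀ ν ∈ N, ∀ s ∈ Ioo (0 : ℝ) 1,
    Tendsto (fun t => (action (γ ν) (r ν) s t).re) (𝓝[<] 1) atTop

/-- A WKB-realization, for `ν ∈ N`, of the sides of the oriented quadrilateral with vertices
`v 0, v 1, v 2, v 3` (indices mod 4). The quadrilateral is WKB-admissible for `ν ∈ N` if the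
vertices are distinct and a WKB-realization exists. -/
abbrev Realization (α : ℝ) (N : Set ℂ) (v : Fin 4 → Vertex) : Type :=
  ∀ i : Fin 4, StrictlyAdmissible α N (v i) (v (i + 1))

/-- `Re (e ^ (-iθ) ∫ √V dx)` is strictly increasing along the four sides. -/
def Realization.RotatedMono {α : ℝ} {N : Set ℂ} {v : Fin 4 → Vertex} (Q : Realization α N v)
    (θ : ℝ) : Prop :=
  ∀ ν ∈ N, ∀ i, ∀ s ∈ Ioo (0 : ℝ) 1, ∀ t ∈ Ioo (0 : ℝ) 1, s < t →
    0 < (Complex.exp (-(Complex.I * θ)) * action ((Q i).γ ν) ((Q i).r ν) s t).re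

/-- The four sides are horizontal trajectories: `Im ∫ √V dx` is constant along them. -/
def Realization.Horizontal {α : ℝ} {N : Set ℂ} {v : Fin 4 → Vertex} (Q : Realization α N v) :
    Prop :=
  ∀ ν ∈ N, ∀ i, ∀ s ∈ Ioo (0 : ℝ) 1, ∀ t ∈ Ioo (0 : ℝ) 1,
    (action ((Q i).γ ν) ((Q i).r ν) s t).im = 0

/-! ### The loop associated to a realization, its period and its index -/

/-- Basis of neighbourhoods of the boundary points: `|x| < exp (-M)` at `0`, and the part
`|x| > exp M` of the `k`-th Stokes sector at `∞_k`. They are convex in the coordinate `w`. -/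
def vertexNhd (α M : ℝ) : Vertex → Set ℂ
  | Vertex.zero => {w | w.re < -M}
  | Vertex.infty k =>
      {w | M < w.re ∧ |w.im - k * Real.pi / (α + 1)| < Real.pi / (2 * α + 2)}

/-- `Γ : [0, 8] → ℂ` is a closed curve obtained by surgery from the sides of the quadrilateral:
the ends of the sides are cut off inside neighbourhoods of the vertices that contain no zero of
`V`, and at each vertex the incoming side is joined to the outgoing one inside that neighbourhood.
On `[2 i, 2 i + 1]` the curve runs along the `i`-th side; on `[2 i + 1, 2 i + 2]` it runs near the
vertex `v (i + 1)`. All such curves are freely homotopic in the complement of the zeros of `V`;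
their class is the loop associated to the realization. -/
structure IsSurgeryLoop {α : ℝ} {N : Set ℂ} {v : Fin 4 → Vertex} (Q : Realization α N v) (ν : ℂ)
    (Γ : ℝ → ℂ) (s t : Fin 4 → ℝ) (M : ℝ) : Prop where
  cut : ∀ i, 0 < s i ∧ s i < t i ∧ t i < 1
  nhd_ne_zero : ∀ i, ∀ w ∈ vertexNhd α M (v i), redV α ν w ≠ 0
  start_mem : ∀ i, ∀ τ, 0 < τ → τ ≤ s i → (Q i).γ ν τ ∈ vertexNhd α M (v i)
  finish_mem : ∀ i, ∀ τ, t i ≤ τ → τ < 1 → (Q i).γ ν τ ∈ vertexNhd α M (v (i + 1))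
  side : ∀ i : Fin 4, ∀ u ∈ Icc (0 : ℝ) 1,
    Γ (2 * (i : ℕ) + u) = (Q i).γ ν (s i + (t i - s i) * u)
  corner_mem : ∀ i : Fin 4, ∀ u ∈ Icc (0 : ℝ) 1,
    Γ (2 * (i : ℕ) + 1 + u) ∈ vertexNhd α M (v (i + 1))
  corner_smooth : ∀ i : Fin 4,
    ContDiffOn ℝ 1 Γ (Icc (2 * (i : ℕ) + 1 : ℝ) (2 * (i : ℕ) + 2))
  closed : Γ 8 = Γ 0

/-- `σ` is the branch of `√V` along the loop such that `Re ∫ √V dx` decreases along the side from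
`v 0` to `v 1`; it then decreases from `v 2` to `v 3` and increases along the other two sides. -/
structure IsLoopBranch {α : ℝ} {N : Set ℂ} {v : Fin 4 → Vertex} (Q : Realization α N v) (ν : ℂ)
    (Γ : ℝ → ℂ) (s t : Fin 4 → ℝ) (σ : ℝ → ℂ) : Prop where
  continuous : ContinuousOn σ (Icc 0 8)
  sq : ∀ τ ∈ Icc (0 : ℝ) 8, σ τ ^ 2 = redV α ν (Γ τ)
  side_zero : ∀ u ∈ Icc (0 : ℝ) 1, σ u = -(Q 0).r ν (s 0 + (t 0 - s 0) * u)

/-- The period `∮ √V dx`. -/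
def period (Γ σ : ℝ → ℂ) : ℂ := action Γ σ 0 8

/-- The winding number of the loop around `z`. -/
def winding (Γ : ℝ → ℂ) (z : ℂ) : ℂ :=
  (2 * Real.pi * Complex.I)⁻¹ * ∫ τ in (0 : ℝ)..8, (Γ τ - z)⁻¹ * deriv Γ τ

/-- The index `ind_Γ(V)`: the number of zeros of `V` encircled by the loop, counted with
multiplicity and orientation (`V` has no pole on the universal cover). -/
def index (α : ℝ) (ν : ℂ) (Γ : ℝ → ℂ) : ℂ :=
  ∑ᶠ z : ℂ, (analyticOrderNatAt (redV α ν) z : ℂ) * winding Γ z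

/-! ### The estimate -/

/-- The estimate for given `ν`, `ħ` and constant `C`. The Fock–Goncharov coordinate `R(ν, ħ)` is
that of the anharmonic oscillator with `E = ν ħ ^ (-2 α / (α + 1))` and `ℓ = 1 / ħ - 1 / 2`: the
cross-ratio of the asymptotic values `W i` at the vertices `v i`, in any basis of solutions. -/
def Estimate {α : ℝ} {N : Set ℂ} {v : Fin 4 → Vertex} (Q : Realization α N v) (ν ħ : ℂ) (C : ℝ) :
    Prop :=
  ∀ ψ φ : ℂ → ℂ,
    IsSolutionBasis α (ν * ħ ^ (-(2 * α / (α + 1)) : ℂ)) (1 / ħ - 1 / 2) ψ φ →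
    ∃ W : Fin 4 → OnePoint ℂ, (∀ i, IsAsymptoticValue α (v i) ψ φ (W i)) ∧
      (W 0 ≠ W 2 ∨ W 1 ≠ W 3 →
        ∃ R : ℂ, crossRatio (W 0) (W 1) (W 2) (W 3) = (R : OnePoint ℂ) ∧
          ∀ (Γ σ : ℝ → ℂ) (s t : Fin 4 → ℝ) (M : ℝ),
            IsSurgeryLoop Q ν Γ s t M → IsLoopBranch Q ν Γ s t σ →
            ‖R * Complex.exp (ħ⁻¹ * period Γ σ) +
              Complex.exp (-(Complex.I * Real.pi / 2) * index α ν Γ)‖ ≤ C * ‖ħ‖)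

end

end WKB

namespace WKB

noncomputable section

section

/-! ### Linear equations `g'' = P g` with an entire coefficient -/

/-! Put w = log x. Multiplication by e^{-w/2} and a translation by log ħ/(α+1) turn the oscillator
into g'' = ħ⁻² Q g with the entire function Q = x²V (`Qf`, `IsSolution.isSol_rescale`). The choice ℓ
= 1/ħ - 1/2 is what makes ℓ(ℓ+1) + 1/4 = ħ⁻², and the term 1/(4x²) of F is what the passage to w
produces: F dx is the usual Liouville–Green error form `errF` dw (`forcing_mul_exp`).

At every vertex v_i there is a subdominant solution χ_i, and the asymptotic value of a basis (g, h)
at v_i is read off from the coefficients of χ_i in that basis. With w_ij the Wronskian of χ_i and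
χ_j, the Fock–Goncharov coordinate is therefore w_01 w_23 / (w_03 w_12) (`exists_crossRatio`), and
only Wronskians of neighbouring vertices enter.

Each of these is computed by WKB along one side. Let p be a fourth root of Q, T a primitive of p²,
and describe a solution by its two Liouville–Green coefficients `lg`. Along a curve on which Re(T/ħ)
does not decrease, a Grönwall argument shows that the deviation from the growing Liouville–Green
solution is amplified at most by exp(|ħ| ∫ |errF dw|) (`LGPath.transport`). The solution decaying at
a is the growing one when it is followed from a to b, while the solution of b decays there.
Evaluating their constant Wronskian near b gives -(εħ/2) wr(χ_a, χ_b) = 1 + O(ħ), where ε = ±1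
relates p² to the admissible branch (`norm_wr_sub_one_le`).

The four normalizations fit together when one root p and one action S are continued around the
quadrilateral (`Chain`). The sign ε alternates from side to side. After one turn p is multiplied by
μ = ±1 and S is increased by d, so χ_0 returns normalized as μ e^{-d/ħ} χ_0; with the antisymmetry
of the Wronskian this yields R e^{d/ħ} = -μ + O(ħ) (`Chain.exists_estimate`). Here d is the period
of √V dx. Since log p changes by a quarter of ∮ Q'/Q, the argument principle identifies μ with
e^{-iπ ind/2} (`period_eq`, `exp_index`).

Existence of the χ_i, and their domination by all other solutions in the relevant sectors, comes
from the same transport estimate along straight segments in the w-plane, because the error function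
decays exponentially at both kinds of ends (`EndData`).

The constants do not depend on the realization because μ and d do not: two realizations share the
same R, so e^{(d'-d)/ħ} tends to μ'/μ as ħ → 0+, which forces d = d' and μ = μ' (`Chain.unique`).
For complex ħ the transport needs precisely the monotonicity of Re(e^{-iθ}∫√V dx) at θ = arg ħ, and
horizontal sides have it for all |θ| < π/2. -/

/-- `g` is an entire solution of `g'' = P g`. -/
def IsSol (P g : ℂ → ℂ) : Prop :=
  Differentiable ℂ g ∧ ∀ w, deriv (deriv g) w = P w * g w

/-- The Wronskian. -/
def wr (g h : ℂ → ℂ) (w : ℂ) : ℂ := g w * deriv h w - deriv g w * h w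

lemma differentiable_deriv {f : ℂ → ℂ} (hf : Differentiable ℂ f) : Differentiable ℂ (deriv f) :=
  fun z => (hf.analyticAt z).deriv.differentiableAt

lemma IsSol.hasDerivAt {P g : ℂ → ℂ} (h : IsSol P g) (w : ℂ) : HasDerivAt g (deriv g w) w :=
  (h.1 w).hasDerivAt

lemma IsSol.hasDerivAt_deriv {P g : ℂ → ℂ} (h : IsSol P g) (w : ℂ) :
    HasDerivAt (deriv g) (P w * g w) w := by
  rw [← h.2 w]; exact (differentiable_deriv h.1 w).hasDerivAt

lemma IsSol.lin {P g h : ℂ → ℂ} (hg : IsSol P g) (hh : IsSol P h) (a b : ℂ) :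
    IsSol P (fun w => a * g w + b * h w) := by
  have h1 : deriv (fun w => a * g w + b * h w) = fun w => a * deriv g w + b * deriv h w := by
    funext w
    exact (((hg.hasDerivAt w).const_mul a).add ((hh.hasDerivAt w).const_mul b)).deriv
  refine ⟨(hg.1.const_mul a).add (hh.1.const_mul b), fun w => ?_⟩
  rw [h1, (((hg.hasDerivAt_deriv w).const_mul a).fun_add ((hh.hasDerivAt_deriv w).const_mul b)).deriv]
  ring

lemma deriv_lin {P g h : ℂ → ℂ} (hg : IsSol P g) (hh : IsSol P h) (a b w : ℂ) :
    deriv (fun w => a * g w + b * h w) w = a * deriv g w + b * deriv h w :=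
  (((hg.hasDerivAt w).const_mul a).add ((hh.hasDerivAt w).const_mul b)).deriv

lemma IsSol.const_mul {P g : ℂ → ℂ} (hg : IsSol P g) (a : ℂ) : IsSol P (fun w => a * g w) := by
  simpa using hg.lin hg a 0

lemma wr_const {P g h : ℂ → ℂ} (hg : IsSol P g) (hh : IsSol P h) (z w : ℂ) :
    wr g h z = wr g h w := by
  have key : ∀ w, HasDerivAt (wr g h) 0 w := fun w => by
    have := ((hg.hasDerivAt w).mul (hh.hasDerivAt_deriv w)).sub
      ((hg.hasDerivAt_deriv w).mul (hh.hasDerivAt w))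
    refine this.congr_deriv ?_
    ring
  exact is_const_of_deriv_eq_zero (fun w => (key w).differentiableAt) (fun w => (key w).deriv) z w

/-- Expansion of a 3×3 determinant with a repeated row. As Wronskians of solutions are constant,
this is the explicit linear relation between any three solutions, and it stands in for a dimension
count of the solution space. -/
lemma wr_three (g h k : ℂ → ℂ) (w : ℂ) :
    wr g h w * k w + wr h k w * g w + wr k g w * h w = 0 := by
  simp only [wr]; ring

lemma wr_swap (g h : ℂ → ℂ) (w : ℂ) : wr h g w = -wr g h w := by
  simp only [wr]; ring

/-- The primitive, vanishing at the origin, of an entire function. -/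
lemma exists_primitive {f : ℂ → ℂ} (hf : Differentiable ℂ f) :
    ∃ F : ℂ → ℂ, F 0 = 0 ∧ ∀ z, HasDerivAt F (f z) z := by
  obtain ⟨F, hF0, hF⟩ := hf.isExactOn_univ.with_val_at 0 0
  exact ⟨F, hF0, fun z => hF z (mem_univ z)⟩

/-- Integration along the ray from 0. Applied twice per Picard step, it produces the factors
1/(2n+1) and 1/(2n+2) of a factorial. -/
lemma norm_primitive_le {f F : ℂ → ℂ} (hF0 : F 0 = 0) (hF : ∀ z, HasDerivAt F (f z) z)
    {R C : ℝ} {n : ℕ} (hb : ∀ z, ‖z‖ < R → ‖f z‖ ≤ C * ‖z‖ ^ n) {z : ℂ} (hz : ‖z‖ < R) :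
    ‖F z‖ ≤ C / (n + 1) * ‖z‖ ^ (n + 1) := by
  have hn : (0 : ℝ) < n + 1 := by positivity
  have hd : ∀ t : ℝ, HasDerivAt (fun t : ℝ => F (t * z)) (f (t * z) * z) t := fun t => by
    have h1 : HasDerivAt (fun t : ℝ => (t : ℂ) * z) z t := by
      simpa using (Complex.ofRealCLM.hasDerivAt (x := t)).mul_const z
    exact (hF (t * z)).comp t h1
  have hB : ∀ t : ℝ, HasDerivAt (fun t : ℝ => C / (n + 1) * ‖z‖ ^ (n + 1) * t ^ (n + 1))
      (C * ‖z‖ ^ (n + 1) * t ^ n) t := fun t => by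
    have := (hasDerivAt_pow (n + 1) t).const_mul (C / (n + 1) * ‖z‖ ^ (n + 1))
    refine this.congr_deriv ?_
    push_cast
    field_simp
  have := image_norm_le_of_norm_deriv_right_le_deriv_boundary (a := 0) (b := 1)
    (f := fun t : ℝ => F (t * z)) (f' := fun t : ℝ => f (t * z) * z)
    (fun t _ => (hd t).continuousAt.continuousWithinAt) (fun t _ => (hd t).hasDerivWithinAt)
    (B := fun t : ℝ => C / (n + 1) * ‖z‖ ^ (n + 1) * t ^ (n + 1)) (by simp [hF0])
    hB (fun t ht => by
      have h1 : ‖(t : ℂ) * z‖ = t * ‖z‖ := by rw [norm_mul, Complex.norm_real, Real.norm_of_nonneg ht.1]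
      have h2 : ‖(t : ℂ) * z‖ < R := by
        rw [h1]; exact lt_of_le_of_lt (mul_le_of_le_one_left (norm_nonneg _) ht.2.le) hz
      calc ‖f (t * z) * z‖ = ‖f (t * z)‖ * ‖z‖ := norm_mul _ _
        _ ≤ C * (t * ‖z‖) ^ n * ‖z‖ := by
          have := hb _ h2
          rw [h1] at this
          gcongr
        _ = C * ‖z‖ ^ (n + 1) * t ^ n := by ring) (x := 1) (by simp)
  simpa using this

/-- Picard iteration as a series: the first term is a + bz, each further term is the double
primitive of P times the previous one. On a disc where |P| ≤ K, the n-th term is O(Kⁿ|z|²ⁿ/(2n)!),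
so the series converges locally uniformly and may be differentiated termwise. -/
lemma exists_isSol {P : ℂ → ℂ} (hP : Differentiable ℂ P) (a b : ℂ) :
    ∃ g, IsSol P g ∧ g 0 = a ∧ deriv g 0 = b := by
  have step : ∀ u : {u : ℂ → ℂ // Differentiable ℂ u}, ∃ v : {u : ℂ → ℂ // Differentiable ℂ u},
      v.1 0 = 0 ∧ ∃ v1 : ℂ → ℂ, v1 0 = 0 ∧ (∀ z, HasDerivAt v.1 (v1 z) z) ∧
        ∀ z, HasDerivAt v1 (P z * u.1 z) z := fun u => by
    obtain ⟨v1, h10, h1⟩ := exists_primitive (hP.mul u.2)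
    obtain ⟨v, h0, h⟩ := exists_primitive (f := v1) (fun z => (h1 z).differentiableAt)
    exact ⟨⟨v, fun z => (h z).differentiableAt⟩, h0, v1, h10, h, h1⟩
  choose next hn0 next1 hn10 hn hn1 using step
  let seq : ℕ → {u : ℂ → ℂ // Differentiable ℂ u} := fun n =>
    Nat.rec ⟨fun z => a + b * z, by fun_prop⟩ (fun _ u => next u) n
  have hs0 : ∀ z, (seq 0).1 z = a + b * z := fun z => rfl
  have hss : ∀ n, seq (n + 1) = next (seq n) := fun n => rfl
  have bound : ∀ R : ℝ, 0 < R → ∃ u : ℕ → ℝ, Summable u ∧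
      ∀ n z, z ∈ Metric.ball (0 : ℂ) R → ‖(seq n).1 z‖ ≤ u n := by
    intro R hR
    obtain ⟨K, hK⟩ := (isCompact_closedBall (0 : ℂ) R).exists_bound_of_continuousOn
      hP.continuous.continuousOn
    have hK0 : 0 ≤ K := (norm_nonneg _).trans (hK 0 (by simp [hR.le]))
    have hK' : ∀ z : ℂ, ‖z‖ < R → ‖P z‖ ≤ K := fun z hz => hK z (by simpa using hz.le)
    have hA : ∀ n z, ‖z‖ < R →
        ‖(seq n).1 z‖ ≤ (‖a‖ + ‖b‖ * R) * K ^ n / (Nat.factorial (2 * n)) * ‖z‖ ^ (2 * n) := by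
      intro n
      induction n with
      | zero =>
        intro z hz
        simp only [hs0]
        refine (norm_add_le _ _).trans ?_
        simp only [pow_zero, mul_zero, Nat.factorial_zero, norm_mul]
        norm_num
        gcongr
      | succ n ih =>
        intro z hz
        rw [hss]
        have h1 : ∀ z : ℂ, ‖z‖ < R → ‖P z * (seq n).1 z‖ ≤
            ((‖a‖ + ‖b‖ * R) * K ^ (n + 1) / (Nat.factorial (2 * n))) * ‖z‖ ^ (2 * n) := by
          intro z hz
          rw [norm_mul]
          calc ‖P z‖ * ‖(seq n).1 z‖ ≤ K * ((‖a‖ + ‖b‖ * R) * K ^ n / (Nat.factorial (2 * n)) *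
                ‖z‖ ^ (2 * n)) := by
                gcongr
                · exact hK' z hz
                · exact ih z hz
            _ = _ := by ring
        have h2 := fun z hz => norm_primitive_le (hn10 (seq n)) (hn1 (seq n)) h1 (z := z) hz
        have h3 := norm_primitive_le (hn0 (seq n)) (hn (seq n)) h2 hz
        refine h3.trans (le_of_eq ?_)
        have : 2 * (n + 1) = 2 * n + 1 + 1 := by ring
        rw [this, Nat.factorial_succ, Nat.factorial_succ]
        push_cast
        field_simp
    -- Weakening (2n)! to n! leaves an exponential series as majorant.
    refine ⟨fun n => (‖a‖ + ‖b‖ * R) * ((K * R ^ 2) ^ n / (Nat.factorial n)),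
      (Real.summable_pow_div_factorial _).mul_left _, fun n z hz => ?_⟩
    have hz' : ‖z‖ < R := by simpa using hz
    refine (hA n z hz').trans ?_
    have e : (‖a‖ + ‖b‖ * R) * ((K * R ^ 2) ^ n / (Nat.factorial n)) =
        (‖a‖ + ‖b‖ * R) * K ^ n / (Nat.factorial n) * R ^ (2 * n) := by
      rw [mul_pow, ← pow_mul]; ring
    show _ ≤ (‖a‖ + ‖b‖ * R) * ((K * R ^ 2) ^ n / (Nat.factorial n))
    rw [e]
    gcongr
    omega
  have hsd : ∀ n, Differentiable ℂ (seq n).1 := fun n => (seq n).2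
  have hd1 : ∀ n z, deriv (deriv (seq (n + 1)).1) z = P z * (seq n).1 z := fun n z => by
    have : deriv (seq (n + 1)).1 = next1 (seq n) := by
      funext z; rw [hss]; exact (hn (seq n) z).deriv
    rw [this]; exact (hn1 (seq n) z).deriv
  have hd0 : ∀ z, deriv (seq 0).1 z = b := fun z => by
    have : HasDerivAt (seq 0).1 b z := by
      have : HasDerivAt (fun z : ℂ => a + b * z) (b * 1) z :=
        ((hasDerivAt_id z).const_mul b).const_add a
      rw [mul_one] at this
      exact this
    exact this.deriv
  have hd00 : ∀ z, deriv (deriv (seq 0).1) z = 0 := fun z => by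
    have : deriv (seq 0).1 = fun _ => b := funext hd0
    rw [this]; simp
  set g : ℂ → ℂ := fun z => ∑' n, (seq n).1 z with hg
  have hgd : Differentiable ℂ g := fun z => by
    obtain ⟨u, hu, hub⟩ := bound (‖z‖ + 1) (by positivity)
    exact (Complex.differentiableOn_tsum_of_summable_norm hu (fun n => (hsd n).differentiableOn)
      Metric.isOpen_ball hub).differentiableAt (Metric.isOpen_ball.mem_nhds (by simp))
  have hg1 : ∀ z, HasSum (fun n => deriv (seq n).1 z) (deriv g z) := fun z => by
    obtain ⟨u, hu, hub⟩ := bound (‖z‖ + 1) (by positivity)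
    exact Complex.hasSum_deriv_of_summable_norm hu (fun n => (hsd n).differentiableOn)
      Metric.isOpen_ball hub (by simp)
  have hg2 : ∀ z, HasSum (fun n => deriv (deriv (seq n).1) z) (deriv (deriv g) z) := fun z => by
    obtain ⟨u, hu, hub⟩ := bound (‖z‖ + 2) (by positivity)
    -- Cauchy's estimate on unit circles bounds the derivatives by the same majorant, at the cost of
    -- one unit of radius.
    have hb' : ∀ n w, w ∈ Metric.ball (0 : ℂ) (‖z‖ + 1) → ‖deriv (seq n).1 w‖ ≤ u n := by
      intro n w hw
      have hw' : ‖w‖ < ‖z‖ + 1 := by simpa using hw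
      have := Complex.norm_deriv_le_of_forall_mem_sphere_norm_le (c := w) (R := 1) (C := u n)
        (f := (seq n).1) one_pos (hsd n).diffContOnCl (fun y hy => hub n y (by
          have hy' : ‖y - w‖ = 1 := by simpa [dist_eq_norm] using hy
          have := norm_le_norm_add_norm_sub w y
          have e : ‖w - y‖ = 1 := by rw [norm_sub_rev]; exact hy'
          have := norm_sub_norm_le y w
          simp only [Metric.mem_ball, dist_zero_right]
          linarith))
      simpa using this
    have e : (fun w => ∑' n, deriv (seq n).1 w) = deriv g := funext fun w => (hg1 w).tsum_eq
    have := Complex.hasSum_deriv_of_summable_norm hu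
      (fun n => (differentiable_deriv (hsd n)).differentiableOn)
      Metric.isOpen_ball hb' (z := z) (by simp)
    rwa [e] at this
  have hgs : ∀ z, HasSum (fun n => (seq n).1 z) (g z) := fun z => by
    obtain ⟨u, hu, hub⟩ := bound (‖z‖ + 1) (by positivity)
    exact (Summable.of_norm_bounded hu (fun n => hub n z (by simp))).hasSum
  refine ⟨g, ⟨hgd, fun z => ?_⟩, ?_, ?_⟩
  · have h1 := (hgs z).mul_left (P z)
    have h2 := hg2 z
    have h3 : HasSum (fun n => deriv (deriv (seq (n + 1)).1) z) (deriv (deriv g) z) := by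
      rw [← hasSum_nat_add_iff' 1] at h2
      simpa [hd00] using h2
    simp only [hd1] at h3
    exact h3.unique h1
  · have h2 := hgs 0
    rw [← hasSum_nat_add_iff' 1] at h2
    have : ∀ n, (seq (n + 1)).1 0 = 0 := fun n => by rw [hss]; exact hn0 _
    simp only [this, Finset.range_one, Finset.sum_singleton, hs0] at h2
    have := h2.unique hasSum_zero
    simpa [sub_eq_zero] using this
  · have h2 := hg1 0
    rw [← hasSum_nat_add_iff' 1] at h2
    have : ∀ n, deriv (seq (n + 1)).1 0 = 0 := fun n => by
      rw [hss, (hn (seq n) 0).deriv]; exact hn10 _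
    simp only [this, Finset.range_one, Finset.sum_singleton, hd0] at h2
    have := h2.unique hasSum_zero
    simpa [sub_eq_zero] using this

/-- Solutions of `g'' = P g` with prescribed value and derivative at a point. -/
lemma exists_isSol_at {P : ℂ → ℂ} (hP : Differentiable ℂ P) (w₀ a b : ℂ) :
    ∃ g, IsSol P g ∧ g w₀ = a ∧ deriv g w₀ = b := by
  obtain ⟨g, hg, h0, h1⟩ := exists_isSol (P := fun z => P (z + w₀)) (by fun_prop) a b
  have e1 : deriv (fun w => g (w - w₀)) = fun w => deriv g (w - w₀) := by
    funext w; exact deriv_comp_sub_const _ _ _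
  refine ⟨fun w => g (w - w₀), ⟨fun w => ?_, fun w => ?_⟩, by simpa using h0, ?_⟩
  · exact (hg.1 _).comp w (by fun_prop)
  · rw [e1, deriv_comp_sub_const (f := deriv g), hg.2]; simp
  · rw [e1]; simpa using h1

/-- If wr g h vanished, `wr_three` would be a linear relation between g and h for every third
solution k; independence then kills wr g k for all k, and taking k in a basis gives g = 0. -/
lemma wr_ne_zero_of_linearIndependent {P g h : ℂ → ℂ} (hP : Differentiable ℂ P) (hg : IsSol P g)
    (hh : IsSol P h) (hl : LinearIndependent ℂ ![g, h]) (w : ℂ) : wr g h w ≠ 0 := by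
  intro h0
  have hz : ∀ z, wr g h z = 0 := fun z => (wr_const hg hh z w).trans h0
  rw [LinearIndependent.pair_iff] at hl
  have key : ∀ k, IsSol P k → wr g k 0 = 0 := fun k hk => by
    have := hl (wr h k 0) (wr k g 0) (by
      funext z
      have := wr_three g h k z
      rw [hz z, wr_const hh hk z 0, wr_const hk hg z 0] at this
      simpa using this)
    rw [wr_swap k g, this.2, neg_zero]
  obtain ⟨k1, hk1, h10, h11⟩ := exists_isSol_at hP 0 1 0
  obtain ⟨k2, hk2, h20, h21⟩ := exists_isSol_at hP 0 0 1
  have hw : wr k1 k2 0 = 1 := by simp [wr, h10, h11, h20, h21]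
  have hg0 : g = 0 := by
    funext z
    have := wr_three k1 k2 g z
    rw [wr_const hk1 hk2 z 0, hw, wr_const hk2 hg z 0, wr_const hg hk1 z 0, wr_swap g k2 0,
      key k1 hk1, key k2 hk2] at this
    simpa using this
  have := hl 1 0 (by simp [hg0])
  exact one_ne_zero this.1

end

section

/-! ### Integral form of Grönwall's inequality -/

lemma hasDerivAt_integral_of_continuousOn {f : ℝ → ℝ} {s t x : ℝ} (hf : ContinuousOn f (Icc s t))
    (hx : x ∈ Ioo s t) : HasDerivAt (fun x => ∫ τ in s..x, f τ) (f x) x := by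
  have hn : Icc s t ∈ 𝓝 x := Icc_mem_nhds hx.1 hx.2
  refine intervalIntegral.integral_hasDerivAt_right ?_ ?_ (hf.continuousAt hn)
  · exact (hf.mono (Icc_subset_Icc_right hx.2.le)).intervalIntegrable_of_Icc hx.1.le
  · exact (hf.mono Ioo_subset_Icc_self).stronglyMeasurableAtFilter isOpen_Ioo x hx

lemma continuousOn_integral_of_continuousOn {f : ℝ → ℝ} {s t : ℝ} (hst : s ≤ t)
    (hf : ContinuousOn f (Icc s t)) : ContinuousOn (fun x => ∫ τ in s..x, f τ) (Icc s t) := by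
  have := intervalIntegral.continuousOn_primitive_interval (μ := MeasureTheory.volume) (f := f)
    (a := s) (b := t) (by rw [uIcc_of_le hst]; exact hf.integrableOn_Icc)
  rwa [uIcc_of_le hst] at this

/-- The right-hand side of the hypothesis, multiplied by exp(-∫k), is nonincreasing. -/
lemma gronwall_integral {u k : ℝ → ℝ} {s t c : ℝ} (hst : s ≤ t) (hu : ContinuousOn u (Icc s t))
    (hk : ContinuousOn k (Icc s t)) (hk0 : ∀ x ∈ Icc s t, 0 ≤ k x)
    (h : ∀ x ∈ Icc s t, u x ≤ c + ∫ τ in s..x, k τ * u τ) :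
    u t ≤ c * Real.exp (∫ τ in s..t, k τ) := by
  have hd : ∀ x ∈ Ioo s t, HasDerivAt
      (fun x => (c + ∫ τ in s..x, k τ * u τ) * Real.exp (-∫ τ in s..x, k τ))
      (k x * u x * Real.exp (-∫ τ in s..x, k τ) +
        (c + ∫ τ in s..x, k τ * u τ) * (Real.exp (-∫ τ in s..x, k τ) * -k x)) x := fun x hx =>
    ((hasDerivAt_integral_of_continuousOn (hk.mul hu) hx).const_add c).mul
      (hasDerivAt_integral_of_continuousOn hk hx).fun_neg.exp
  have anti : AntitoneOn
      (fun x => (c + ∫ τ in s..x, k τ * u τ) * Real.exp (-∫ τ in s..x, k τ)) (Icc s t) := by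
    refine antitoneOn_of_deriv_nonpos (convex_Icc s t) ?_ ?_ ?_
    · exact (continuousOn_const.add (continuousOn_integral_of_continuousOn hst (hk.mul hu))).mul
        (continuousOn_integral_of_continuousOn hst hk).neg.rexp
    · rw [interior_Icc]
      exact fun x hx => (hd x hx).differentiableAt.differentiableWithinAt
    · rw [interior_Icc]
      intro x hx
      rw [(hd x hx).deriv]
      have h1 := h x (Ioo_subset_Icc_self hx)
      have h2 := hk0 x (Ioo_subset_Icc_self hx)
      have h3 := Real.exp_pos (-∫ τ in s..x, k τ)
      have : k x * u x * Real.exp (-∫ τ in s..x, k τ) +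
        (c + ∫ τ in s..x, k τ * u τ) * (Real.exp (-∫ τ in s..x, k τ) * -k x) =
        -(k x * (Real.exp (-∫ τ in s..x, k τ) * ((c + ∫ τ in s..x, k τ * u τ) - u x))) := by ring
      rw [this]
      exact neg_nonpos.2 (mul_nonneg h2 (mul_nonneg h3.le (sub_nonneg.2 h1)))
  have := anti (left_mem_Icc.2 hst) (right_mem_Icc.2 hst) hst
  simp only [intervalIntegral.integral_same, neg_zero, Real.exp_zero, mul_one, add_zero] at this
  have h1 := h t (right_mem_Icc.2 hst)
  refine h1.trans ?_
  rwa [Real.exp_neg, mul_inv_le_iff₀ (Real.exp_pos _)] at this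

/-! ### Liouville–Green coefficients -/

/-- The coefficient of the increasing Liouville–Green solution `p⁻¹ exp (∫ p² / ħ)` in `g`, times the
exponential, where `p` is a fourth root of `Q`. The decreasing one is obtained from `-ħ`. -/
def lg (Q : ℂ → ℂ) (ħ p : ℂ) (g : ℂ → ℂ) (w : ℂ) : ℂ :=
  (p * g w + ħ / p * (deriv g w + deriv Q w / (4 * Q w) * g w)) / 2

/-- The error control function of the Liouville–Green approximation, where `q` is the branch of
the square root of `Q`. -/
def errF (Q : ℂ → ℂ) (q w : ℂ) : ℂ :=
  (-4 * deriv (deriv Q) w * Q w + 5 * deriv Q w ^ 2) / (16 * Q w ^ 2) / q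

/-- The deviation of `g` from the increasing Liouville–Green solution `p⁻¹ exp (T / ħ)`. -/
def dev (Q : ℂ → ℂ) (ħ p T : ℂ) (g : ℂ → ℂ) (w : ℂ) : ℝ :=
  ‖lg Q ħ p g w * Complex.exp (-(T / ħ)) - 1‖ + ‖lg Q (-ħ) p g w * Complex.exp (-(T / ħ))‖

lemma lg_add_lg (Q : ℂ → ℂ) (ħ p : ℂ) (g : ℂ → ℂ) (w : ℂ) :
    lg Q ħ p g w + lg Q (-ħ) p g w = p * g w := by
  simp only [lg]; ring

lemma lg_const_mul (Q : ℂ → ℂ) (ħ p c : ℂ) {g : ℂ → ℂ} (hg : Differentiable ℂ g) (w : ℂ) :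
    lg Q ħ p (fun w => c * g w) w = c * lg Q ħ p g w := by
  have : deriv (fun w => c * g w) w = c * deriv g w := ((hg w).hasDerivAt.const_mul c).deriv
  simp only [lg, this]; ring

/-- Changing the fourth root by c with c² = -1 exchanges the growing and the decaying coefficient,
whereas c² = 1 only scales both. -/
lemma lg_root_mul (Q : ℂ → ℂ) (ħ p c : ℂ) (hc : c ^ 4 = 1) (g : ℂ → ℂ) (w : ℂ) :
    lg Q (c ^ 2 * ħ) (c * p) g w = c * lg Q ħ p g w := by
  have h0 : c ≠ 0 := by rintro rfl; norm_num at hc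
  rcases eq_or_ne p 0 with rfl | hp
  · simp [lg]
  · simp only [lg]; field_simp

/-- The passage from (g, g') to the two coefficients is linear, so the Wronskian becomes their 2×2
determinant up to the constant -ħ/2. -/
lemma wr_eq_lg (Q : ℂ → ℂ) {ħ p : ℂ} (hp : p ≠ 0) (g h : ℂ → ℂ) (w : ℂ) :
    -ħ / 2 * wr g h w = lg Q ħ p g w * lg Q (-ħ) p h w - lg Q (-ħ) p g w * lg Q ħ p h w := by
  simp only [wr, lg]; field_simp; ring

/-- `γ` is a curve, parametrized over `I`, with derivative `γ'`, along which `Q` does not vanish;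
`p` is a continuous fourth root of `Q` and `T` a primitive of `p²` along it. -/
structure LGPath (Q : ℂ → ℂ) (γ γ' p T : ℝ → ℂ) (I : Set ℝ) : Prop where
  tangent : ∀ τ ∈ I, HasDerivAt γ (γ' τ) τ
  cont : ContinuousOn γ' I
  deriv_root : ∀ τ ∈ I, HasDerivAt p (deriv Q (γ τ) / (4 * Q (γ τ)) * γ' τ * p τ) τ
  root : ∀ τ ∈ I, p τ ^ 4 = Q (γ τ)
  ne_zero : ∀ τ ∈ I, Q (γ τ) ≠ 0
  deriv_action : ∀ τ ∈ I, HasDerivAt T (p τ ^ 2 * γ' τ) τ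

lemma LGPath.mono {Q : ℂ → ℂ} {γ γ' p T : ℝ → ℂ} {I J : Set ℝ} (h : LGPath Q γ γ' p T I)
    (hJ : J ⊆ I) : LGPath Q γ γ' p T J :=
  ⟨fun τ hτ => h.tangent τ (hJ hτ), h.cont.mono hJ, fun τ hτ => h.deriv_root τ (hJ hτ),
    fun τ hτ => h.root τ (hJ hτ), fun τ hτ => h.ne_zero τ (hJ hτ),
    fun τ hτ => h.deriv_action τ (hJ hτ)⟩

lemma LGPath.root_ne_zero {Q : ℂ → ℂ} {γ γ' p T : ℝ → ℂ} {I : Set ℝ} (h : LGPath Q γ γ' p T I)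
    {τ : ℝ} (hτ : τ ∈ I) : p τ ≠ 0 := by
  intro h0
  have := h.root τ hτ
  rw [h0] at this
  exact h.ne_zero τ hτ (by rw [← this]; simp)

/-- With y = pg and dT = p² dw, the coefficients are (y ± ħ dy/dT)/2. In the variable T the equation
for y is the constant coefficient one plus a perturbation, and that perturbation is what `errF`
measures; the term Q'/(4Q) in `lg` is p'/p. -/
lemma LGPath.lg_hasDerivAt {Q : ℂ → ℂ} (hQ : Differentiable ℂ Q) {γ γ' p T : ℝ → ℂ} {I : Set ℝ}
    (h : LGPath Q γ γ' p T I) {ħ : ℂ} (hħ : ħ ≠ 0) {g : ℂ → ℂ}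
    (hg : IsSol (fun w => Q w / ħ ^ 2) g) {τ : ℝ} (hτ : τ ∈ I) :
    HasDerivAt (fun τ => lg Q ħ (p τ) g (γ τ))
      (p τ ^ 2 * γ' τ / ħ * lg Q ħ (p τ) g (γ τ) - ħ / 2 * (errF Q (p τ ^ 2) (γ τ) * γ' τ) *
        (lg Q ħ (p τ) g (γ τ) + lg Q (-ħ) (p τ) g (γ τ))) τ := by
  have hp0 := h.root_ne_zero hτ
  have hQ0 := h.ne_zero τ hτ
  have hγ := h.tangent τ hτ
  have hp := h.deriv_root τ hτ
  have h1 := (hg.hasDerivAt (γ τ)).comp τ hγ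
  have h2 := (hg.hasDerivAt_deriv (γ τ)).comp τ hγ
  have h3 := (hQ (γ τ)).hasDerivAt.comp τ hγ
  have h4 := (differentiable_deriv hQ (γ τ)).hasDerivAt.comp τ hγ
  have h5 := h4.div (h3.const_mul 4) (by simpa using hQ0)
  have h6 := ((hp.mul h1).add (((hasDerivAt_const τ ħ).div hp hp0).mul
    (h2.add (h5.mul h1)))).div_const 2
  refine (h6.congr_deriv ?_)
  rw [lg_add_lg]
  have h4 := h.root τ hτ
  simp only [lg, errF, Function.comp, Pi.mul_apply, Pi.add_apply, Pi.div_apply] at *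
  generalize deriv g (γ τ) = g1 at *
  generalize g (γ τ) = g0 at *
  generalize deriv (deriv Q) (γ τ) = Q2 at *
  generalize deriv Q (γ τ) = Q1 at *
  generalize Q (γ τ) = Q0 at *
  generalize p τ = p0 at *
  subst h4
  field_simp
  ring

lemma LGPath.continuousOn_errF {Q : ℂ → ℂ} (hQ : Differentiable ℂ Q) {γ γ' p T : ℝ → ℂ} {I : Set ℝ}
    (h : LGPath Q γ γ' p T I) : ContinuousOn (fun τ => errF Q (p τ ^ 2) (γ τ) * γ' τ) I := by
  have hγ : ContinuousOn γ I := fun τ hτ => (h.tangent τ hτ).continuousAt.continuousWithinAt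
  have hp : ContinuousOn p I := fun τ hτ => (h.deriv_root τ hτ).continuousAt.continuousWithinAt
  have h0 : ContinuousOn (fun τ => Q (γ τ)) I := hQ.continuous.comp_continuousOn hγ
  have h1 : ContinuousOn (fun τ => deriv Q (γ τ)) I :=
    (differentiable_deriv hQ).continuous.comp_continuousOn hγ
  have h2 : ContinuousOn (fun τ => deriv (deriv Q) (γ τ)) I :=
    (differentiable_deriv (differentiable_deriv hQ)).continuous.comp_continuousOn hγ
  refine ContinuousOn.mul (ContinuousOn.div (ContinuousOn.div ?_ ?_ ?_) (hp.pow 2) ?_) h.cont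
  · exact ((continuousOn_const.mul h2).mul h0).add (continuousOn_const.mul (h1.pow 2))
  · exact continuousOn_const.mul (h0.pow 2)
  · intro τ hτ
    exact mul_ne_zero (by norm_num) (pow_ne_zero 2 (h.ne_zero τ hτ))
  · intro τ hτ
    exact pow_ne_zero 2 (h.root_ne_zero hτ)

/-- Transport of the Liouville–Green approximation along a curve on which `Re (T / ħ)` does not
decrease. -/
lemma LGPath.transport {Q : ℂ → ℂ} (hQ : Differentiable ℂ Q) {γ γ' p T : ℝ → ℂ} {s t : ℝ}
    (h : LGPath Q γ γ' p T (Icc s t)) (hst : s ≤ t) {ħ : ℂ} (hħ : ħ ≠ 0) {g : ℂ → ℂ}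
    (hg : IsSol (fun w => Q w / ħ ^ 2) g)
    (hmono : ∀ x ∈ Icc s t, ∀ y ∈ Icc s t, x ≤ y → 0 ≤ ((T y - T x) / ħ).re) :
    1 + dev Q ħ (p t) (T t) g (γ t) ≤ (1 + dev Q ħ (p s) (T s) g (γ s)) *
      Real.exp (‖ħ‖ * ∫ τ in s..t, ‖errF Q (p τ ^ 2) (γ τ) * γ' τ‖) := by
  set f : ℝ → ℂ := fun τ => errF Q (p τ ^ 2) (γ τ) * γ' τ with hf
  have hfc : ContinuousOn f (Icc s t) := h.continuousOn_errF hQ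
  have hg' : IsSol (fun w => Q w / (-ħ) ^ 2) g := by simpa using hg
  have hTd : ∀ τ ∈ Icc s t, HasDerivAt (fun τ => Complex.exp (-(T τ / ħ)))
      (Complex.exp (-(T τ / ħ)) * -(p τ ^ 2 * γ' τ / ħ)) τ := fun τ hτ =>
    ((h.deriv_action τ hτ).div_const ħ).fun_neg.cexp
  set A : ℝ → ℂ := fun τ => lg Q ħ (p τ) g (γ τ) * Complex.exp (-(T τ / ħ)) with hA
  set b : ℝ → ℂ := fun τ => lg Q (-ħ) (p τ) g (γ τ) * Complex.exp (-(T τ / ħ)) with hb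
  have hAd : ∀ τ ∈ Icc s t, HasDerivAt A (-(ħ / 2 * f τ * (A τ + b τ))) τ := fun τ hτ => by
    refine ((h.lg_hasDerivAt hQ hħ hg hτ).mul (hTd τ hτ)).congr_deriv ?_
    simp only [hA, hb, hf]; ring
  have hbd : ∀ τ ∈ Icc s t, HasDerivAt b
      (-(2 * (p τ ^ 2 * γ' τ / ħ) * b τ) + ħ / 2 * f τ * (A τ + b τ)) τ := fun τ hτ => by
    refine ((h.lg_hasDerivAt hQ (neg_ne_zero.2 hħ) hg' hτ).mul (hTd τ hτ)).congr_deriv ?_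
    simp only [hA, hb, hf, neg_neg]; ring
  have hAc : ContinuousOn A (Icc s t) := fun τ hτ => (hAd τ hτ).continuousAt.continuousWithinAt
  have hbc : ContinuousOn b (Icc s t) := fun τ hτ => (hbd τ hτ).continuousAt.continuousWithinAt
  have hTc : ContinuousOn T (Icc s t) := fun τ hτ =>
    (h.deriv_action τ hτ).continuousAt.continuousWithinAt
  -- A and b obey equations with the same perturbation ħ f (A + b)/2 up to sign, and |A + b| is at
  -- most 1 plus the deviation. Each of the two accounts for half of the kernel k in the Grönwall
  -- inequality.
  have key : ∀ τ, ‖ħ / 2 * f τ * (A τ + b τ)‖ ≤ ‖ħ‖ * ‖f τ‖ * (1 + (‖A τ - 1‖ + ‖b τ‖)) / 2 := by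
    intro τ
    have h1 : ‖A τ + b τ‖ ≤ 1 + (‖A τ - 1‖ + ‖b τ‖) := by
      calc ‖A τ + b τ‖ = ‖1 + ((A τ - 1) + b τ)‖ := by congr 1; ring
        _ ≤ ‖(1 : ℂ)‖ + ‖(A τ - 1) + b τ‖ := norm_add_le _ _
        _ ≤ _ := by rw [norm_one]; gcongr; exact norm_add_le _ _
    rw [norm_mul, norm_mul, norm_div, Complex.norm_ofNat]
    calc ‖ħ‖ / 2 * ‖f τ‖ * ‖A τ + b τ‖ ≤ ‖ħ‖ / 2 * ‖f τ‖ * (1 + (‖A τ - 1‖ + ‖b τ‖)) := by gcongr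
      _ = _ := by ring
  set k : ℝ → ℝ := fun τ => ‖ħ‖ * ‖f τ‖ with hk
  set u : ℝ → ℝ := fun τ => 1 + (‖A τ - 1‖ + ‖b τ‖) with hu
  have hkc : ContinuousOn k (Icc s t) := continuousOn_const.mul hfc.norm
  have huc : ContinuousOn u (Icc s t) :=
    continuousOn_const.add ((hAc.sub continuousOn_const).norm.add hbc.norm)
  have main : ∀ x ∈ Icc s t, u x ≤ u s + ∫ τ in s..x, k τ * u τ := by
    intro x hx
    have hsub : Icc s x ⊆ Icc s t := Icc_subset_Icc_right hx.2
    have hint : IntervalIntegrable (fun τ => k τ * u τ / 2) MeasureTheory.volume s x :=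
      (((hkc.mul huc).div_const 2).mono hsub).intervalIntegrable_of_Icc hx.1
    have e1 : ‖A x - A s‖ ≤ ∫ τ in s..x, k τ * u τ / 2 := by
      rw [← intervalIntegral.integral_eq_sub_of_hasDerivAt (f := A) (a := s) (b := x)
        (f' := fun τ => -(ħ / 2 * f τ * (A τ + b τ)))]
      · refine intervalIntegral.norm_integral_le_of_norm_le hx.1 ?_ hint
        refine Eventually.of_forall fun τ _ => ?_
        rw [norm_neg]
        exact key τ
      · intro τ hτ
        rw [uIcc_of_le hx.1] at hτ
        exact hAd τ (hsub hτ)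
      · exact ContinuousOn.intervalIntegrable_of_Icc hx.1
          ((((continuousOn_const.mul hfc).mul (hAc.add hbc)).neg).mono hsub)
    -- Integrating factor of the damped equation for b. Its norm is at most 1 exactly because
    -- Re(T/ħ) does not decrease.
    set D : ℝ → ℂ := fun τ => Complex.exp (-(2 * ((T x - T τ) / ħ))) with hD
    have hDn : ∀ τ ∈ Icc s x, ‖D τ‖ ≤ 1 := fun τ hτ => by
      rw [hD]
      simp only [Complex.norm_exp]
      rw [Real.exp_le_one_iff]
      have := hmono τ (hsub hτ) x hx hτ.2
      simp only [Complex.neg_re, Complex.mul_re, Complex.re_ofNat, Complex.im_ofNat, zero_mul, sub_zero]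
      linarith
    have hDd : ∀ τ ∈ Icc s t, HasDerivAt D (D τ * (2 * (p τ ^ 2 * γ' τ / ħ))) τ := fun τ hτ => by
      refine ((((h.deriv_action τ hτ).const_sub (T x)).div_const ħ).const_mul 2).fun_neg.cexp.congr_deriv ?_
      simp only [hD]; ring
    have e2 : ‖b x - D s * b s‖ ≤ ∫ τ in s..x, k τ * u τ / 2 := by
      have hDx : D x = 1 := by simp [hD]
      have hd : ∀ τ ∈ Icc s t, HasDerivAt (fun τ => D τ * b τ)
          (D τ * (ħ / 2 * f τ * (A τ + b τ))) τ := fun τ hτ => by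
        refine ((hDd τ hτ).mul (hbd τ hτ)).congr_deriv ?_
        ring
      have e : b x - D s * b s = D x * b x - D s * b s := by rw [hDx, one_mul]
      rw [e, ← intervalIntegral.integral_eq_sub_of_hasDerivAt (f := fun τ => D τ * b τ)
        (a := s) (b := x) (f' := fun τ => D τ * (ħ / 2 * f τ * (A τ + b τ)))]
      · refine intervalIntegral.norm_integral_le_of_norm_le hx.1 ?_ hint
        refine Eventually.of_forall fun τ hτ => ?_
        rw [norm_mul]
        calc ‖D τ‖ * _ ≤ 1 * _ := by
              gcongr
              exact hDn τ (Ioc_subset_Icc_self hτ)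
          _ ≤ _ := by rw [one_mul]; exact key τ
      · intro τ hτ
        rw [uIcc_of_le hx.1] at hτ
        exact hd τ (hsub hτ)
      · have hDc : ContinuousOn D (Icc s t) := fun τ hτ =>
          (hDd τ hτ).continuousAt.continuousWithinAt
        exact ContinuousOn.intervalIntegrable_of_Icc hx.1
          ((hDc.mul ((continuousOn_const.mul hfc).mul (hAc.add hbc))).mono hsub)
    have e3 : ∫ τ in s..x, k τ * u τ = 2 * ∫ τ in s..x, k τ * u τ / 2 := by
      rw [intervalIntegral.integral_div]; ring
    have e4 : ‖A x - 1‖ ≤ ‖A x - A s‖ + ‖A s - 1‖ := norm_sub_le_norm_sub_add_norm_sub _ _ _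
    have e5 : ‖b x‖ ≤ ‖b x - D s * b s‖ + ‖b s‖ := by
      have h1 : ‖b x‖ ≤ ‖b x - D s * b s‖ + ‖D s * b s‖ := norm_le_norm_sub_add _ _
      have h2 : ‖D s * b s‖ ≤ 1 * ‖b s‖ := by
        rw [norm_mul]; gcongr; exact hDn s ⟨le_refl s, hx.1⟩
      linarith
    simp only [hu] at *
    linarith
  have := gronwall_integral hst huc hkc (fun x _ => by positivity) main
  rw [hk, intervalIntegral.integral_const_mul] at this
  exact this

end

section

/-! ### Fourth roots on a region -/

/-- On `U`, `p` is a holomorphic fourth root of the non-vanishing function `Q`, and `S` is a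
primitive of `p²`. -/
structure RootOn (Q p S : ℂ → ℂ) (U : Set ℂ) : Prop where
  root : ∀ w ∈ U, p w ^ 4 = Q w
  ne_zero : ∀ w ∈ U, Q w ≠ 0
  deriv_root : ∀ w ∈ U, HasDerivAt p (deriv Q w / (4 * Q w) * p w) w
  deriv_action : ∀ w ∈ U, HasDerivAt S (p w ^ 2) w

lemma RootOn.mono {Q p S : ℂ → ℂ} {U V : Set ℂ} (h : RootOn Q p S U) (hV : V ⊆ U) :
    RootOn Q p S V :=
  ⟨fun w hw => h.root w (hV hw), fun w hw => h.ne_zero w (hV hw),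
    fun w hw => h.deriv_root w (hV hw), fun w hw => h.deriv_action w (hV hw)⟩

lemma RootOn.root_ne_zero {Q p S : ℂ → ℂ} {U : Set ℂ} (h : RootOn Q p S U) {w : ℂ} (hw : w ∈ U) :
    p w ≠ 0 := by
  intro h0
  have := h.root w hw
  rw [h0] at this
  exact h.ne_zero w hw (by rw [← this]; simp)

lemma exists_primitive_of_convex {f : ℂ → ℂ} {U : Set ℂ} (hU : Convex ℝ U) (hUo : IsOpen U)
    (hf : DifferentiableOn ℂ f U) (w₀ a : ℂ) :
    ∃ F : ℂ → ℂ, F w₀ = a ∧ ∀ w ∈ U, HasDerivAt F (f w) w := by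
  obtain ⟨F, hF⟩ := hU.exists_forall_hasDerivWithinAt hf
  refine ⟨fun w => F w - F w₀ + a, by simp, fun w hw => ?_⟩
  exact (((hF w hw).hasDerivAt (hUo.mem_nhds hw)).sub_const _).add_const _

lemma eq_of_deriv_eq {f g f' : ℂ → ℂ} {U : Set ℂ} (hU : Convex ℝ U) (hUo : IsOpen U)
    (hf : ∀ w ∈ U, HasDerivAt f (f' w) w) (hg : ∀ w ∈ U, HasDerivAt g (f' w) w) {z w : ℂ}
    (hz : z ∈ U) (hw : w ∈ U) : f z - g z = f w - g w := by
  have hd : ∀ w ∈ U, HasDerivAt (fun w => f w - g w) 0 w := fun w hw => by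
    simpa using (hf w hw).fun_sub (hg w hw)
  exact hU.is_const_of_fderivWithin_eq_zero (𝕜 := ℂ) (f := fun w => f w - g w)
    (fun w hw => (hd w hw).differentiableAt.differentiableWithinAt)
    (fun w hw => by
      rw [fderivWithin_of_isOpen hUo hw]
      ext
      simpa using (hd w hw).deriv) hz hw

/-- Exponentiate a primitive of Q'/(4Q), which exists on a convex region; p⁴/Q then has zero
derivative and equals 1 at the base point. -/
lemma exists_rootOn {Q : ℂ → ℂ} (hQ : Differentiable ℂ Q) {U : Set ℂ} (hU : Convex ℝ U)
    (hUo : IsOpen U) (h0 : ∀ w ∈ U, Q w ≠ 0) {w₀ : ℂ} (hw₀ : w₀ ∈ U) {p₀ : ℂ}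
    (hp₀ : p₀ ^ 4 = Q w₀) (S₀ : ℂ) :
    ∃ p S, RootOn Q p S U ∧ p w₀ = p₀ ∧ S w₀ = S₀ := by
  have hd : DifferentiableOn ℂ (fun w => deriv Q w / (4 * Q w)) U := fun w hw =>
    ((differentiable_deriv hQ w).div ((hQ w).const_mul 4)
      (by simpa using h0 w hw)).differentiableWithinAt
  obtain ⟨Λ, hΛ0, hΛ⟩ := exists_primitive_of_convex hU hUo hd w₀ 0
  have hp : ∀ w ∈ U, HasDerivAt (fun w => p₀ * Complex.exp (Λ w))
      (deriv Q w / (4 * Q w) * (p₀ * Complex.exp (Λ w))) w := fun w hw =>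
    ((hΛ w hw).cexp.const_mul p₀).congr_deriv (by ring)
  obtain ⟨S, hS0, hS⟩ := exists_primitive_of_convex hU hUo
    (f := fun w => (p₀ * Complex.exp (Λ w)) ^ 2)
    (fun w hw => ((hp w hw).differentiableAt.pow 2).differentiableWithinAt) w₀ S₀
  refine ⟨_, S, ⟨?_, h0, hp, hS⟩, by simp [hΛ0], hS0⟩
  have hr : ∀ w ∈ U, HasDerivAt (fun w => (p₀ * Complex.exp (Λ w)) ^ 4 / Q w) 0 w := fun w hw => by
    have hQw := h0 w hw
    refine (((hp w hw).fun_pow 4).div (hQ w).hasDerivAt hQw).congr_deriv ?_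
    field_simp
    ring
  intro w hw
  have := eq_of_deriv_eq hU hUo hr (g := fun _ => 0) (fun w _ => hasDerivAt_const w 0) hw hw₀
  have e : (p₀ * Complex.exp (Λ w₀)) ^ 4 / Q w₀ = 1 := by
    rw [hΛ0, Complex.exp_zero, mul_one, hp₀, div_self (h0 _ hw₀)]
  simp only [sub_zero, e] at this
  exact (div_eq_one_iff_eq (h0 w hw)).1 this

/-- Two fourth roots on a convex region differ by a fourth root of unity, and the primitives
correspondingly. -/
lemma RootOn.unique {Q p S p' S' : ℂ → ℂ} {U : Set ℂ} (hU : Convex ℝ U) (hUo : IsOpen U)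
    (h : RootOn Q p S U) (h' : RootOn Q p' S' U) {w₀ : ℂ} (hw₀ : w₀ ∈ U) :
    ∃ c d : ℂ, c ^ 4 = 1 ∧ ∀ w ∈ U, p' w = c * p w ∧ S' w = c ^ 2 * S w + d := by
  have hr : ∀ w ∈ U, HasDerivAt (fun w => p' w / p w) 0 w := fun w hw => by
    refine ((h'.deriv_root w hw).div (h.deriv_root w hw) (h.root_ne_zero hw)).congr_deriv ?_
    have := h.root_ne_zero hw
    field_simp
    ring
  have hp : ∀ w ∈ U, p' w = p' w₀ / p w₀ * p w := fun w hw => by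
    have := eq_of_deriv_eq hU hUo hr (g := fun _ => 0) (fun w _ => hasDerivAt_const w 0) hw hw₀
    simp only [sub_zero] at this
    rw [← this, div_mul_cancel₀ _ (h.root_ne_zero hw)]
  refine ⟨p' w₀ / p w₀, S' w₀ - (p' w₀ / p w₀) ^ 2 * S w₀, ?_, fun w hw => ⟨hp w hw, ?_⟩⟩
  · rw [div_pow, h'.root _ hw₀, h.root _ hw₀, div_self (h.ne_zero _ hw₀)]
  · have := eq_of_deriv_eq hU hUo h'.deriv_action (g := fun w => (p' w₀ / p w₀) ^ 2 * S w)
      (fun w hw => ((h.deriv_action w hw).const_mul _).congr_deriv (by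
        rw [hp w hw]; ring)) hw hw₀
    linear_combination this

lemma RootOn.lgPath {Q p S : ℂ → ℂ} {U : Set ℂ} (h : RootOn Q p S U) {γ γ' : ℝ → ℂ} {I : Set ℝ}
    (hγ : ∀ τ ∈ I, HasDerivAt γ (γ' τ) τ) (hγ' : ContinuousOn γ' I) (hU : ∀ τ ∈ I, γ τ ∈ U) :
    LGPath Q γ γ' (fun τ => p (γ τ)) (fun τ => S (γ τ)) I where
  tangent := hγ
  cont := hγ'
  deriv_root τ hτ := ((h.deriv_root _ (hU τ hτ)).comp τ (hγ τ hτ)).congr_deriv (by ring)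
  root τ hτ := h.root _ (hU τ hτ)
  ne_zero τ hτ := h.ne_zero _ (hU τ hτ)
  deriv_action τ hτ := (h.deriv_action _ (hU τ hτ)).comp τ (hγ τ hτ)

/-! ### Solutions near an end of the plane -/

lemma hasDerivAt_re {f : ℝ → ℂ} {f' : ℂ} {x : ℝ} (hf : HasDerivAt f f' x) :
    HasDerivAt (fun x => (f x).re) f'.re x :=
  Complex.reCLM.hasFDerivAt.comp_hasDerivAt x hf

/-- The half plane `M < η re w`, where `η = ±1`. -/
def halfPlane (η M : ℝ) : Set ℂ := {w | M < η * w.re}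

lemma convex_halfPlane (η M : ℝ) : Convex ℝ (halfPlane η M) :=
  convex_halfSpace_gt (f := fun w : ℂ => η * w.re)
    ⟨fun x y => by simp [mul_add], fun c x => by simp; ring⟩ M

lemma isOpen_halfPlane (η M : ℝ) : IsOpen (halfPlane η M) :=
  isOpen_lt continuous_const (by fun_prop)

/-- A half plane `H` with a fourth root of `Q`, such that the error control function decays
exponentially, and on the base line `im w = y₀` the function `re (S / ħ)` grows outwards. -/
structure EndData (Q : ℂ → ℂ) (ħ : ℂ) (p S : ℂ → ℂ) (η M K c y₀ m : ℝ) : Prop where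
  entire : Differentiable ℂ Q
  hbar : ħ ≠ 0
  sign : η ^ 2 = 1
  rootOn : RootOn Q p S (halfPlane η M)
  K_pos : 0 < K
  c_pos : 0 < c
  m_pos : 0 < m
  bound : ∀ w ∈ halfPlane η M, ‖errF Q (p w ^ 2) w‖ ≤ K * Real.exp (-(c * (η * w.re)))
  base : ∀ w ∈ halfPlane η M, w.im = y₀ → m ≤ (p w ^ 2 * η / ħ).re

/-- On the strip `|im w - y₀| ≤ b`, far out, `re (S / ħ)` grows in the direction pointing
outwards and towards the base line. -/
def Inward (ħ : ℂ) (p : ℂ → ℂ) (η y₀ b : ℝ) : Prop :=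
  ∃ c₀ > 0, ∃ M₀ : ℝ, ∀ e : ℝ, e ^ 2 = 1 → ∀ w ∈ halfPlane η M₀, 0 ≤ e * (w.im - y₀) →
    e * (w.im - y₀) ≤ b → 0 ≤ (p w ^ 2 * ((c₀ * η : ℝ) - (e : ℝ) * Complex.I) / ħ).re

/-- On the strip `|im w - y₀| ≤ b`, far out, `re (S / ħ)` grows in a direction pointing
outwards and away from the base line. -/
def Outward (ħ : ℂ) (p : ℂ → ℂ) (η y₀ b : ℝ) : Prop :=
  ∃ c₀ > 0, ∃ M₀ : ℝ, ∀ e : ℝ, e ^ 2 = 1 → ∀ w ∈ halfPlane η M₀, 0 ≤ e * (w.im - y₀) →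
    e * (w.im - y₀) ≤ b → 0 ≤ (p w ^ 2 * ((c₀ * η : ℝ) + (e : ℝ) * Complex.I) / ħ).re

/-- The filter of `η re w → ∞` in a strip. -/
def stripFilter (η y₀ b : ℝ) : Filter ℂ :=
  comap (fun w : ℂ => η * w.re) atTop ⊓ 𝓟 {w : ℂ | |w.im - y₀| ≤ b}

lemma hasDerivAt_line (z d : ℂ) (τ : ℝ) : HasDerivAt (fun τ : ℝ => z + τ * d) d τ := by
  simpa using ((Complex.ofRealCLM.hasDerivAt (x := τ)).mul_const d).const_add z

lemma RootOn.action_mono {Q p S : ℂ → ℂ} {U : Set ℂ} (h : RootOn Q p S U) {ħ z d : ℂ} {s t : ℝ}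
    {m : ℝ} (hU : ∀ τ ∈ Icc s t, z + τ * d ∈ U)
    (hm : ∀ τ ∈ Icc s t, m ≤ (p (z + τ * d) ^ 2 * d / ħ).re) {x y : ℝ} (hx : x ∈ Icc s t)
    (hy : y ∈ Icc s t) (hxy : x ≤ y) :
    m * (y - x) ≤ ((S (z + y * d) - S (z + x * d)) / ħ).re := by
  have hd : ∀ τ ∈ Icc s t, HasDerivAt (fun τ : ℝ => (S (z + τ * d) / ħ).re - m * τ)
      ((p (z + τ * d) ^ 2 * d / ħ).re - m) τ := fun τ hτ => by
    have h1 := ((h.deriv_action _ (hU τ hτ)).comp τ (hasDerivAt_line z d τ)).div_const ħ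
    simpa using (hasDerivAt_re h1).fun_sub ((hasDerivAt_id τ).const_mul m)
  have := monotoneOn_of_deriv_nonneg (convex_Icc s t)
    (fun τ hτ => (hd τ hτ).continuousAt.continuousWithinAt)
    (fun τ hτ => (hd τ (interior_subset hτ)).differentiableAt.differentiableWithinAt)
    (fun τ hτ => by
      rw [(hd τ (interior_subset hτ)).deriv]
      linarith [hm τ (interior_subset hτ)]) hx hy hxy
  simp only at this
  rw [sub_div, Complex.sub_re]
  linarith

lemma integral_exp_le {a κ c ℓ L : ℝ} (hc : 0 < c) (hκ : κ ≠ 0) (h0 : L ≤ a)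
    (h1 : L ≤ a + κ * ℓ) :
    ∫ τ in (0 : ℝ)..ℓ, Real.exp (-(c * (a + κ * τ))) ≤ Real.exp (-(c * L)) / (c * |κ|) := by
  have hd : ∀ τ : ℝ, HasDerivAt (fun τ => -(Real.exp (-(c * (a + κ * τ))) / (c * κ)))
      (Real.exp (-(c * (a + κ * τ)))) τ := fun τ => by
    have h1 : HasDerivAt (fun τ : ℝ => -(c * (a + κ * τ))) (-(c * κ)) τ := by
      simpa using ((((hasDerivAt_id τ).const_mul κ).const_add a).const_mul c).fun_neg
    refine (h1.exp.div_const (c * κ)).fun_neg.congr_deriv ?_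
    field_simp
  rw [intervalIntegral.integral_eq_sub_of_hasDerivAt (fun τ _ => hd τ)
    (by apply Continuous.intervalIntegrable; fun_prop)]
  have e0 : Real.exp (-(c * (a + κ * 0))) ≤ Real.exp (-(c * L)) := by
    rw [mul_zero, add_zero]
    exact Real.exp_le_exp.2 (by nlinarith)
  have e1 : Real.exp (-(c * (a + κ * ℓ))) ≤ Real.exp (-(c * L)) := Real.exp_le_exp.2 (by nlinarith)
  have p0 := Real.exp_pos (-(c * (a + κ * 0)))
  have p1 := Real.exp_pos (-(c * (a + κ * ℓ)))
  rcases lt_or_gt_of_ne hκ with h | h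
  · rw [abs_of_neg h]
    have hn : 0 < c * -κ := by nlinarith
    rw [show c * κ = -(c * -κ) by ring, div_neg, div_neg, neg_neg, neg_neg, ← sub_div]
    gcongr
    linarith
  · rw [abs_of_pos h]
    have hn : 0 < c * κ := by positivity
    rw [sub_neg_eq_add, neg_add_eq_sub, ← sub_div]
    gcongr
    linarith

/-- Transport along a straight segment lying beyond the level L. Since the error decays
exponentially and d is not vertical, the bound does not involve the length of the segment, so
starting points may go to infinity. Both ħ' = ħ and ħ' = -ħ are covered, for growing and for
decaying solutions. -/
lemma EndData.dev_line {Q : ℂ → ℂ} {ħ : ℂ} {p S : ℂ → ℂ} {η M K c y₀ m : ℝ}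
    (h : EndData Q ħ p S η M K c y₀ m) {ħ' : ℂ} (hħ' : ħ' ^ 2 = ħ ^ 2) {g : ℂ → ℂ}
    (hg : IsSol (fun w => Q w / ħ ^ 2) g) {z d w : ℂ} {ℓ L : ℝ} (hℓ : 0 ≤ ℓ) (hd : d.re ≠ 0)
    (hw : w = z + ℓ * d) (hM : M < L) (hL0 : L ≤ η * z.re) (hL1 : L ≤ η * w.re)
    (hm : ∀ τ ∈ Icc (0 : ℝ) ℓ, 0 ≤ (p (z + τ * d) ^ 2 * d / ħ').re) :
    1 + dev Q ħ' (p w) (S w) g w ≤ (1 + dev Q ħ' (p z) (S z) g z) *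
      Real.exp (‖ħ‖ * (K * ‖d‖ / (c * |d.re|) * Real.exp (-(c * L)))) := by
  have hħ0 : ħ' ≠ 0 := by
    rintro rfl
    exact h.hbar (by simpa using hħ'.symm)
  have hn : ‖ħ'‖ = ‖ħ‖ := by
    have := congrArg norm hħ'
    rw [norm_pow, norm_pow] at this
    exact (pow_left_inj₀ (norm_nonneg _) (norm_nonneg _) two_ne_zero).1 this
  have hη1 : |η| = 1 := by rw [← sq_eq_sq₀ (abs_nonneg _) zero_le_one, sq_abs, h.sign, one_pow]
  have hre : ∀ τ : ℝ, η * (z + τ * d).re = η * z.re + η * d.re * τ := fun τ => by simp; ring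
  have hU : ∀ τ ∈ Icc (0 : ℝ) ℓ, z + τ * d ∈ halfPlane η M := fun τ hτ => by
    rw [hw, hre] at hL1
    show M < _
    rw [hre]
    rcases le_total 0 (η * d.re) with h1 | h1
    · nlinarith [mul_nonneg h1 hτ.1]
    · nlinarith [mul_le_mul_of_nonpos_left hτ.2 h1]
  have hpath := h.rootOn.lgPath (γ := fun τ : ℝ => z + τ * d) (γ' := fun _ => d)
    (fun τ _ => hasDerivAt_line z d τ) continuousOn_const hU
  have hg' : IsSol (fun w => Q w / ħ' ^ 2) g := by rw [hħ']; exact hg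
  have := hpath.transport h.entire hℓ hħ0 hg' (fun x hx y hy hxy => by
    have := h.rootOn.action_mono (m := 0) hU hm hx hy hxy
    simpa using this)
  simp only [Complex.ofReal_zero, zero_mul, add_zero, ← hw, hn] at this
  refine this.trans ?_
  have hdev : 0 ≤ 1 + dev Q ħ' (p z) (S z) g z := by unfold dev; positivity
  gcongr
  have hκ : η * d.re ≠ 0 := mul_ne_zero (by rintro rfl; simp at hη1) hd
  have hb : ∫ τ in (0 : ℝ)..ℓ, ‖errF Q (p (z + τ * d) ^ 2) (z + τ * d) * d‖ ≤
      ∫ τ in (0 : ℝ)..ℓ, K * ‖d‖ * Real.exp (-(c * (η * z.re + η * d.re * τ))) := by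
    refine intervalIntegral.integral_mono_on hℓ ?_ ?_ fun τ hτ => ?_
    · exact ((hpath.continuousOn_errF h.entire).norm).intervalIntegrable_of_Icc hℓ
    · apply Continuous.intervalIntegrable; fun_prop
    · rw [norm_mul]
      have := h.bound _ (hU τ hτ)
      rw [hre] at this
      calc _ ≤ K * Real.exp (-(c * (η * z.re + η * d.re * τ))) * ‖d‖ := by gcongr
        _ = _ := by ring
  refine hb.trans ?_
  rw [intervalIntegral.integral_const_mul]
  have h3 := integral_exp_le h.c_pos hκ hL0 (ℓ := ℓ) (by rw [hw, hre] at hL1; exact hL1)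
  rw [abs_mul, hη1, one_mul] at h3
  have hK := h.K_pos
  calc K * ‖d‖ * _ ≤ K * ‖d‖ * (Real.exp (-(c * L)) / (c * |d.re|)) := by gcongr
    _ = _ := by ring

end

/-! ### Subdominant solutions at an end: existence on the base line, asymptotics in strips -/

section

lemma dev_nonneg (Q : ℂ → ℂ) (ħ p T : ℂ) (g : ℂ → ℂ) (w : ℂ) : 0 ≤ dev Q ħ p T g w := by
  unfold dev; positivity

lemma lg_lin {P : ℂ → ℂ} (Q : ℂ → ℂ) (ħ p : ℂ) {g h : ℂ → ℂ} (hg : IsSol P g) (hh : IsSol P h)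
    (a b w : ℂ) :
    lg Q ħ p (fun w => a * g w + b * h w) w = a * lg Q ħ p g w + b * lg Q ħ p h w := by
  simp only [lg, deriv_lin hg hh]; ring

lemma eq_lin {P g h k : ℂ → ℂ} (hg : IsSol P g) (hh : IsSol P h) (hk : IsSol P k)
    (hw : wr g h 0 ≠ 0) : ∃ a b : ℂ, k = fun w => a * g w + b * h w := by
  refine ⟨-wr h k 0 / wr g h 0, -wr k g 0 / wr g h 0, funext fun w => ?_⟩
  have := wr_three g h k w
  rw [wr_const hg hh w 0, wr_const hh hk w 0, wr_const hk hg w 0] at this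
  field_simp
  linear_combination this

/-- Both coefficients can be prescribed at a point, because they determine the value and the
derivative of g there. -/
lemma exists_lg {Q : ℂ → ℂ} (hQ : Differentiable ℂ Q) {ħ p : ℂ} (hħ : ħ ≠ 0) (hp : p ≠ 0)
    (w x y : ℂ) :
    ∃ g, IsSol (fun w => Q w / ħ ^ 2) g ∧ lg Q ħ p g w = x ∧ lg Q (-ħ) p g w = y := by
  obtain ⟨g, hg, h0, h1⟩ := exists_isSol_at (P := fun w => Q w / ħ ^ 2) (by fun_prop) w
    ((x + y) / p) (p * (x - y) / ħ - deriv Q w / (4 * Q w) * ((x + y) / p))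
  refine ⟨g, hg, ?_, ?_⟩
  · simp only [lg, h0, h1]
    generalize deriv Q w / (4 * Q w) = L
    field_simp
    ring
  · simp only [lg, h0, h1]
    generalize deriv Q w / (4 * Q w) = L
    field_simp
    ring

lemma exists_dev_eq_zero {Q : ℂ → ℂ} (hQ : Differentiable ℂ Q) {ħ p : ℂ} (hħ : ħ ≠ 0) (hp : p ≠ 0)
    (T w : ℂ) : ∃ g, IsSol (fun w => Q w / ħ ^ 2) g ∧ dev Q ħ p T g w = 0 := by
  obtain ⟨g, hg, h0, h1⟩ := exists_lg hQ hħ hp w (Complex.exp (T / ħ)) 0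
  refine ⟨g, hg, ?_⟩
  simp [dev, h0, h1, ← Complex.exp_add]

variable {Q : ℂ → ℂ} {ħ : ℂ} {p S : ℂ → ℂ} {η M K c y₀ m : ℝ}

/-- A solution which is asymptotic to the decaying Liouville–Green solution along the base line. -/
lemma EndData.exists_subdominant (h : EndData Q ħ p S η M K c y₀ m) :
    ∃ χ, IsSol (fun w => Q w / ħ ^ 2) χ ∧ ∀ w ∈ halfPlane η M, w.im = y₀ →
      1 + dev Q (-ħ) (p w) (S w) χ w ≤
        Real.exp (‖ħ‖ * (K / c * Real.exp (-(c * (η * w.re))))) := by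
  have hħ' : -ħ ≠ 0 := neg_ne_zero.2 h.hbar
  have hηη : η * η = 1 := by rw [← sq, h.sign]
  have hη1 : |η| = 1 := by rw [← sq_eq_sq₀ (abs_nonneg _) zero_le_one, sq_abs, h.sign, one_pow]
  set z : ℝ → ℂ := fun u => ((η * u : ℝ) : ℂ) + (y₀ : ℂ) * Complex.I with hz
  have hzre : ∀ u, (z u).re = η * u := fun u => by simp [hz]
  have hzim : ∀ u, (z u).im = y₀ := fun u => by simp [hz]
  have hzη : ∀ u, η * (z u).re = u := fun u => by rw [hzre, ← mul_assoc, hηη, one_mul]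
  have hzH : ∀ u, M < u → z u ∈ halfPlane η M := fun u hu => by
    show M < _
    rwa [hzη]
  have hzw : ∀ w : ℂ, w.im = y₀ → z (η * w.re) = w := fun w hw => by
    apply Complex.ext
    · rw [hzre, ← mul_assoc, hηη, one_mul]
    · rw [hzim, hw]
  have hsol : ∀ n : ℕ, ∃ g, IsSol (fun w => Q w / ħ ^ 2) g ∧
      (M < n → dev Q (-ħ) (p (z n)) (S (z n)) g (z n) = 0) := fun n => by
    by_cases hn : M < n
    · obtain ⟨g, hg, h0⟩ := exists_dev_eq_zero h.entire hħ' (h.rootOn.root_ne_zero (hzH n hn))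
        (S (z n)) (z n)
      exact ⟨g, by simpa using hg, fun _ => h0⟩
    · exact ⟨fun _ => 0, ⟨differentiable_const _, fun w => by simp⟩, fun h => absurd h hn⟩
  choose χ hχ hχ0 using hsol
  -- The decaying solution grows inwards, so the transport runs from z n back to z u; the bound is
  -- uniform in n.
  have hdev : ∀ u, M < u → ∀ n : ℕ, u ≤ n →
      1 + dev Q (-ħ) (p (z u)) (S (z u)) (χ n) (z u) ≤
        Real.exp (‖ħ‖ * (K / c * Real.exp (-(c * u)))) := by
    intro u hu n hn
    have := h.dev_line (ħ' := -ħ) (by ring) (hχ n) (z := z n) (d := ((-η : ℝ) : ℂ)) (w := z u)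
      (ℓ := n - u) (L := u) (by linarith) (by simpa using fun h : η = 0 => by simp [h] at hηη)
      (by simp only [hz]; push_cast; ring) hu (by rw [hzη]; exact hn) (by rw [hzη]) (by
        intro τ hτ
        have e : z n + τ * ((-η : ℝ) : ℂ) = z (n - τ) := by simp only [hz]; push_cast; ring
        rw [e]
        have := h.base (z (n - τ)) (hzH _ (by linarith [hτ.2])) (hzim _)
        have hm := h.m_pos
        calc (0 : ℝ) ≤ _ := hm.le.trans this
          _ = _ := by congr 1; push_cast; ring)
    rw [hχ0 n (by linarith)] at this
    simpa [hη1] using this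
  set u₁ := |M| + 1 with hu₁
  have hu₁M : M < u₁ := by linarith [le_abs_self M]
  have hp1 := h.rootOn.root_ne_zero (hzH u₁ hu₁M)
  set X := Complex.exp (-(S (z u₁) / -ħ)) with hX
  have hX0 : X ≠ 0 := Complex.exp_ne_zero _
  -- A basis in which the coordinates of a solution are its normalized Liouville–Green coefficients
  -- at z u₁. The uniform bound on the deviation there confines the approximations to a compact set
  -- of coordinates.
  obtain ⟨G₁, hG₁, h11, h12⟩ := exists_lg h.entire hħ' hp1 (z u₁) X⁻¹ 0
  obtain ⟨G₂, hG₂, h21, h22⟩ := exists_lg h.entire hħ' hp1 (z u₁) 0 X⁻¹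
  have hG₁' : IsSol (fun w => Q w / ħ ^ 2) G₁ := by simpa using hG₁
  have hG₂' : IsSol (fun w => Q w / ħ ^ 2) G₂ := by simpa using hG₂
  have hW : wr G₁ G₂ 0 ≠ 0 := by
    intro h0
    have := wr_eq_lg Q (ħ := -ħ) hp1 G₁ G₂ (z u₁)
    rw [h11, h12, h21, h22, wr_const hG₁ hG₂ _ 0, h0] at this
    simp [hX0] at this
  choose a b hab using fun n => eq_lin hG₁' hG₂' (hχ n) hW
  have hdlin : ∀ (w : ℂ) (a b : ℂ), dev Q (-ħ) (p w) (S w) (fun w => a * G₁ w + b * G₂ w) w =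
      ‖(a * lg Q (-ħ) (p w) G₁ w + b * lg Q (-ħ) (p w) G₂ w) * Complex.exp (-(S w / -ħ)) - 1‖ +
      ‖(a * lg Q ħ (p w) G₁ w + b * lg Q ħ (p w) G₂ w) * Complex.exp (-(S w / -ħ))‖ := by
    intro w a b
    simp only [dev, lg_lin Q _ _ hG₁' hG₂', neg_neg]
  set B := Real.exp (‖ħ‖ * (K / c * Real.exp (-(c * u₁)))) with hB
  obtain ⟨N, hN⟩ := exists_nat_ge u₁
  have hbd : ∀ n, (a (n + N), b (n + N)) ∈ Metric.closedBall (0 : ℂ × ℂ) (B + 1) := by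
    intro n
    have := hdev u₁ hu₁M (n + N) (by push_cast; linarith [(Nat.cast_nonneg n : (0 : ℝ) ≤ n)])
    rw [hab, hdlin, h11, h21] at this
    rw [neg_neg] at h12 h22
    rw [h12, h22, ← hX] at this
    simp only [mul_zero, add_zero, zero_add, mul_assoc, inv_mul_cancel₀ hX0, mul_one] at this
    have e : ‖a (n + N)‖ ≤ ‖a (n + N) - 1‖ + 1 := by
      simpa using norm_le_norm_sub_add (a (n + N)) 1
    rw [mem_closedBall_zero_iff, Prod.norm_def]
    refine max_le ?_ ?_ <;> dsimp only
    · linarith [norm_nonneg (b (n + N))]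
    · linarith [norm_nonneg (a (n + N) - 1)]
  -- A limit point in coordinates is again a solution, and the bound survives since the deviation at
  -- a fixed w is continuous in the coordinates.
  obtain ⟨⟨a₀, b₀⟩, -, φ, hφ, hlim⟩ := (isCompact_closedBall (0 : ℂ × ℂ) (B + 1)).tendsto_subseq hbd
  refine ⟨fun w => a₀ * G₁ w + b₀ * G₂ w, hG₁'.lin hG₂' _ _, fun w hw him => ?_⟩
  have hcont : Continuous fun q : ℂ × ℂ =>
      1 + dev Q (-ħ) (p w) (S w) (fun w => q.1 * G₁ w + q.2 * G₂ w) w := by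
    simp only [hdlin]; fun_prop
  refine le_of_tendsto ((hcont.tendsto (a₀, b₀)).comp hlim) ?_
  obtain ⟨N', hN'⟩ := exists_nat_ge (η * w.re)
  filter_upwards [eventually_ge_atTop N'] with n hn
  have h1 : N' ≤ φ n + N := hn.trans ((hφ.id_le n).trans (Nat.le_add_right _ _))
  have := hdev (η * w.re) hw (φ n + N) (hN'.trans (by exact_mod_cast h1))
  rw [hzw w him, hab] at this
  exact this

lemma tendsto_exp_decay {ι : Type*} {c a : ℝ} (hc : 0 < c) {l : Filter ι} {f : ι → ℝ} (hf : Tendsto f l atTop) :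
    Tendsto (fun w => a * Real.exp (-(c * f w))) l (𝓝 0) := by
  have := (Real.tendsto_exp_neg_atTop_nhds_zero.comp (hf.const_mul_atTop hc)).const_mul a
  simpa using this

lemma eventually_stripFilter (η y₀ b M : ℝ) :
    ∀ᶠ w in stripFilter η y₀ b, M < η * w.re ∧ |w.im - y₀| ≤ b := by
  have h1 : ∀ᶠ w in stripFilter η y₀ b, M < η * w.re :=
    (tendsto_comap.mono_left inf_le_left).eventually (eventually_gt_atTop M)
  have h2 : ∀ᶠ w in stripFilter η y₀ b, |w.im - y₀| ≤ b :=
    mem_inf_of_right (mem_principal_self _)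
  exact h1.and h2

lemma exists_sign_mul_eq_abs (x : ℝ) : ∃ e : ℝ, e ^ 2 = 1 ∧ e * x = |x| := by
  rcases le_total 0 x with h | h
  · exact ⟨1, by norm_num, by rw [abs_of_nonneg h, one_mul]⟩
  · exact ⟨-1, by norm_num, by rw [abs_of_nonpos h]; ring⟩

/-- The subdominant solution is asymptotic to the decaying Liouville–Green solution in strips. -/
lemma EndData.tendsto_dev (h : EndData Q ħ p S η M K c y₀ m) {χ : ℂ → ℂ}
    (hχ : IsSol (fun w => Q w / ħ ^ 2) χ)
    (hb : ∀ w ∈ halfPlane η M, w.im = y₀ → 1 + dev Q (-ħ) (p w) (S w) χ w ≤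
        Real.exp (‖ħ‖ * (K / c * Real.exp (-(c * (η * w.re))))))
    {b : ℝ} (hin : Inward ħ p η y₀ b) :
    Tendsto (fun w => dev Q (-ħ) (p w) (S w) χ w) (stripFilter η y₀ b) (𝓝 0) := by
  obtain ⟨c₀, hc₀, M₀, hM₀⟩ := hin
  have hηη : η * η = 1 := by rw [← sq, h.sign]
  have hη1 : |η| = 1 := by rw [← sq_eq_sq₀ (abs_nonneg _) zero_le_one, sq_abs, h.sign, one_pow]
  have hK := h.K_pos
  have hc := h.c_pos
  have main : ∀ᶠ w in stripFilter η y₀ b, dev Q (-ħ) (p w) (S w) χ w ≤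
      Real.exp (‖ħ‖ * (K / c * Real.exp (-(c * (η * w.re))))) *
      Real.exp (‖ħ‖ * (K * (c₀ + 1) / (c * c₀) * Real.exp (-(c * (η * w.re))))) - 1 := by
    filter_upwards [eventually_stripFilter η y₀ b (max M M₀)] with w hw
    obtain ⟨hw, hwb⟩ := hw
    obtain ⟨e, he, heq⟩ := exists_sign_mul_eq_abs (w.im - y₀)
    have hee : |e| = 1 := by rw [← sq_eq_sq₀ (abs_nonneg _) zero_le_one, sq_abs, he, one_pow]
    set ℓ := |w.im - y₀| with hℓ
    have hℓ0 : 0 ≤ ℓ := abs_nonneg _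
    have him : w.im - y₀ = e * ℓ := by rw [← heq, ← mul_assoc, ← sq, he, one_mul]
    -- The point w is reached from a point z of the base line by the reverse of the inward
    -- direction. Along this segment η re decreases to its value at w, so the whole segment lies
    -- beyond w and the error is controlled by exp(-c η re w).
    set d : ℂ := -(((c₀ * η : ℝ) : ℂ) - (e : ℝ) * Complex.I) with hd
    have hdre : d.re = -(c₀ * η) := by simp [hd]
    have hdim : d.im = e := by simp [hd]
    have hdn : ‖d‖ ≤ c₀ + 1 := by
      refine (Complex.norm_le_abs_re_add_abs_im d).trans (le_of_eq ?_)
      rw [hdre, hdim, abs_neg, abs_mul, hη1, hee, mul_one, abs_of_pos hc₀]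
    set z : ℂ := w - ℓ * d with hz
    have hzτ : ∀ τ : ℝ, η * (z + τ * d).re = η * w.re + (ℓ - τ) * c₀ := fun τ => by
      simp only [hz, Complex.add_re, Complex.sub_re, Complex.mul_re, Complex.ofReal_re,
        Complex.ofReal_im, zero_mul, sub_zero, hdre]
      linear_combination (ℓ - τ) * c₀ * hηη
    have hzτi : ∀ τ : ℝ, e * ((z + τ * d).im - y₀) = τ := fun τ => by
      simp only [hz, Complex.add_im, Complex.sub_im, Complex.mul_im, Complex.ofReal_re,
        Complex.ofReal_im, zero_mul, add_zero, hdim]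
      linear_combination e * him + τ * he
    have hz0 : η * z.re = η * w.re + ℓ * c₀ := by simpa using hzτ 0
    have hz1 : z.im = y₀ := by
      have := hzτi 0
      simp only [Complex.ofReal_zero, zero_mul, add_zero] at this
      rcases mul_eq_zero.1 this with h | h
      · simp [h] at he
      · linarith
    have hMw : M < η * w.re := (le_max_left _ _).trans_lt hw
    have hlc : 0 ≤ ℓ * c₀ := by positivity
    have h1 := hb z (by show M < _; rw [hz0]; linarith) hz1
    have h2 := h.dev_line (ħ' := -ħ) (by ring) hχ (z := z) (d := d) (w := w) (ℓ := ℓ)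
      (L := η * w.re) hℓ0 (by rw [hdre]; simp [hc₀.ne']; rintro rfl; simp at hηη) (by simp [hz])
      hMw (by rw [hz0]; linarith) le_rfl (fun τ hτ => by
        have := hM₀ e he (z + τ * d) (by
          show M₀ < _
          rw [hzτ]
          have : 0 ≤ (ℓ - τ) * c₀ := mul_nonneg (by linarith [hτ.2]) hc₀.le
          linarith [(le_max_right M M₀).trans_lt hw]) (by rw [hzτi]; exact hτ.1)
          (by rw [hzτi]; exact hτ.2.trans hwb)
        calc (0 : ℝ) ≤ _ := this
          _ = _ := by congr 1; rw [hd]; ring)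
    have h3 : Real.exp (-(c * (η * z.re))) ≤ Real.exp (-(c * (η * w.re))) := by
      apply Real.exp_le_exp.2
      rw [hz0]
      nlinarith
    rw [hdre, abs_neg, abs_mul, hη1, mul_one, abs_of_pos hc₀] at h2
    have : 1 + dev Q (-ħ) (p w) (S w) χ w ≤
      Real.exp (‖ħ‖ * (K / c * Real.exp (-(c * (η * w.re))))) *
      Real.exp (‖ħ‖ * (K * (c₀ + 1) / (c * c₀) * Real.exp (-(c * (η * w.re))))) :=
      h2.trans (mul_le_mul (h1.trans (by gcongr)) (by gcongr) (by positivity) (by positivity))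
    linarith
  have hlim : Tendsto (fun w : ℂ => η * w.re) (stripFilter η y₀ b) atTop :=
    tendsto_comap.mono_left inf_le_left
  refine tendsto_of_tendsto_of_tendsto_of_le_of_le' tendsto_const_nhds ?_
    (Eventually.of_forall fun w => dev_nonneg _ _ _ _ _ _) main
  have h1 := ((tendsto_exp_decay (a := K / c) hc hlim).const_mul ‖ħ‖).rexp
  have h2 := ((tendsto_exp_decay (a := K * (c₀ + 1) / (c * c₀)) hc hlim).const_mul ‖ħ‖).rexp
  simpa using (h1.mul h2).sub_const 1

end

/-! ### Dominant solutions at an end, and domination of the subdominant one -/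

section

variable {Q : ℂ → ℂ} {ħ : ℂ} {p S : ℂ → ℂ} {η M K c y₀ m : ℝ}

/-- In a strip where `re (S / ħ)` grows outwards there is a solution close to the growing
Liouville–Green solution. -/
lemma EndData.exists_dominant (h : EndData Q ħ p S η M K c y₀ m) {b : ℝ}
    (hout : Outward ħ p η y₀ b) :
    ∃ g, IsSol (fun w => Q w / ħ ^ 2) g ∧
      (∀ᶠ w in stripFilter η y₀ b, dev Q ħ (p w) (S w) g w ≤ 1 / 2) ∧
      Tendsto (fun w => (S w / ħ).re) (stripFilter η y₀ b) atTop := by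
  obtain ⟨c₀, hc₀, M₀, hM₀⟩ := hout
  have hηη : η * η = 1 := by rw [← sq, h.sign]
  have hη0 : η ≠ 0 := by rintro rfl; simp at hηη
  have hη1 : |η| = 1 := by rw [← sq_eq_sq₀ (abs_nonneg _) zero_le_one, sq_abs, h.sign, one_pow]
  have hK := h.K_pos
  have hc := h.c_pos
  have hm0 := h.m_pos
  -- Start so far out that the two segments used below together amplify 1 + dev by at most 3/2.
  obtain ⟨u₀, hu₀, hu₁⟩ : ∃ u₀ : ℝ, max M M₀ < u₀ ∧
      Real.exp (‖ħ‖ * (K / c * Real.exp (-(c * u₀)))) *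
      Real.exp (‖ħ‖ * (K * (c₀ + 1) / (c * c₀) * Real.exp (-(c * u₀)))) ≤ 3 / 2 := by
    have h1 := ((tendsto_exp_decay (a := K / c) hc (tendsto_id (α := ℝ) (x := atTop))).const_mul
      ‖ħ‖).rexp
    have h2 := ((tendsto_exp_decay (a := K * (c₀ + 1) / (c * c₀)) hc
      (tendsto_id (α := ℝ) (x := atTop))).const_mul ‖ħ‖).rexp
    have h3 := h1.mul h2
    simp only [mul_zero, Real.exp_zero, mul_one] at h3
    obtain ⟨u, hu, hu'⟩ := ((eventually_gt_atTop (max M M₀)).and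
      (h3.eventually (eventually_le_nhds (show (1 : ℝ) < 3 / 2 by norm_num)))).exists
    exact ⟨u, hu, hu'⟩
  have hMu : M < u₀ := (le_max_left _ _).trans_lt hu₀
  set z₀ : ℂ := ((η * u₀ : ℝ) : ℂ) + (y₀ : ℂ) * Complex.I with hz₀
  have hz₀re : η * z₀.re = u₀ := by simp [hz₀, ← mul_assoc, hηη]
  have hz₀im : z₀.im = y₀ := by simp [hz₀]
  have hz₀H : z₀ ∈ halfPlane η M := by show M < _; rwa [hz₀re]
  obtain ⟨g, hg, hg0⟩ := exists_dev_eq_zero h.entire h.hbar (h.rootOn.root_ne_zero hz₀H) (S z₀) z₀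
  -- Follow the base line outwards from z₀ to z, then a slanted outward segment from z to w. Re(S/ħ)
  -- grows at rate at least m on the former and does not decrease on the latter, which also gives
  -- its divergence.
  have main : ∀ w, u₀ + c₀ * b < η * w.re → |w.im - y₀| ≤ b →
      dev Q ħ (p w) (S w) g w ≤ 1 / 2 ∧
      (S z₀ / ħ).re + m * (η * w.re - c₀ * b - u₀) ≤ (S w / ħ).re := by
    intro w hw hwb
    obtain ⟨e, he, heq⟩ := exists_sign_mul_eq_abs (w.im - y₀)
    have hee : |e| = 1 := by rw [← sq_eq_sq₀ (abs_nonneg _) zero_le_one, sq_abs, he, one_pow]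
    set ℓ := |w.im - y₀| with hℓ
    have hℓ0 : 0 ≤ ℓ := abs_nonneg _
    have him : w.im - y₀ = e * ℓ := by rw [← heq, ← mul_assoc, ← sq, he, one_mul]
    set d : ℂ := ((c₀ * η : ℝ) : ℂ) + (e : ℝ) * Complex.I with hd
    have hdre : d.re = c₀ * η := by simp [hd]
    have hdim : d.im = e := by simp [hd]
    have hdn : ‖d‖ ≤ c₀ + 1 := by
      refine (Complex.norm_le_abs_re_add_abs_im d).trans (le_of_eq ?_)
      rw [hdre, hdim, abs_mul, hη1, hee, mul_one, abs_of_pos hc₀]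
    set z : ℂ := w - ℓ * d with hz
    have hzτ : ∀ τ : ℝ, η * (z + τ * d).re = η * w.re - (ℓ - τ) * c₀ := fun τ => by
      simp only [hz, Complex.add_re, Complex.sub_re, Complex.mul_re, Complex.ofReal_re,
        Complex.ofReal_im, zero_mul, sub_zero, hdre]
      linear_combination -(ℓ - τ) * c₀ * hηη
    have hzτi : ∀ τ : ℝ, e * ((z + τ * d).im - y₀) = τ := fun τ => by
      simp only [hz, Complex.add_im, Complex.sub_im, Complex.mul_im, Complex.ofReal_re,
        Complex.ofReal_im, zero_mul, add_zero, hdim]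
      linear_combination e * him + τ * he
    have hz0 : η * z.re = η * w.re - ℓ * c₀ := by simpa using hzτ 0
    have hz1 : z.im = y₀ := by
      have := hzτi 0
      simp only [Complex.ofReal_zero, zero_mul, add_zero] at this
      rcases mul_eq_zero.1 this with h | h
      · simp [h] at he
      · linarith
    have hlc : ℓ * c₀ ≤ c₀ * b := by nlinarith
    have hlc0 : 0 ≤ ℓ * c₀ := by positivity
    have hzu : u₀ < η * z.re := by rw [hz0]; linarith
    set ℓ₁ := η * z.re - u₀ with hℓ₁
    have hzz : z = z₀ + ℓ₁ * (η : ℂ) := by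
      apply Complex.ext
      · have : z.re = η * (η * z.re) := by rw [← mul_assoc, hηη, one_mul]
        simp [hz₀, hℓ₁]
        linear_combination this
      · simp [hz1, hz₀]
    have hbase : ∀ τ ∈ Icc (0 : ℝ) ℓ₁, z₀ + τ * (η : ℂ) ∈ halfPlane η M ∧
        m ≤ (p (z₀ + τ * (η : ℂ)) ^ 2 * (η : ℂ) / ħ).re := fun τ hτ => by
      have h1 : z₀ + τ * (η : ℂ) ∈ halfPlane η M := by
        show M < _
        have : η * (z₀ + τ * (η : ℂ)).re = u₀ + τ := by
          simp only [Complex.add_re, Complex.mul_re, Complex.ofReal_re, Complex.ofReal_im, mul_zero,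
            sub_zero]
          linear_combination hz₀re + τ * hηη
        rw [this]; linarith [hτ.1]
      exact ⟨h1, h.base _ h1 (by simp [hz₀im])⟩
    have hslant : ∀ τ ∈ Icc (0 : ℝ) ℓ, z + τ * d ∈ halfPlane η M ∧
        0 ≤ (p (z + τ * d) ^ 2 * d / ħ).re := fun τ hτ => by
      have hlt : u₀ < η * (z + τ * d).re := by
        rw [hzτ]
        nlinarith [hτ.1]
      refine ⟨hMu.trans hlt, ?_⟩
      exact hM₀ e he (z + τ * d) (((le_max_right M M₀).trans_lt hu₀).trans hlt)
        (by rw [hzτi]; exact hτ.1) (by rw [hzτi]; exact hτ.2.trans hwb)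
    have h1 := h.dev_line (ħ' := ħ) rfl hg (z := z₀) (d := (η : ℂ)) (w := z) (ℓ := ℓ₁)
      (L := u₀) (by linarith) (by simpa using hη0) hzz hMu hz₀re.ge hzu.le
      (fun τ hτ => hm0.le.trans (hbase τ hτ).2)
    have h2 := h.dev_line (ħ' := ħ) rfl hg (z := z) (d := d) (w := w) (ℓ := ℓ)
      (L := u₀) hℓ0 (by rw [hdre]; exact mul_ne_zero hc₀.ne' hη0) (by simp [hz])
      hMu hzu.le (by nlinarith) (fun τ hτ => (hslant τ hτ).2)
    rw [hg0] at h1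
    rw [hdre, abs_mul, hη1, mul_one, abs_of_pos hc₀] at h2
    simp only [add_zero, one_mul, Complex.norm_real, Real.norm_eq_abs, Complex.ofReal_re, hη1,
      mul_one] at h1
    have h3 : 1 + dev Q ħ (p w) (S w) g w ≤
      Real.exp (‖ħ‖ * (K / c * Real.exp (-(c * u₀)))) *
      Real.exp (‖ħ‖ * (K * (c₀ + 1) / (c * c₀) * Real.exp (-(c * u₀)))) :=
      h2.trans (mul_le_mul h1 (by gcongr) (by positivity) (by positivity))
    refine ⟨by linarith, ?_⟩
    have h4 := h.rootOn.action_mono (fun τ hτ => (hbase τ hτ).1) (fun τ hτ => (hbase τ hτ).2)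
      (left_mem_Icc.2 (by linarith)) (right_mem_Icc.2 (by linarith)) (by linarith : 0 ≤ ℓ₁)
    have h5 := h.rootOn.action_mono (fun τ hτ => (hslant τ hτ).1) (fun τ hτ => (hslant τ hτ).2)
      (left_mem_Icc.2 hℓ0) (right_mem_Icc.2 hℓ0) hℓ0
    have e5 : z + ℓ * d = w := by simp [hz]
    rw [← hzz] at h4
    rw [e5] at h5
    simp only [Complex.ofReal_zero, zero_mul, add_zero, sub_zero, sub_div, Complex.sub_re] at h4 h5
    have h6 : m * (η * w.re - c₀ * b - u₀) ≤ m * ℓ₁ := by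
      gcongr
      rw [hℓ₁, hz0]
      linarith
    linarith
  refine ⟨g, hg, ?_, ?_⟩
  · filter_upwards [eventually_stripFilter η y₀ b (u₀ + c₀ * b)] with w hw
    exact (main w hw.1 hw.2).1
  · have hlim : Tendsto (fun w : ℂ => η * w.re) (stripFilter η y₀ b) atTop :=
      tendsto_comap.mono_left inf_le_left
    have h1 : Tendsto (fun w : ℂ => (S z₀ / ħ).re + m * (η * w.re - c₀ * b - u₀))
        (stripFilter η y₀ b) atTop := by
      refine tendsto_atTop_add_const_left _ _ (Tendsto.const_mul_atTop hm0 ?_)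
      simp only [sub_eq_add_neg]
      exact tendsto_atTop_add_const_right _ _ (tendsto_atTop_add_const_right _ _ hlim)
    refine tendsto_atTop_mono' _ ?_ h1
    filter_upwards [eventually_stripFilter η y₀ b (u₀ + c₀ * b)] with w hw
    exact (main w hw.1 hw.2).2

lemma stripFilter_neBot (hη : η ^ 2 = 1) (y₀ : ℝ) {b : ℝ} (hb : 0 ≤ b) :
    (stripFilter η y₀ b).NeBot := by
  have hηη : η * η = 1 := by rw [← sq, hη]
  have : Tendsto (fun u : ℝ => ((η * u : ℝ) : ℂ) + (y₀ : ℂ) * Complex.I) atTop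
      (stripFilter η y₀ b) := by
    refine tendsto_inf.2 ⟨tendsto_comap_iff.2 ?_, tendsto_principal.2 ?_⟩
    · refine tendsto_id.congr fun u => ?_
      simp [← mul_assoc, hηη]
    · exact Eventually.of_forall fun u => by simpa using hb
  exact this.neBot

lemma norm_mul_sub_one_le_dev (Q : ℂ → ℂ) (ħ p T : ℂ) (g : ℂ → ℂ) (w : ℂ) :
    ‖p * g w * Complex.exp (-(T / ħ)) - 1‖ ≤ dev Q ħ p T g w := by
  rw [dev, ← lg_add_lg Q ħ p g w]
  refine le_trans (le_of_eq ?_) (norm_add_le _ _)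
  congr 1
  ring

/-- All solutions other than the multiples of the subdominant one dominate it. -/
lemma EndData.tendsto_div (h : EndData Q ħ p S η M K c y₀ m) {b : ℝ} (hb : 0 ≤ b)
    (hout : Outward ħ p η y₀ b) {χ : ℂ → ℂ} (hχ : IsSol (fun w => Q w / ħ ^ 2) χ)
    (hdev : Tendsto (fun w => dev Q (-ħ) (p w) (S w) χ w) (stripFilter η y₀ b) (𝓝 0))
    {g : ℂ → ℂ} (hg : IsSol (fun w => Q w / ħ ^ 2) g) (hw : wr g χ 0 ≠ 0) :
    Tendsto (fun w => χ w / g w) (stripFilter η y₀ b) (𝓝 0) := by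
  have := stripFilter_neBot h.sign y₀ hb
  obtain ⟨G, hG, hGdev, hS⟩ := h.exists_dominant hout
  have hr : Tendsto (fun w => χ w / G w) (stripFilter η y₀ b) (𝓝 0) := by
    -- 4 = 2/(1/2): at most 2 for the normalized χ, at least 1/2 for the normalized G.
    have h1 : Tendsto (fun w => 4 * Real.exp (-(2 * (S w / ħ).re))) (stripFilter η y₀ b) (𝓝 0) :=
      tendsto_exp_decay two_pos hS
    refine squeeze_zero_norm' ?_ h1
    filter_upwards [hGdev, hdev.eventually (eventually_le_nhds one_pos),
      eventually_stripFilter η y₀ b M] with w hw1 hw2 hw3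
    have hp := h.rootOn.root_ne_zero (w := w) hw3.1
    have e1 := (norm_mul_sub_one_le_dev _ _ _ _ _ _).trans hw1
    have e2 := (norm_mul_sub_one_le_dev _ _ _ _ _ _).trans hw2
    rw [div_neg, neg_neg] at e2
    set X := Complex.exp (S w / ħ) with hX
    have hX0 : X ≠ 0 := Complex.exp_ne_zero _
    rw [Complex.exp_neg, ← hX] at e1
    have e3 : 1 / 2 ≤ ‖p w * G w * X⁻¹‖ := by
      have := norm_sub_norm_le (1 : ℂ) (p w * G w * X⁻¹)
      rw [norm_one, norm_sub_rev] at this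
      linarith
    have e4 : ‖p w * χ w * X‖ ≤ 2 := by
      have := norm_le_norm_sub_add (p w * χ w * X) 1
      rw [norm_one] at this
      linarith
    have hG0 : G w ≠ 0 := by
      intro h0
      rw [h0] at e3
      norm_num at e3
    have e5 : Real.exp (-(2 * (S w / ħ).re)) = ‖X⁻¹‖ ^ 2 := by
      rw [hX, ← Complex.exp_neg, Complex.norm_exp, ← Real.exp_nat_mul]
      simp
    have e6 : χ w / G w = p w * χ w * X / (p w * G w * X⁻¹) * X⁻¹ ^ 2 := by
      field_simp
    rw [e6, norm_mul, norm_div, norm_pow, e5]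
    gcongr
    rw [div_le_iff₀ (by linarith)]
    linarith
  have hG0 : ∀ᶠ w in stripFilter η y₀ b, G w ≠ 0 := by
    filter_upwards [hGdev] with w hw1 h0
    have e1 := (norm_mul_sub_one_le_dev _ _ _ _ _ _).trans hw1
    rw [h0] at e1
    norm_num at e1
  -- By `wr_three`, g is a combination of G and χ; divided by G, only the G-component survives in
  -- the limit. Its coefficient is wr g χ ≠ 0, which also shows wr G χ ≠ 0.
  have hs : Tendsto (fun w => wr G χ 0 * (g w / G w)) (stripFilter η y₀ b) (𝓝 (wr g χ 0)) := by
    have h1 : Tendsto (fun w => wr g χ 0 - wr g G 0 * (χ w / G w)) (stripFilter η y₀ b)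
        (𝓝 (wr g χ 0)) := by simpa using (hr.const_mul (wr g G 0)).const_sub (wr g χ 0)
    refine h1.congr' ?_
    filter_upwards [hG0] with w hw
    have := wr_three G χ g w
    rw [wr_const hG hχ w 0, wr_const hχ hg w 0, wr_const hg hG w 0, wr_swap g χ] at this
    field_simp
    linear_combination -this
  have hGχ : wr G χ 0 ≠ 0 := by
    intro h0
    rw [h0] at hs
    simp only [zero_mul] at hs
    exact hw (tendsto_nhds_unique tendsto_const_nhds hs).symm
  have := (hr.const_mul (wr G χ 0)).div hs hw
  simp only [mul_zero, zero_div] at this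
  refine this.congr' ?_
  filter_upwards [hG0] with w hw
  simp only [Pi.div_apply]
  field_simp

end

section

/-! ### The two kinds of ends of the anharmonic oscillator -/

lemma norm_sub_one_le_of_re_pos {ζ : ℂ} (h : 0 < ζ.re) : ‖ζ - 1‖ ≤ ‖ζ ^ 2 - 1‖ := by
  have h1 : 1 ≤ ‖ζ + 1‖ := by
    have := Complex.re_le_norm (ζ + 1)
    simp at this
    linarith
  have h2 : ζ ^ 2 - 1 = (ζ - 1) * (ζ + 1) := by ring
  rw [h2, norm_mul]
  exact le_mul_of_one_le_right (norm_nonneg _) h1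

lemma re_ne_zero_of_norm_sq_sub_one_lt {ζ : ℂ} (h : ‖ζ ^ 2 - 1‖ < 1) : ζ.re ≠ 0 := by
  intro h0
  have h1 : (ζ ^ 2 - 1).re = -ζ.im ^ 2 - 1 := by
    simp [sq, h0]
  have h2 := Complex.abs_re_le_norm (ζ ^ 2 - 1)
  rw [h1, abs_le] at h2
  nlinarith [sq_nonneg ζ.im]

lemma exists_sq_eq_re_pos {a : ℂ} (h : ‖a - 1‖ < 1) : ∃ ζ : ℂ, ζ ^ 2 = a ∧ 0 < ζ.re := by
  obtain ⟨ζ, hζ⟩ := IsAlgClosed.exists_pow_nat_eq a two_pos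
  have h0 : ζ.re ≠ 0 := re_ne_zero_of_norm_sq_sub_one_lt (by rwa [hζ])
  rcases lt_or_gt_of_ne h0 with h1 | h1
  · exact ⟨-ζ, by rw [neg_sq, hζ], by simpa using h1⟩
  · exact ⟨ζ, hζ, h1⟩

/-- If `Q` is close to the square of `e₀` then there is a root with `p²` close to `e₀`. -/
lemma exists_rootOn_near {Q e₀ : ℂ → ℂ} (hQ : Differentiable ℂ Q) (he₀ : Continuous e₀) {U : Set ℂ}
    (hU : Convex ℝ U) (hUo : IsOpen U) (hUn : U.Nonempty) (h0 : ∀ w, e₀ w ≠ 0)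
    (h : ∀ w ∈ U, ‖Q w / e₀ w ^ 2 - 1‖ < 1) :
    ∃ p S, RootOn Q p S U ∧ ∀ w ∈ U, ‖p w ^ 2 / e₀ w - 1‖ ≤ ‖Q w / e₀ w ^ 2 - 1‖ := by
  obtain ⟨w₀, hw₀⟩ := hUn
  have hQ0 : ∀ w ∈ U, Q w ≠ 0 := fun w hw hz => by
    have := h w hw
    simp [hz] at this
  obtain ⟨ζ, hζ, hζre⟩ := exists_sq_eq_re_pos (h w₀ hw₀)
  obtain ⟨p₀, hp₀⟩ := IsAlgClosed.exists_pow_nat_eq (ζ * e₀ w₀) two_pos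
  obtain ⟨p, S, hpS, hp, -⟩ := exists_rootOn hQ hU hUo hQ0 hw₀ (p₀ := p₀) (by
    have h1 : p₀ ^ 4 = (p₀ ^ 2) ^ 2 := by ring
    have := h0 w₀
    rw [h1, hp₀, mul_pow, hζ]
    field_simp) 0
  refine ⟨p, S, hpS, fun w hw => ?_⟩
  have hsq : ∀ w ∈ U, (p w ^ 2 / e₀ w) ^ 2 = Q w / e₀ w ^ 2 := fun w hw => by
    rw [div_pow, ← pow_mul, hpS.root w hw]
  have hre : ∀ w ∈ U, (p w ^ 2 / e₀ w).re ≠ 0 := fun w hw =>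
    re_ne_zero_of_norm_sq_sub_one_lt (by rw [hsq w hw]; exact h w hw)
  have hc : ContinuousOn (fun w => (p w ^ 2 / e₀ w).re) U := by
    refine Complex.continuous_re.comp_continuousOn (ContinuousOn.div (ContinuousOn.pow ?_ 2)
      he₀.continuousOn fun w _ => h0 w)
    exact fun w hw => (hpS.deriv_root w hw).continuousAt.continuousWithinAt
  -- The real part of p²/e₀ never vanishes on the connected set U and is positive at w₀, so p² stays
  -- on the side of e₀ and not of -e₀.
  have hpos : 0 < (p w ^ 2 / e₀ w).re := by
    have h1 : 0 < (p w₀ ^ 2 / e₀ w₀).re := by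
      rw [hp, hp₀, mul_div_cancel_right₀ _ (h0 w₀)]
      exact hζre
    by_contra hneg
    obtain ⟨z, hz, hz0⟩ := hU.isPreconnected.intermediate_value hw hw₀ hc
      (show (0 : ℝ) ∈ Icc _ _ from ⟨not_lt.1 hneg, h1.le⟩)
    exact hre z hz hz0
  rw [← hsq w hw]
  exact norm_sub_one_le_of_re_pos hpos

/-- X is the size of Q, Y the relative size of its derivatives, R the size of its square root. The
decay has a different source at each end: at the origin X = R = 1 and Y = e^{2 re w}, while at
infinity Y = 1 and R = e^{(α+1) re w}. -/
lemma norm_errF_le {Q : ℂ → ℂ} {q w : ℂ} {X Y R A B : ℝ} (hX : 0 < X) (hR : 0 < R)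
    (hY : 0 ≤ Y) (hY1 : Y ≤ 1) (hB : 0 ≤ B) (h0 : X / 2 ≤ ‖Q w‖) (h0' : ‖Q w‖ ≤ 2 * X)
    (h1 : ‖deriv Q w‖ ≤ A * X * Y) (h2 : ‖deriv (deriv Q) w‖ ≤ B * X * Y) (hq : R / 2 ≤ ‖q‖) :
    ‖errF Q q w‖ ≤ (8 * B + 5 * A ^ 2) / 2 * (Y / R) := by
  have e1 : ‖-4 * deriv (deriv Q) w * Q w + 5 * deriv Q w ^ 2‖ ≤
      (8 * B + 5 * A ^ 2) * X ^ 2 * Y := by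
    refine (norm_add_le _ _).trans ?_
    simp only [norm_mul, norm_neg, Complex.norm_ofNat, norm_pow]
    calc 4 * ‖deriv (deriv Q) w‖ * ‖Q w‖ + 5 * ‖deriv Q w‖ ^ 2
        ≤ 4 * (B * X * Y) * (2 * X) + 5 * (A * X * Y) ^ 2 := by gcongr
      _ = (8 * B) * X ^ 2 * Y + (5 * A ^ 2) * X ^ 2 * (Y * Y) := by ring
      _ ≤ (8 * B) * X ^ 2 * Y + (5 * A ^ 2) * X ^ 2 * (1 * Y) := by gcongr
      _ = _ := by ring
  have e2 : 4 * X ^ 2 ≤ ‖16 * Q w ^ 2‖ := by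
    rw [norm_mul, norm_pow, Complex.norm_ofNat]
    calc 4 * X ^ 2 = 16 * (X / 2) ^ 2 := by ring
      _ ≤ _ := by gcongr
  rw [errF, norm_div, norm_div]
  calc _ ≤ (8 * B + 5 * A ^ 2) * X ^ 2 * Y / (4 * X ^ 2) / (R / 2) := by gcongr
    _ = _ := by field_simp; ring

lemma re_one_add_mul_nonneg {ξ u : ℂ} {a x y : ℝ} (ha : 0 ≤ a) (hx : x ≤ u.re) (hy : ‖u‖ ≤ y)
    (h : ‖ξ‖ * y ≤ x) : 0 ≤ (a * ((1 + ξ) * u)).re := by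
  rw [Complex.re_ofReal_mul]
  refine mul_nonneg ha ?_
  rw [add_mul, one_mul, Complex.add_re]
  have h1 := (abs_le.1 (Complex.abs_re_le_norm (ξ * u))).1
  rw [norm_mul] at h1
  have : ‖ξ‖ * ‖u‖ ≤ ‖ξ‖ * y := by gcongr
  linarith

/-- The potential of the oscillator in the logarithmic coordinate. -/
def Qf (α : ℝ) (ν : ℂ) (w : ℂ) : ℂ :=
  Complex.exp (2 * (α + 1) * w) - ν * Complex.exp (2 * w) + 1

lemma hasDerivAt_cexp_const_mul (a w : ℂ) :
    HasDerivAt (fun w => Complex.exp (a * w)) (a * Complex.exp (a * w)) w := by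
  simpa [mul_comm] using ((hasDerivAt_id w).const_mul a).cexp

lemma Qf_hasDerivAt (α : ℝ) (ν w : ℂ) : HasDerivAt (Qf α ν)
    (2 * (α + 1) * Complex.exp (2 * (α + 1) * w) - ν * (2 * Complex.exp (2 * w))) w :=
  ((hasDerivAt_cexp_const_mul _ w).sub ((hasDerivAt_cexp_const_mul 2 w).const_mul ν)).add_const 1

lemma deriv_Qf (α : ℝ) (ν : ℂ) : deriv (Qf α ν) = fun w =>
    2 * (α + 1) * Complex.exp (2 * (α + 1) * w) - ν * (2 * Complex.exp (2 * w)) :=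
  funext fun w => (Qf_hasDerivAt α ν w).deriv

lemma deriv_deriv_Qf (α : ℝ) (ν : ℂ) : deriv (deriv (Qf α ν)) = fun w =>
    (2 * (α + 1)) ^ 2 * Complex.exp (2 * (α + 1) * w) - ν * (4 * Complex.exp (2 * w)) := by
  rw [deriv_Qf]
  funext w
  refine HasDerivAt.deriv ?_
  refine (((hasDerivAt_cexp_const_mul _ w).const_mul _).fun_sub
    (((hasDerivAt_cexp_const_mul 2 w).const_mul 2).const_mul ν)).congr_deriv ?_
  ring

lemma Qf_differentiable (α : ℝ) (ν : ℂ) : Differentiable ℂ (Qf α ν) :=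
  fun w => (Qf_hasDerivAt α ν w).differentiableAt

lemma norm_cexp_two_mul (w : ℂ) : ‖Complex.exp (2 * w)‖ = Real.exp (2 * w.re) := by
  rw [Complex.norm_exp]; simp

lemma norm_cexp_two_mul' (α : ℝ) (w : ℂ) :
    ‖Complex.exp (2 * (α + 1) * w)‖ = Real.exp (2 * (α + 1) * w.re) := by
  rw [Complex.norm_exp]
  congr 1
  have : (2 * (α + 1) * w : ℂ) = ((2 * (α + 1) : ℝ) : ℂ) * w := by push_cast; ring
  rw [this, Complex.re_ofReal_mul]

lemma norm_deriv_Qf_le (α : ℝ) (hα : 0 < α) (ν w : ℂ) : ‖deriv (Qf α ν) w‖ ≤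
    2 * (α + 1) * Real.exp (2 * (α + 1) * w.re) + 2 * ‖ν‖ * Real.exp (2 * w.re) := by
  rw [deriv_Qf]
  refine (norm_sub_le _ _).trans (le_of_eq ?_)
  have h1 : (2 * (α + 1) : ℂ) = ((2 * (α + 1) : ℝ) : ℂ) := by push_cast; ring
  rw [norm_mul (2 * ((α : ℂ) + 1)), norm_mul ν, norm_mul 2 (Complex.exp _), norm_cexp_two_mul',
    norm_cexp_two_mul, h1, Complex.norm_real, Real.norm_of_nonneg (by positivity), Complex.norm_ofNat]
  ring

lemma norm_deriv_deriv_Qf_le (α : ℝ) (hα : 0 < α) (ν w : ℂ) : ‖deriv (deriv (Qf α ν)) w‖ ≤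
    (2 * (α + 1)) ^ 2 * Real.exp (2 * (α + 1) * w.re) + 4 * ‖ν‖ * Real.exp (2 * w.re) := by
  rw [deriv_deriv_Qf]
  refine (norm_sub_le _ _).trans (le_of_eq ?_)
  have h1 : (2 * (α + 1) : ℂ) = ((2 * (α + 1) : ℝ) : ℂ) := by push_cast; ring
  rw [norm_mul, norm_mul, norm_mul, norm_cexp_two_mul', norm_cexp_two_mul, h1, norm_pow,
    Complex.norm_real, Real.norm_of_nonneg (by positivity), Complex.norm_ofNat]
  ring

lemma hbar_eq {ħ : ℂ} : ħ = (‖ħ‖ : ℂ) * Complex.exp (ħ.arg * Complex.I) :=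
  (Complex.norm_mul_exp_arg_mul_I ħ).symm

lemma norm_add_I_le {c e : ℝ} (hc : 0 < c) (he : e ^ 2 = 1) :
    ‖(c : ℂ) + (e : ℝ) * Complex.I‖ ≤ c + 1 := by
  have hee : |e| = 1 := by rw [← sq_eq_sq₀ (abs_nonneg _) zero_le_one, sq_abs, he, one_pow]
  refine (Complex.norm_le_abs_re_add_abs_im _).trans (le_of_eq ?_)
  simp [hee, abs_of_pos hc]

/-- The end at the origin. -/
lemma exists_endData_zero {α : ℝ} (hα : 0 < α) (ν : ℂ) : ∃ M p S,
    RootOn (Qf α ν) p S (halfPlane (-1) M) ∧ ∀ ħ : ℂ, ħ ≠ 0 → |ħ.arg| < Real.pi / 2 →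
      (∃ M' K c m, EndData (Qf α ν) ħ p S (-1) M' K c 0 m) ∧
      (∀ b, Inward ħ p (-1) 0 b) ∧ ∀ b, Outward ħ p (-1) 0 b := by
  set dl : ℝ → ℝ := fun u => (1 + ‖ν‖) * Real.exp (-(2 * u)) with hdl
  have hdl0 : Tendsto dl atTop (𝓝 0) := tendsto_exp_decay two_pos tendsto_id
  have hdlanti : Antitone dl := fun x y hxy => by simp only [hdl]; gcongr
  have hQ1 : ∀ w : ℂ, w.re ≤ 0 → ‖Qf α ν w - 1‖ ≤ dl (-1 * w.re) := fun w hw => by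
    have e : Qf α ν w - 1 = Complex.exp (2 * (α + 1) * w) - ν * Complex.exp (2 * w) := by
      simp [Qf]
    rw [e]
    refine (norm_sub_le _ _).trans ?_
    rw [norm_mul, norm_cexp_two_mul, norm_cexp_two_mul']
    have h1 : Real.exp (2 * (α + 1) * w.re) ≤ Real.exp (2 * w.re) :=
      Real.exp_le_exp.2 (by nlinarith)
    have h2 : -(2 * (-1 * w.re)) = 2 * w.re := by ring
    simp only [hdl, h2]
    linarith
  obtain ⟨M, hM0, hM⟩ := ((eventually_ge_atTop (0 : ℝ)).and
    (hdl0.eventually (eventually_le_nhds (show (0 : ℝ) < 1 / 2 by norm_num)))).exists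
  have hH : ∀ w ∈ halfPlane (-1) M, w.re ≤ 0 ∧ ‖Qf α ν w - 1‖ ≤ dl (-1 * w.re) ∧
      dl (-1 * w.re) ≤ 1 / 2 := fun w hw => by
    have hw' : M < -1 * w.re := hw
    have h1 : w.re ≤ 0 := by linarith
    exact ⟨h1, hQ1 w h1, (hdlanti hw'.le).trans hM⟩
  -- The model value -1 for p² makes S behave like -w, so that Re S grows towards x = 0.
  obtain ⟨p, S, hpS, hp⟩ := exists_rootOn_near (Qf_differentiable α ν)
    (e₀ := fun _ => -1) continuous_const (convex_halfPlane (-1) M) (isOpen_halfPlane (-1) M)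
    ⟨((-(M + 1) : ℝ) : ℂ), by show M < _; simp⟩ (by simp) (fun w hw => by
      have := hH w hw
      norm_num
      linarith)
  have hp' : ∀ w ∈ halfPlane (-1) M, ∃ ξ : ℂ, p w ^ 2 = -(1 + ξ) ∧ ‖ξ‖ ≤ dl (-1 * w.re) :=
    fun w hw => ⟨p w ^ 2 / -1 - 1, by ring, (hp w hw).trans (by
      have := (hH w hw).2.1
      have e : Qf α ν w / (-1) ^ 2 - 1 = Qf α ν w - 1 := by norm_num
      rwa [e])⟩
  refine ⟨M, p, S, hpS, fun ħ hħ harg => ?_⟩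
  have hcos : 0 < Real.cos ħ.arg := Real.cos_pos_of_mem_Ioo (abs_lt.1 harg)
  have hn : 0 < ‖ħ‖ := norm_pos_iff.2 hħ
  have hinv : (ħ : ℂ)⁻¹ = ((‖ħ‖⁻¹ : ℝ) : ℂ) * Complex.exp (-(ħ.arg * Complex.I)) := by
    conv_lhs => rw [hbar_eq (ħ := ħ)]
    rw [mul_inv, ← Complex.exp_neg]; push_cast; rfl
  -- As p² tends to -1 whatever im w is, one inequality valid for e = 1 and e = -1 serves inward and
  -- outward directions in strips of any width.
  have key : ∃ c₀ > 0, ∃ M₀ : ℝ, ∀ e : ℝ, e ^ 2 = 1 → ∀ w ∈ halfPlane (-1) M₀,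
      0 ≤ (p w ^ 2 * (-((c₀ : ℝ) + (e : ℝ) * Complex.I)) / ħ).re := by
    -- Chosen so that c₀ cos(arg ħ) + e sin(arg ħ) ≥ 2 - 1 = 1.
    set c₀ := 2 / Real.cos ħ.arg with hc₀
    have hc₀0 : 0 < c₀ := by positivity
    have h1 : Tendsto (fun u => dl u * (c₀ + 1)) atTop (𝓝 0) := by
      simpa using hdl0.mul_const (c₀ + 1)
    obtain ⟨M₀, hM₀, hM₁⟩ := ((eventually_ge_atTop M).and
      (h1.eventually (eventually_le_nhds one_pos))).exists
    refine ⟨c₀, hc₀0, M₀, fun e he w hw => ?_⟩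
    have hw' : M₀ < -1 * w.re := hw
    obtain ⟨ξ, hξ, hξn⟩ := hp' w (hM₀.trans_lt hw')
    have e1 : p w ^ 2 * (-((c₀ : ℝ) + (e : ℝ) * Complex.I)) / ħ = ((‖ħ‖⁻¹ : ℝ) : ℂ) *
        ((1 + ξ) * (Complex.exp (-(ħ.arg * Complex.I)) * ((c₀ : ℝ) + (e : ℝ) * Complex.I))) := by
      rw [hξ, div_eq_mul_inv, hinv]; ring
    rw [e1]
    refine re_one_add_mul_nonneg (x := 1) (y := c₀ + 1) (by positivity) ?_ ?_ ?_
    · have e2 : (Complex.exp (-(ħ.arg * Complex.I)) * ((c₀ : ℝ) + (e : ℝ) * Complex.I)).re =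
          c₀ * Real.cos ħ.arg + e * Real.sin ħ.arg := by
        rw [show -((ħ.arg : ℂ) * Complex.I) = ((-ħ.arg : ℝ) : ℂ) * Complex.I by push_cast; ring,
          Complex.exp_mul_I, ← Complex.ofReal_cos, ← Complex.ofReal_sin, Real.cos_neg, Real.sin_neg]
        simp only [Complex.mul_re, Complex.add_re, Complex.add_im, Complex.mul_im,
          Complex.ofReal_re, Complex.ofReal_im, Complex.I_re, Complex.I_im]
        ring
      rw [e2, hc₀, div_mul_cancel₀ _ hcos.ne']
      nlinarith [sq_nonneg (e + Real.sin ħ.arg), Real.sin_sq_le_one ħ.arg]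
    · rw [norm_mul, show -((ħ.arg : ℂ) * Complex.I) = ((-ħ.arg : ℝ) : ℂ) * Complex.I by
        push_cast; ring, Complex.norm_exp_ofReal_mul_I, one_mul]
      exact norm_add_I_le hc₀0 he
    · refine le_trans ?_ hM₁
      have := hξn.trans (hdlanti hw'.le)
      gcongr
  refine ⟨?_, fun b => ?_, fun b => ?_⟩
  · set A := 2 * (α + 1) + 2 * ‖ν‖ with hA
    set B := (2 * (α + 1)) ^ 2 + 4 * ‖ν‖ with hB
    have hA0 : 0 < A := by positivity
    have hB0 : 0 < B := by positivity
    obtain ⟨M', hM', hM''⟩ := ((eventually_ge_atTop M).and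
      (hdl0.eventually (eventually_le_nhds (show (0 : ℝ) < Real.cos ħ.arg / 2 by positivity)))).exists
    have hHM : halfPlane (-1) M' ⊆ halfPlane (-1) M := fun w hw => hM'.trans_lt hw
    refine ⟨M', (8 * B + 5 * A ^ 2) / 2, 2, ‖ħ‖⁻¹ * (Real.cos ħ.arg / 2), Qf_differentiable α ν, hħ,
      by norm_num, hpS.mono hHM, by positivity, two_pos, by positivity, fun w hw => ?_,
      fun w hw _ => ?_⟩
    · obtain ⟨h1, h2, h3⟩ := hH w (hHM hw)
      obtain ⟨ξ, hξ, hξn⟩ := hp' w (hHM hw)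
      have e1 : Real.exp (2 * (α + 1) * w.re) ≤ Real.exp (2 * w.re) :=
        Real.exp_le_exp.2 (by nlinarith)
      have e2 : 1 / 2 ≤ ‖1 + ξ‖ := by
        have := norm_sub_norm_le (1 : ℂ) (-ξ)
        rw [norm_one, norm_neg, sub_neg_eq_add] at this
        linarith
      have e3 : |‖Qf α ν w‖ - 1| ≤ 1 / 2 := by
        have := abs_norm_sub_norm_le (Qf α ν w) 1
        rw [norm_one] at this
        linarith
      rw [abs_le] at e3
      have := norm_errF_le (Q := Qf α ν) (q := p w ^ 2) (w := w) (X := 1) (Y := Real.exp (2 * w.re))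
        (R := 1) (A := A) (B := B) one_pos one_pos (Real.exp_pos _).le
        (Real.exp_le_one_iff.2 (by linarith)) hB0.le (by linarith) (by linarith)
        ((norm_deriv_Qf_le α hα ν w).trans (by
          have : 2 * (α + 1) * Real.exp (2 * (α + 1) * w.re) ≤ 2 * (α + 1) * Real.exp (2 * w.re) := by
            gcongr
          rw [hA]; linarith))
        ((norm_deriv_deriv_Qf_le α hα ν w).trans (by
          have : (2 * (α + 1)) ^ 2 * Real.exp (2 * (α + 1) * w.re) ≤
            (2 * (α + 1)) ^ 2 * Real.exp (2 * w.re) := by gcongr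
          rw [hB]; linarith)) (by rw [hξ, norm_neg]; exact e2)
      rw [div_one] at this
      rwa [show -(2 * (-1 * w.re)) = 2 * w.re by ring]
    · obtain ⟨ξ, hξ, hξn⟩ := hp' w (hHM hw)
      have e1 : p w ^ 2 * ((-1 : ℝ) : ℂ) / ħ = ((‖ħ‖⁻¹ : ℝ) : ℂ) *
          (Complex.exp (-(ħ.arg * Complex.I)) + ξ * Complex.exp (-(ħ.arg * Complex.I))) := by
        rw [hξ, div_eq_mul_inv, hinv]; push_cast; ring
      have e2 : ‖Complex.exp (-(ħ.arg * Complex.I))‖ = 1 := by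
        rw [show -((ħ.arg : ℂ) * Complex.I) = ((-ħ.arg : ℝ) : ℂ) * Complex.I by push_cast; ring,
          Complex.norm_exp_ofReal_mul_I]
      have e3 : (Complex.exp (-(ħ.arg * Complex.I))).re = Real.cos ħ.arg := by
        rw [show -((ħ.arg : ℂ) * Complex.I) = ((-ħ.arg : ℝ) : ℂ) * Complex.I by push_cast; ring,
          Complex.exp_ofReal_mul_I_re, Real.cos_neg]
      have e4 := (abs_le.1 (Complex.abs_re_le_norm (ξ * Complex.exp (-(ħ.arg * Complex.I))))).1
      rw [norm_mul, e2, mul_one] at e4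
      have e5 := hξn.trans ((hdlanti (show M' ≤ -1 * w.re from le_of_lt hw)).trans hM'')
      rw [e1, Complex.re_ofReal_mul, Complex.add_re, e3]
      gcongr
      linarith
  · obtain ⟨c₀, hc₀, M₀, h⟩ := key
    refine ⟨c₀, hc₀, M₀, fun e he w hw _ _ => (h e he w hw).trans_eq ?_⟩
    congr 1; push_cast; ring
  · obtain ⟨c₀, hc₀, M₀, h⟩ := key
    refine ⟨c₀, hc₀, M₀, fun e he w hw _ _ => (h (-e) (by simpa using he) w hw).trans_eq ?_⟩
    congr 1; push_cast; ring

end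

/-! ### The end at infinity -/

section

/-- A small outward component sin B / 2 is enough for the inward direction at every angle up to B <
π: sin x compensates the negative cosine. This is why the inward condition holds in a sector twice
as wide as the outward one. -/
lemma le_cos_add_sin {x B : ℝ} (hx : 0 ≤ x) (hxB : x ≤ B) (hB : Real.pi / 2 ≤ B)
    (hB' : B < Real.pi) :
    Real.sin B / 2 ≤ Real.sin B / 2 * Real.cos x + Real.sin x := by
  have hs : 0 < Real.sin B := Real.sin_pos_of_pos_of_lt_pi (by linarith [Real.pi_pos]) hB'
  have hs1 := Real.sin_le_one B
  rcases le_total x (Real.pi / 2) with h | h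
  · have h1 : 0 ≤ Real.cos x := Real.cos_nonneg_of_mem_Icc ⟨by linarith, h⟩
    have h2 : 0 ≤ Real.sin x := Real.sin_nonneg_of_nonneg_of_le_pi hx (by linarith)
    have h3 := Real.sin_sq_add_cos_sq x
    have h4 := Real.sin_le_one x
    have h5 := Real.cos_le_one x
    nlinarith
  · have h1 : Real.sin B ≤ Real.sin x := by
      rw [← Real.cos_sub_pi_div_two B, ← Real.cos_sub_pi_div_two x]
      exact Real.cos_le_cos_of_nonneg_of_le_pi (by linarith) (by linarith) (by linarith)
    have h2 := Real.neg_one_le_cos x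
    nlinarith

/-- The end at infinity. -/
lemma exists_endData_infty {α : ℝ} (hα : 0 < α) (ν : ℂ) (k : ℤ) : ∃ M p S,
    RootOn (Qf α ν) p S (halfPlane 1 M) ∧ ∀ ħ : ℂ, ħ ≠ 0 →
      (∃ M' K c m, EndData (Qf α ν) ħ p S 1 M' K c ((k * Real.pi + ħ.arg) / (α + 1)) m) ∧
      (∀ b, (α + 1) * b < Real.pi → Inward ħ p 1 ((k * Real.pi + ħ.arg) / (α + 1)) b) ∧
      ∀ b, (α + 1) * b < Real.pi / 2 → Outward ħ p 1 ((k * Real.pi + ħ.arg) / (α + 1)) b := by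
  set β := α + 1 with hβ
  have hβ0 : 0 < β := by linarith
  set dl : ℝ → ℝ := fun u => ‖ν‖ * Real.exp (-(2 * α * u)) + 1 * Real.exp (-(2 * β * u)) with hdl
  have hdl0 : Tendsto dl atTop (𝓝 0) := by
    have h1 := tendsto_exp_decay (a := ‖ν‖) (c := 2 * α) (by positivity)
      (tendsto_id (α := ℝ) (x := atTop))
    have h2 := tendsto_exp_decay (a := 1) (c := 2 * β) (by positivity)
      (tendsto_id (α := ℝ) (x := atTop))
    have := h1.add h2
    rw [add_zero] at this
    exact this
  have hdlanti : Antitone dl := fun x y hxy => by simp only [hdl]; gcongr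
  -- The factor (-1)^k does not affect the square, and makes e₀ positive on the central line im w =
  -- kπ/(α+1) of the k-th sector.
  set e₀ : ℂ → ℂ := fun w => Complex.exp (β * w - k * Real.pi * Complex.I) with he₀
  have he0 : ∀ w, e₀ w ≠ 0 := fun w => Complex.exp_ne_zero _
  have he2 : ∀ w, e₀ w ^ 2 = Complex.exp (2 * β * w) := fun w => by
    rw [he₀, ← Complex.exp_nat_mul]
    rw [Complex.exp_eq_exp_iff_exists_int]
    exact ⟨-k, by push_cast; ring⟩
  have hen : ∀ w, ‖e₀ w‖ = Real.exp (β * w.re) := fun w => by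
    rw [he₀, Complex.norm_exp]
    congr 1
    simp
  have hQ1 : ∀ w : ℂ, ‖Qf α ν w / e₀ w ^ 2 - 1‖ ≤ dl w.re := fun w => by
    have e1 : Complex.exp (2 * w) * (Complex.exp (2 * β * w))⁻¹ =
        Complex.exp (((-(2 * α) : ℝ) : ℂ) * w) := by
      rw [← Complex.exp_neg, ← Complex.exp_add]
      congr 1
      rw [hβ]; push_cast; ring
    have e2 : (Complex.exp (2 * β * w))⁻¹ = Complex.exp (((-(2 * β) : ℝ) : ℂ) * w) := by
      rw [← Complex.exp_neg]
      congr 1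
      push_cast; ring
    have e : Qf α ν w / e₀ w ^ 2 - 1 = -(ν * Complex.exp (((-(2 * α) : ℝ) : ℂ) * w)) +
        Complex.exp (((-(2 * β) : ℝ) : ℂ) * w) := by
      rw [he2, ← e1, ← e2, Qf, hβ]
      have := Complex.exp_ne_zero (2 * (α + 1) * w)
      push_cast
      field_simp
      ring
    rw [e]
    refine (norm_add_le _ _).trans (le_of_eq ?_)
    rw [norm_neg, norm_mul, Complex.norm_exp, Complex.norm_exp, Complex.re_ofReal_mul,
      Complex.re_ofReal_mul]
    simp only [hdl, neg_mul, one_mul]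
  obtain ⟨M, hM0, hM⟩ := ((eventually_ge_atTop (0 : ℝ)).and
    (hdl0.eventually (eventually_le_nhds (show (0 : ℝ) < 1 / 2 by norm_num)))).exists
  have hH : ∀ w ∈ halfPlane 1 M, 0 < w.re ∧ dl w.re ≤ 1 / 2 := fun w hw => by
    have hw' : M < 1 * w.re := hw
    rw [one_mul] at hw'
    exact ⟨by linarith, (hdlanti hw'.le).trans hM⟩
  obtain ⟨p, S, hpS, hp⟩ := exists_rootOn_near (Qf_differentiable α ν)
    (e₀ := e₀) (by fun_prop) (convex_halfPlane 1 M) (isOpen_halfPlane 1 M)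
    ⟨((M + 1 : ℝ) : ℂ), by show M < _; simp⟩ he0 (fun w hw => by
      have := (hQ1 w).trans (hH w hw).2
      linarith)
  have hp' : ∀ w ∈ halfPlane 1 M, ∃ ξ : ℂ, p w ^ 2 = e₀ w * (1 + ξ) ∧ ‖ξ‖ ≤ dl w.re :=
    fun w hw => ⟨p w ^ 2 / e₀ w - 1, by have := he0 w; field_simp; ring, (hp w hw).trans (hQ1 w)⟩
  refine ⟨M, p, S, hpS, fun ħ hħ => ?_⟩
  -- The line on which e₀/ħ, rather than e₀, is positive; relative to it the phase of e₀/ħ is β(im w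
  -- - y₀).
  set y₀ := (k * Real.pi + ħ.arg) / β with hy₀
  have hn : 0 < ‖ħ‖ := norm_pos_iff.2 hħ
  have hinv : ∀ w, e₀ w / ħ = ((Real.exp (β * w.re) * ‖ħ‖⁻¹ : ℝ) : ℂ) *
      Complex.exp (((β * (w.im - y₀) : ℝ) : ℂ) * Complex.I) := fun w => by
    rw [div_eq_mul_inv]
    conv_lhs => rw [hbar_eq (ħ := ħ)]
    rw [mul_inv, ← Complex.exp_neg]
    have e1 : β * (w.im - y₀) = β * w.im - (k * Real.pi + ħ.arg) := by
      rw [hy₀]; field_simp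
    rw [e1]
    push_cast
    have e2 : Complex.exp (β * w - k * Real.pi * Complex.I) * Complex.exp (-(ħ.arg * Complex.I)) =
        Complex.exp (β * w.re) *
          Complex.exp ((β * w.im - (k * Real.pi + ħ.arg)) * Complex.I) := by
      rw [← Complex.exp_add, ← Complex.exp_add]
      congr 1
      conv_lhs => rw [← Complex.re_add_im w]
      ring
    rw [he₀]
    linear_combination ((‖ħ‖ : ℂ))⁻¹ * e2
  have hdir : ∀ (w : ℂ) (x y : ℝ), (Complex.exp (((β * (w.im - y₀) : ℝ) : ℂ) * Complex.I) *
      ((x : ℂ) + (y : ℝ) * Complex.I)).re =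
        x * Real.cos (β * (w.im - y₀)) - y * Real.sin (β * (w.im - y₀)) := fun w x y => by
    rw [Complex.exp_mul_I, ← Complex.ofReal_cos, ← Complex.ofReal_sin]
    simp only [Complex.mul_re, Complex.add_re, Complex.add_im, Complex.mul_im,
      Complex.ofReal_re, Complex.ofReal_im, Complex.I_re, Complex.I_im]
    ring
  have key : ∀ (c₀ x : ℝ) (P : ℝ → ℂ → Prop), 0 < c₀ → 0 < x →
      (∀ e w, e ^ 2 = 1 → P e w →
        x ≤ c₀ * Real.cos (β * (w.im - y₀)) - e * Real.sin (β * (w.im - y₀))) →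
      ∃ M₀ : ℝ, ∀ e : ℝ, e ^ 2 = 1 → ∀ w ∈ halfPlane 1 M₀, P e w →
        0 ≤ (p w ^ 2 * ((c₀ : ℝ) + (e : ℝ) * Complex.I) / ħ).re := by
    intro c₀ x P hc₀ hx hP
    have h1 : Tendsto (fun u => dl u * (c₀ + 1)) atTop (𝓝 0) := by
      simpa using hdl0.mul_const (c₀ + 1)
    obtain ⟨M₀, hM₀, hM₁⟩ := ((eventually_ge_atTop M).and
      (h1.eventually (eventually_le_nhds hx))).exists
    refine ⟨M₀, fun e he w hw hPw => ?_⟩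
    have hw' : M₀ < 1 * w.re := hw
    obtain ⟨ξ, hξ, hξn⟩ := hp' w (hM₀.trans_lt hw')
    rw [one_mul] at hw'
    have e1 : p w ^ 2 * ((c₀ : ℝ) + (e : ℝ) * Complex.I) / ħ =
        ((Real.exp (β * w.re) * ‖ħ‖⁻¹ : ℝ) : ℂ) * ((1 + ξ) *
          (Complex.exp (((β * (w.im - y₀) : ℝ) : ℂ) * Complex.I) *
            ((c₀ : ℝ) + (e : ℝ) * Complex.I))) := by
      rw [hξ]
      linear_combination (1 + ξ) * ((c₀ : ℝ) + (e : ℝ) * Complex.I) * hinv w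
    rw [e1]
    refine re_one_add_mul_nonneg (x := x) (y := c₀ + 1) (by positivity) ?_ ?_ ?_
    · rw [hdir]
      exact hP e w he hPw
    · rw [norm_mul, Complex.norm_exp_ofReal_mul_I, one_mul]
      exact norm_add_I_le hc₀ he
    · refine le_trans ?_ hM₁
      have := hξn.trans (hdlanti hw'.le)
      gcongr
  have hangle : ∀ (e : ℝ) (w : ℂ), e ^ 2 = 1 →
      Real.cos (β * (w.im - y₀)) = Real.cos (β * (e * (w.im - y₀))) ∧
      Real.sin (β * (w.im - y₀)) = e * Real.sin (β * (e * (w.im - y₀))) := fun e w he => by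
    rcases sq_eq_sq_iff_eq_or_eq_neg.1 (he.trans (one_pow 2).symm) with rfl | rfl
    · simp
    · rw [neg_one_mul, mul_neg, Real.cos_neg, Real.sin_neg]
      simp
  refine ⟨?_, fun b hb => ?_, fun b hb => ?_⟩
  · set A := 2 * (α + 1) + 2 * ‖ν‖ with hA
    set B := (2 * (α + 1)) ^ 2 + 4 * ‖ν‖ with hB
    have hA0 : 0 < A := by positivity
    have hB0 : 0 < B := by positivity
    refine ⟨M, (8 * B + 5 * A ^ 2) / 2, β, ‖ħ‖⁻¹ / 2, Qf_differentiable α ν, hħ,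
      by norm_num, hpS, by positivity, hβ0, by positivity, fun w hw => ?_,
      fun w hw him => ?_⟩
    · obtain ⟨h1, h2⟩ := hH w hw
      obtain ⟨ξ, hξ, hξn⟩ := hp' w hw
      have e1 : Real.exp (2 * w.re) ≤ Real.exp (2 * (α + 1) * w.re) :=
        Real.exp_le_exp.2 (by nlinarith)
      have e2 : 1 / 2 ≤ ‖1 + ξ‖ := by
        have := norm_sub_norm_le (1 : ℂ) (-ξ)
        rw [norm_one, norm_neg, sub_neg_eq_add] at this
        linarith
      have e4 : ‖e₀ w ^ 2‖ = Real.exp (2 * (α + 1) * w.re) := by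
        rw [norm_pow, hen, ← Real.exp_nat_mul]
        congr 1; rw [hβ]; push_cast; ring
      have e5 : Qf α ν w = Qf α ν w / e₀ w ^ 2 * e₀ w ^ 2 := by
        have := he0 w
        field_simp
      have e6 : ‖Qf α ν w‖ = ‖Qf α ν w / e₀ w ^ 2‖ * Real.exp (2 * (α + 1) * w.re) := by
        conv_lhs => rw [e5]
        rw [norm_mul, e4]
      have e3 : |‖Qf α ν w / e₀ w ^ 2‖ - 1| ≤ 1 / 2 := by
        have := abs_norm_sub_norm_le (Qf α ν w / e₀ w ^ 2) 1
        rw [norm_one] at this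
        exact this.trans ((hQ1 w).trans h2)
      rw [abs_le] at e3
      have hX := Real.exp_pos (2 * (α + 1) * w.re)
      have := norm_errF_le (Q := Qf α ν) (q := p w ^ 2) (w := w)
        (X := Real.exp (2 * (α + 1) * w.re)) (Y := 1)
        (R := Real.exp (β * w.re)) (A := A) (B := B) hX (Real.exp_pos _) zero_le_one le_rfl
        hB0.le (by rw [e6]; nlinarith) (by rw [e6]; nlinarith)
        ((norm_deriv_Qf_le α hα ν w).trans (by
          have : 2 * ‖ν‖ * Real.exp (2 * w.re) ≤ 2 * ‖ν‖ * Real.exp (2 * (α + 1) * w.re) := by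
            gcongr
          rw [hA]; linarith))
        ((norm_deriv_deriv_Qf_le α hα ν w).trans (by
          have : 4 * ‖ν‖ * Real.exp (2 * w.re) ≤ 4 * ‖ν‖ * Real.exp (2 * (α + 1) * w.re) := by
            gcongr
          rw [hB]; linarith)) (by
            rw [hξ, norm_mul, hen]
            have := Real.exp_pos (β * w.re)
            nlinarith)
      rwa [one_div, ← Real.exp_neg, ← one_mul w.re] at this
    · obtain ⟨h1, h2⟩ := hH w hw
      obtain ⟨ξ, hξ, hξn⟩ := hp' w hw
      have e1 : p w ^ 2 * ((1 : ℝ) : ℂ) / ħ =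
          ((Real.exp (β * w.re) * ‖ħ‖⁻¹ : ℝ) : ℂ) * (1 + ξ) := by
        have := hinv w
        rw [him, sub_self, mul_zero, Complex.ofReal_zero, zero_mul, Complex.exp_zero, mul_one] at this
        rw [hξ, ← this]; push_cast; ring
      have e4 := (abs_le.1 (Complex.abs_re_le_norm ξ)).1
      have e5 : 1 ≤ Real.exp (β * w.re) := Real.one_le_exp (by positivity)
      rw [e1, Complex.re_ofReal_mul, Complex.add_re, Complex.one_re]
      have e6 : 1 / 2 ≤ 1 + ξ.re := by linarith
      calc ‖ħ‖⁻¹ / 2 = 1 * ‖ħ‖⁻¹ * (1 / 2) := by ring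
        _ ≤ _ := by gcongr
  -- The bound B must be at least π/2 for `le_cos_add_sin`. Inward directions are those of `key`
  -- with -e in place of e.
  · set B := max (β * b) (Real.pi / 2) with hB
    have hB' : B < Real.pi := max_lt hb (by linarith [Real.pi_pos])
    have hB'' : Real.pi / 2 ≤ B := le_max_right _ _
    have hs : 0 < Real.sin B := Real.sin_pos_of_pos_of_lt_pi (by linarith [Real.pi_pos]) hB'
    obtain ⟨M₀, hM₀⟩ := key (Real.sin B / 2) (Real.sin B / 2)
      (fun e w => 0 ≤ -e * (w.im - y₀) ∧ -e * (w.im - y₀) ≤ b)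
      (by positivity) (by positivity) (fun e w he hP => by
        obtain ⟨h1, h2⟩ := hangle (-e) w (by simpa using he)
        have h3 := le_cos_add_sin (x := β * (-e * (w.im - y₀))) (mul_nonneg hβ0.le hP.1)
          ((mul_le_mul_of_nonneg_left hP.2 hβ0.le).trans (le_max_left _ _)) hB'' hB'
        rw [h1, h2]
        linear_combination h3 - Real.sin (β * (-e * (w.im - y₀))) * he)
    refine ⟨Real.sin B / 2, by positivity, M₀, fun e he w hw h1 h2 => ?_⟩
    refine (hM₀ (-e) (by simpa using he) w hw (by simpa using ⟨h1, h2⟩)).trans_eq ?_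
    congr 1; push_cast; ring
  · rcases lt_or_ge b 0 with hb0 | hb0
    -- For b < 0 the strip is empty.
    · exact ⟨1, one_pos, 0, fun e he w hw h1 h2 => by linarith⟩
    have hcos : 0 < Real.cos (β * b) :=
      Real.cos_pos_of_mem_Ioo ⟨by linarith [Real.pi_pos, mul_nonneg hβ0.le hb0], hb⟩
    -- The slope 2/cos(βb) makes the cosine term at least 2, against a sine of at most 1.
    obtain ⟨M₀, hM₀⟩ := key (2 / Real.cos (β * b)) 1
      (fun e w => 0 ≤ e * (w.im - y₀) ∧ e * (w.im - y₀) ≤ b)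
      (by positivity) (by positivity) (fun e w he hP => by
        obtain ⟨h1, h2⟩ := hangle e w he
        have h3 : Real.cos (β * b) ≤ Real.cos (β * (e * (w.im - y₀))) :=
          Real.cos_le_cos_of_nonneg_of_le_pi (mul_nonneg hβ0.le hP.1)
            (by linarith [Real.pi_pos]) (mul_le_mul_of_nonneg_left hP.2 hβ0.le)
        have h4 := Real.sin_le_one (β * (e * (w.im - y₀)))
        have h5 : 2 ≤ 2 / Real.cos (β * b) * Real.cos (β * (e * (w.im - y₀))) := by
          calc 2 = 2 / Real.cos (β * b) * Real.cos (β * b) := by field_simp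
            _ ≤ _ := by gcongr
        rw [h1, h2]
        linear_combination h5 + h4 + Real.sin (β * (e * (w.im - y₀))) * he)
    refine ⟨2 / Real.cos (β * b), by positivity, M₀, fun e he w hw h1 h2 => ?_⟩
    refine (hM₀ e he w hw ⟨h1, h2⟩).trans_eq ?_
    congr 1; push_cast; ring

end

section

/-! ### Boundary points -/

/-- Needed because the rescaling by a complex ħ translates w by log ħ/(α+1), which moves the centre
of a strip. -/
lemma tendsto_add_stripFilter (η : ℝ) {y b y' b' : ℝ} {z : ℂ} (h : b + |y + z.im - y'| ≤ b') :
    Tendsto (fun w => w + z) (stripFilter η y b) (stripFilter η y' b') := by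
  refine tendsto_inf.2 ⟨tendsto_comap_iff.2 ?_, tendsto_principal.2 ?_⟩
  · have h1 : Tendsto (fun w : ℂ => η * w.re) (stripFilter η y b) atTop :=
      tendsto_comap.mono_left inf_le_left
    refine (tendsto_atTop_add_const_right _ (η * z.re) h1).congr fun w => ?_
    simp [mul_add]
  · filter_upwards [eventually_stripFilter η y b 0] with w hw
    have : (w + z).im - y' = (w.im - y) + (y + z.im - y') := by simp; ring
    show |(w + z).im - y'| ≤ b'
    rw [this]
    exact (abs_add_le _ _).trans (by linarith [hw.2])

lemma vertexFilter_zero (α : ℝ) : vertexFilter α Vertex.zero = ⨆ B : ℝ, stripFilter (-1) 0 B := by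
  simp only [vertexFilter, stripFilter, sub_zero]
  congr 1
  funext B
  congr 1
  have : (fun w : ℂ => -1 * w.re) = Neg.neg ∘ Complex.re := by funext w; simp
  rw [this, ← comap_comap, comap_neg_atTop]

lemma vertexFilter_infty (α : ℝ) (k : ℤ) : vertexFilter α (Vertex.infty k) =
    ⨆ (ε : ℝ) (_ : 0 < ε), stripFilter 1 (k * Real.pi / (α + 1)) ((Real.pi - ε) / (2 * α + 2)) := by
  simp only [vertexFilter, stripFilter, one_mul]

lemma vertexFilter_neBot (α : ℝ) (v : Vertex) : (vertexFilter α v).NeBot := by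
  cases v with
  | zero =>
    rw [vertexFilter_zero]
    have := stripFilter_neBot (η := -1) (by norm_num) 0 (b := 0) le_rfl
    exact this.mono (le_iSup (fun B => stripFilter (-1) 0 B) 0)
  | infty k =>
    rw [vertexFilter_infty]
    have := stripFilter_neBot (η := 1) (by norm_num) (k * Real.pi / (α + 1))
      (b := (Real.pi - Real.pi) / (2 * α + 2)) (by simp)
    exact this.mono (le_iSup₂ (f := fun (ε : ℝ) (_ : 0 < ε) =>
      stripFilter 1 (k * Real.pi / (α + 1)) ((Real.pi - ε) / (2 * α + 2))) Real.pi Real.pi_pos)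

lemma eventually_mem_vertexNhd {α : ℝ} (hα : 0 < α) (M : ℝ) (v : Vertex) :
    ∀ᶠ w in vertexFilter α v, w ∈ vertexNhd α M v := by
  cases v with
  | zero =>
    rw [vertexFilter_zero, eventually_iSup]
    intro B
    filter_upwards [eventually_stripFilter (-1) 0 B M] with w hw
    show w.re < -M
    linarith [hw.1]
  | infty k =>
    simp only [vertexFilter_infty, eventually_iSup]
    intro ε hε
    filter_upwards [eventually_stripFilter 1 (k * Real.pi / (α + 1))
      ((Real.pi - ε) / (2 * α + 2)) M] with w hw
    refine ⟨by linarith [hw.1], hw.2.trans_lt ?_⟩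
    gcongr
    linarith

lemma convex_vertexNhd (α M : ℝ) (v : Vertex) : Convex ℝ (vertexNhd α M v) := by
  cases v with
  | zero => exact convex_halfSpace_re_lt (-M)
  | infty k =>
    refine (convex_halfSpace_re_gt M).inter ?_
    have : {w : ℂ | |w.im - k * Real.pi / (α + 1)| < Real.pi / (2 * α + 2)} =
        {w : ℂ | k * Real.pi / (α + 1) - Real.pi / (2 * α + 2) < w.im} ∩
        {w : ℂ | w.im < k * Real.pi / (α + 1) + Real.pi / (2 * α + 2)} := by
      ext w
      simp only [mem_ofPred_eq, mem_inter_iff, abs_lt]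
      constructor <;> rintro ⟨h1, h2⟩ <;> constructor <;> linarith
    show Convex ℝ {w : ℂ | |w.im - k * Real.pi / (α + 1)| < Real.pi / (2 * α + 2)}
    rw [this]
    exact (convex_halfSpace_im_gt _).inter (convex_halfSpace_im_lt _)

lemma isOpen_vertexNhd (α M : ℝ) (v : Vertex) : IsOpen (vertexNhd α M v) := by
  cases v with
  | zero => exact isOpen_lt Complex.continuous_re continuous_const
  | infty k =>
    exact (isOpen_lt continuous_const Complex.continuous_re).inter
      (isOpen_lt (f := fun w : ℂ => |w.im - k * Real.pi / (α + 1)|) (by fun_prop) continuous_const)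

/-- Near each boundary point: a root such that `re S` grows towards it, and the subdominant
solutions. -/
lemma exists_subdominant_at {α : ℝ} (hα : 0 < α) (ν : ℂ) (v : Vertex) : ∃ η M p S,
    RootOn (Qf α ν) p S (halfPlane η M) ∧ (∀ᶠ w in vertexFilter α v, w ∈ halfPlane η M) ∧
    Tendsto (fun w => (S w).re) (vertexFilter α v) atTop ∧
    ∀ ħ : ℂ, ħ ≠ 0 → |ħ.arg| < Real.pi / 2 → ∃ χ, IsSol (fun w => Qf α ν w / ħ ^ 2) χ ∧
      Tendsto (fun w => dev (Qf α ν) (-ħ) (p w) (S w) χ w) (vertexFilter α v) (𝓝 0) ∧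
      ∀ g, IsSol (fun w => Qf α ν w / ħ ^ 2) g → wr g χ 0 ≠ 0 →
        Tendsto (fun w => χ (w + Complex.log ħ / (α + 1)) / g (w + Complex.log ħ / (α + 1)))
          (vertexFilter α v) (𝓝 0) := by
  have him : ∀ ħ : ℂ, (Complex.log ħ / (α + 1)).im = ħ.arg / (α + 1) := fun ħ => by
    have : (α + 1 : ℂ) = ((α + 1 : ℝ) : ℂ) := by push_cast; rfl
    rw [this, Complex.div_ofReal_im, Complex.log_im]
  cases v with
  | zero =>
    obtain ⟨M, p, S, hpS, h⟩ := exists_endData_zero hα ν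
    refine ⟨-1, M, p, S, hpS, ?_, ?_, fun ħ hħ harg => ?_⟩
    · rw [vertexFilter_zero, eventually_iSup]
      exact fun B => (eventually_stripFilter (-1) 0 B M).mono fun w hw => hw.1
    -- p and S do not depend on ħ, so the growth of Re S is read off at ħ = 1.
    · obtain ⟨⟨M', K, c, m, hE⟩, hin, hout⟩ := h 1 one_ne_zero (by simp [Real.pi_pos])
      rw [vertexFilter_zero, tendsto_iSup]
      intro B
      obtain ⟨-, -, -, h1⟩ := hE.exists_dominant (hout B)
      simpa using h1
    · obtain ⟨⟨M', K, c, m, hE⟩, hin, hout⟩ := h ħ hħ harg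
      obtain ⟨χ, hχ, hb⟩ := hE.exists_subdominant
      refine ⟨χ, hχ, ?_, fun g hg hw => ?_⟩
      · rw [vertexFilter_zero, tendsto_iSup]
        exact fun B => hE.tendsto_dev hχ hb (hin B)
      · rw [vertexFilter_zero, tendsto_iSup]
        intro B
        -- The strip is widened to absorb the imaginary part of the translation.
        set b := |B| + |0 + (Complex.log ħ / (α + 1)).im - 0| with hb'
        exact (hE.tendsto_div (b := b) (by positivity) (hout _) hχ
          (hE.tendsto_dev hχ hb (hin _)) hg hw).comp
          (tendsto_add_stripFilter (-1) (by rw [hb']; gcongr; exact le_abs_self B))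
  | infty k =>
    have hβ : 0 < α + 1 := by linarith
    have hπ := Real.pi_pos
    have e2 : ∀ ε : ℝ, (α + 1) * ((Real.pi - ε) / (2 * α + 2)) = (Real.pi - ε) / 2 := fun ε => by
      have : 2 * α + 2 = 2 * (α + 1) := by ring
      rw [this]; field_simp
    obtain ⟨M, p, S, hpS, h⟩ := exists_endData_infty hα ν k
    refine ⟨1, M, p, S, hpS, ?_, ?_, fun ħ hħ harg => ?_⟩
    · simp only [vertexFilter_infty, eventually_iSup]
      exact fun ε hε => (eventually_stripFilter 1 _ _ M).mono fun w hw => hw.1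
    · obtain ⟨⟨M', K, c, m, hE⟩, hin, hout⟩ := h 1 one_ne_zero
      simp only [vertexFilter_infty, tendsto_iSup]
      intro ε hε
      obtain ⟨-, -, -, h1⟩ := hE.exists_dominant (hout ((Real.pi - ε) / (2 * α + 2)) (by
        rw [e2]; linarith))
      simpa using h1
    · obtain ⟨⟨M', K, c, m, hE⟩, hin, hout⟩ := h ħ hħ
      obtain ⟨χ, hχ, hb⟩ := hE.exists_subdominant
      refine ⟨χ, hχ, ?_, fun g hg hw => ?_⟩
      · simp only [vertexFilter_infty, tendsto_iSup]
        intro ε hε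
        -- The base line for ħ is off the centre of the sector by arg ħ/(α+1). In units of the
        -- phase, the required half-width is (π-ε)/2 + |arg ħ|, below π because |arg ħ| < π/2; this
        -- uses the full width of the inward condition.
        have h1 := hE.tendsto_dev hχ hb (hin ((Real.pi - ε) / (2 * α + 2) + |ħ.arg| / (α + 1)) (by
          rw [mul_add, e2, mul_div_cancel₀ _ hβ.ne']; linarith))
        have h2 := h1.comp (tendsto_add_stripFilter 1 (y := k * Real.pi / (α + 1))
          (b := (Real.pi - ε) / (2 * α + 2)) (z := 0) (by
            rw [Complex.zero_im, add_zero, ← sub_div, sub_add_cancel_left, neg_div, abs_neg,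
              abs_div, abs_of_pos hβ]))
        simpa [Function.comp_def] using h2
      · simp only [vertexFilter_infty, tendsto_iSup]
        intro ε hε
        -- For ε > π the sector has negative width and the filter is trivial.
        rcases lt_or_ge Real.pi ε with hε' | hε'
        · have : stripFilter 1 (k * Real.pi / (α + 1)) ((Real.pi - ε) / (2 * α + 2)) = ⊥ := by
            rw [← empty_mem_iff_bot]
            refine (eventually_stripFilter 1 (k * Real.pi / (α + 1)) _ 0).mono fun w hw => ?_
            have h1 : (Real.pi - ε) / (2 * α + 2) < 0 := div_neg_of_neg_of_pos (by linarith) (by linarith)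
            exact absurd (abs_nonneg _) (not_le.2 (hw.2.trans_lt h1))
          rw [this]
          exact tendsto_bot
        -- The translation by log ħ/(α+1) carries the centre of the sector exactly to the base line
        -- for ħ, so the narrower outward range suffices.
        · exact (hE.tendsto_div (b := (Real.pi - ε) / (2 * α + 2))
            (div_nonneg (by linarith) (by linarith)) (hout _ (by rw [e2]; linarith)) hχ
            (hE.tendsto_dev hχ hb (hin _ (by rw [e2]; linarith))) hg hw).comp
            (tendsto_add_stripFilter 1 (by
              rw [him, ← add_div, sub_self, abs_zero, add_zero]))

/-- For every root in a neighbourhood of a boundary point there is a sign `s` such that `s re S`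
grows towards it, and subdominant solutions normalized by this root. -/
lemma exists_normalized_subdominant {α : ℝ} (hα : 0 < α) (ν : ℂ) (v : Vertex) {M : ℝ}
    {p S : ℂ → ℂ} (h : RootOn (Qf α ν) p S (vertexNhd α M v)) : ∃ s : ℝ, s ^ 2 = 1 ∧
    Tendsto (fun w => s * (S w).re) (vertexFilter α v) atTop ∧
    ∀ ħ : ℂ, ħ ≠ 0 → |ħ.arg| < Real.pi / 2 → ∃ χ, IsSol (fun w => Qf α ν w / ħ ^ 2) χ ∧
      Tendsto (fun w => dev (Qf α ν) (-(s * ħ)) (p w) (S w) χ w) (vertexFilter α v) (𝓝 0) ∧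
      ∀ g, IsSol (fun w => Qf α ν w / ħ ^ 2) g → wr g χ 0 ≠ 0 →
        Tendsto (fun w => χ (w + Complex.log ħ / (α + 1)) / g (w + Complex.log ħ / (α + 1)))
          (vertexFilter α v) (𝓝 0) := by
  obtain ⟨η, M', p', S', hpS', hH, hS', hχ'⟩ := exists_subdominant_at hα ν v
  have hne := vertexFilter_neBot α v
  have hU := eventually_mem_vertexNhd hα M v
  set V := vertexNhd α M v ∩ halfPlane η M' with hV
  have hVc : Convex ℝ V := (convex_vertexNhd α M v).inter (convex_halfPlane η M')
  have hVo : IsOpen V := (isOpen_vertexNhd α M v).inter (isOpen_halfPlane η M')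
  obtain ⟨w₀, hw₀⟩ : V.Nonempty := by
    obtain ⟨w, hw⟩ := (hU.and hH).exists
    exact ⟨w, hw⟩
  have hVe : ∀ᶠ w in vertexFilter α v, w ∈ V := hU.and hH
  obtain ⟨c, d, hc, hcd⟩ := (hpS'.mono inter_subset_right).unique hVc hVo
    (h.mono inter_subset_left) hw₀
  have hc2 : c ^ 2 = 1 ∨ c ^ 2 = -1 := by
    -- The two roots differ by a fourth root of unity c; the sign c² tells whether the given S grows
    -- or decays towards the vertex.
    refine sq_eq_sq_iff_eq_or_eq_neg.1 ?_
    linear_combination hc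
  obtain ⟨s, hs, hsc⟩ : ∃ s : ℝ, s ^ 2 = 1 ∧ (s : ℂ) = c ^ 2 := by
    rcases hc2 with h | h
    · exact ⟨1, by norm_num, by rw [h]; simp⟩
    · exact ⟨-1, by norm_num, by rw [h]; simp⟩
  have hss : (s : ℂ) * s = 1 := by rw [← Complex.ofReal_mul, ← sq, hs, Complex.ofReal_one]
  have hs0 : (s : ℂ) ≠ 0 := by intro h; simp [h] at hss
  have hc0 : c ≠ 0 := by rintro rfl; norm_num at hc
  refine ⟨s, hs, ?_, fun ħ hħ harg => ?_⟩
  · refine (tendsto_atTop_add_const_right _ (s * d.re) hS').congr' ?_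
    filter_upwards [hVe] with w hw
    rw [(hcd w hw).2, ← hsc, Complex.add_re, Complex.re_ofReal_mul]
    linear_combination -(S' w).re * hs
  · obtain ⟨χ, hχ, hdev, hdom⟩ := hχ' ħ hħ harg
    -- This factor compensates the changes of root and of additive constant in S, so that the
    -- deviation with respect to (p, S) equals the one with respect to (p', S').
    set a : ℂ := (c * Complex.exp (d / (s * ħ)))⁻¹ with ha
    have ha0 : a ≠ 0 := inv_ne_zero (mul_ne_zero hc0 (Complex.exp_ne_zero _))
    refine ⟨fun w => a * χ w, hχ.const_mul a, ?_, fun g hg hw => ?_⟩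
    · refine hdev.congr' ?_
      filter_upwards [hVe] with w hw
      have key : ∀ e : ℂ, lg (Qf α ν) (s * e) (p w) (fun w => a * χ w) w *
          Complex.exp (-(S w / -(s * ħ))) =
          lg (Qf α ν) e (p' w) χ w * Complex.exp (-(S' w / -ħ)) := fun e => by
        rw [lg_const_mul _ _ _ _ hχ.1, (hcd w hw).1, (hcd w hw).2, hsc, lg_root_mul _ _ _ _ hc, ← hsc,
          ha, mul_inv, ← Complex.exp_neg]
        have e1 : -(((s : ℂ) * S' w + d) / -(s * ħ)) = -(S' w / -ħ) + d / (s * ħ) := by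
          field_simp
        rw [e1, Complex.exp_add, Complex.exp_neg (d / (s * ħ))]
        have := Complex.exp_ne_zero (d / (s * ħ))
        field_simp
      have k1 := key (-ħ)
      have k2 := key ħ
      simp only [dev, neg_neg]
      rw [← k1, ← k2, mul_neg]
    · have hw' : wr g χ 0 ≠ 0 := by
        intro h0
        apply hw
        have : wr g (fun w => a * χ w) 0 = a * wr g χ 0 := by
          simp only [wr, ((hχ.hasDerivAt 0).const_mul a).deriv]; ring
        rw [this, h0, mul_zero]
      have := (hdom g hg hw').const_mul a
      rw [mul_zero] at this
      refine this.congr fun w => ?_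
      ring

end

section

/-! ### Sides of the quadrilateral -/

lemma Qf_eq_redV (α : ℝ) (ν w : ℂ) : Qf α ν w = Complex.exp w ^ 2 * redV α ν w := by
  have h1 : Complex.exp (2 * (α + 1) * w) = Complex.exp w ^ 2 * Complex.exp (2 * α * w) := by
    rw [← Complex.exp_nat_mul, ← Complex.exp_add]; congr 1; push_cast; ring
  have h2 : Complex.exp (2 * w) = Complex.exp w ^ 2 := by
    rw [← Complex.exp_nat_mul]; push_cast; rfl
  have := Complex.exp_ne_zero w
  rw [Qf, redV, h1, h2]
  field_simp

/-- Says that F dx = `errF` dw. The summand 1/(4x²) of F cancels against the terms created by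
passing from x-derivatives of V to w-derivatives of x²V. -/
lemma forcing_mul_exp {α : ℝ} {ν w r : ℂ} (h0 : redV α ν w ≠ 0) (hr : r ≠ 0) :
    forcing α ν w r * Complex.exp w = errF (Qf α ν) (r * Complex.exp w) w := by
  have hE := Complex.exp_ne_zero w
  have hinv : ∀ w, HasDerivAt (fun w => 1 / Complex.exp w ^ 2) (-2 / Complex.exp w ^ 2) w :=
    fun w => by
      have hE := Complex.exp_ne_zero w
      refine ((hasDerivAt_const w (1 : ℂ)).div ((Complex.hasDerivAt_exp w).fun_pow 2)
        (pow_ne_zero 2 hE)).congr_deriv ?_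
      field_simp
      simp
      ring
  have hV : ∀ w, HasDerivAt (redV α ν)
      (2 * α * Complex.exp (2 * α * w) + -2 / Complex.exp w ^ 2) w := fun w =>
    ((hasDerivAt_cexp_const_mul (2 * α) w).sub_const ν).add (hinv w)
  have hd : deriv (redV α ν) = fun w =>
    2 * α * Complex.exp (2 * α * w) + -2 / Complex.exp w ^ 2 := funext fun w => (hV w).deriv
  have hd1 : ddx (redV α ν) = fun w =>
      Complex.exp (-w) * (2 * α * Complex.exp (2 * α * w) + -2 * (1 / Complex.exp w ^ 2)) := by
    funext w; rw [ddx, hd]; ring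
  have hd2 : ddx (ddx (redV α ν)) w = Complex.exp (-w) *
      (-Complex.exp (-w) * (2 * α * Complex.exp (2 * α * w) + -2 * (1 / Complex.exp w ^ 2)) +
      Complex.exp (-w) * (2 * α * (2 * α * Complex.exp (2 * α * w)) +
        -2 * (-2 / Complex.exp w ^ 2))) := by
    rw [ddx, hd1]
    congr 1
    refine HasDerivAt.deriv ?_
    refine (((hasDerivAt_neg w).cexp).fun_mul (((hasDerivAt_cexp_const_mul (2 * α) w).const_mul
      (2 * α : ℂ)).fun_add ((hinv w).const_mul (-2)))).congr_deriv ?_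
    ring
  have h1 : Complex.exp (2 * (α + 1) * w) = Complex.exp w ^ 2 * Complex.exp (2 * α * w) := by
    rw [← Complex.exp_nat_mul, ← Complex.exp_add]; congr 1; push_cast; ring
  have h2 : Complex.exp (2 * w) = Complex.exp w ^ 2 := by
    rw [← Complex.exp_nat_mul]; push_cast; rfl
  have hQ0 : redV α ν w = Complex.exp (2 * α * w) - ν + 1 / Complex.exp w ^ 2 := rfl
  rw [forcing, errF, deriv_deriv_Qf, deriv_Qf, Qf_eq_redV, hd2, hd1]
  simp only [h1, h2, Complex.exp_neg]
  generalize Complex.exp (2 * α * w) = X at *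
  generalize Complex.exp w = E at *
  have hν : ν = X + 1 / E ^ 2 - redV α ν w := by rw [hQ0]; ring
  generalize redV α ν w = V at *
  subst hν
  field_simp
  ring

lemma eqOn_const_of_hasDerivAt {f g f' : ℝ → ℂ} {I : Set ℝ} (hI : Convex ℝ I)
    (hf : ∀ τ ∈ I, HasDerivAt f (f' τ) τ) (hg : ∀ τ ∈ I, HasDerivAt g (f' τ) τ) {x y : ℝ}
    (hx : x ∈ I) (hy : y ∈ I) : f y - g y = f x - g x := by
  have := hI.norm_image_sub_le_of_norm_hasDerivWithin_le (f := fun τ => f τ - g τ)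
    (f' := fun _ => 0) (C := 0) (fun τ hτ => by
      simpa using ((hf τ hτ).fun_sub (hg τ hτ)).hasDerivWithinAt) (by simp) hx hy
  rw [zero_mul, norm_le_zero_iff, sub_eq_zero] at this
  exact this

lemma LGPath.unique {Q : ℂ → ℂ} {γ γ' p T p' T' : ℝ → ℂ} {I : Set ℝ} (hI : Convex ℝ I)
    (h : LGPath Q γ γ' p T I) (h' : LGPath Q γ γ' p' T' I) {x : ℝ} (hx : x ∈ I)
    (hp : p x = p' x) (hT : T x = T' x) : ∀ τ ∈ I, p τ = p' τ ∧ T τ = T' τ := by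
  have hpp : ∀ τ ∈ I, p τ = p' τ := fun τ hτ => by
    have h1 : ∀ τ ∈ I, HasDerivAt (fun τ => p τ / p' τ) 0 τ := fun τ hτ => by
      have h0 := h'.root_ne_zero hτ
      refine ((h.deriv_root τ hτ).div (h'.deriv_root τ hτ) h0).congr_deriv ?_
      field_simp
      ring
    have h2 := eqOn_const_of_hasDerivAt hI h1 (fun τ _ => hasDerivAt_const τ 0) hx hτ
    rw [hp, div_self (h'.root_ne_zero hx), sub_left_inj, div_eq_one_iff_eq (h'.root_ne_zero hτ)] at h2
    exact h2
  refine fun τ hτ => ⟨hpp τ hτ, ?_⟩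
  have := eqOn_const_of_hasDerivAt hI h.deriv_action (fun τ hτ => by
    rw [hpp τ hτ]; exact h'.deriv_action τ hτ) hx hτ
  rwa [hT, sub_self, sub_eq_zero] at this

lemma hasDerivAt_integral_of_continuousOn_Ioo {f : ℝ → ℂ} {a b s t : ℝ}
    (hf : ContinuousOn f (Ioo a b)) (hs : s ∈ Ioo a b) (ht : t ∈ Ioo a b) :
    HasDerivAt (fun t => ∫ τ in s..t, f τ) (f t) t := by
  refine intervalIntegral.integral_hasDerivAt_right ?_ ?_ (hf.continuousAt (Ioo_mem_nhds ht.1 ht.2))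
  · exact (hf.mono (ordConnected_Ioo.uIcc_subset hs ht)).intervalIntegrable
  · exact hf.stronglyMeasurableAtFilter isOpen_Ioo t ht

lemma exists_lgPath {Q : ℂ → ℂ} (hQ : Differentiable ℂ Q) {γ γ' : ℝ → ℂ} {a b : ℝ}
    (hγ : ∀ τ ∈ Ioo a b, HasDerivAt γ (γ' τ) τ) (hγ' : ContinuousOn γ' (Ioo a b))
    (h0 : ∀ τ ∈ Ioo a b, Q (γ τ) ≠ 0) {s : ℝ} (hs : s ∈ Ioo a b) {p₀ : ℂ}
    (hp₀ : p₀ ^ 4 = Q (γ s)) (T₀ : ℂ) :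
    ∃ p T, LGPath Q γ γ' p T (Ioo a b) ∧ p s = p₀ ∧ T s = T₀ := by
  have hγc : ContinuousOn γ (Ioo a b) := fun τ hτ => (hγ τ hτ).continuousAt.continuousWithinAt
  set L : ℝ → ℂ := fun τ => deriv Q (γ τ) / (4 * Q (γ τ)) * γ' τ with hL
  have hLc : ContinuousOn L (Ioo a b) :=
    (((differentiable_deriv hQ).continuous.comp_continuousOn hγc).div
      (continuousOn_const.mul (hQ.continuous.comp_continuousOn hγc))
      (fun τ hτ => mul_ne_zero (by norm_num) (h0 τ hτ))).mul hγ'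
  set p : ℝ → ℂ := fun t => p₀ * Complex.exp (∫ τ in s..t, L τ) with hp
  have hpd : ∀ τ ∈ Ioo a b, HasDerivAt p (L τ * p τ) τ := fun τ hτ =>
    ((hasDerivAt_integral_of_continuousOn_Ioo hLc hs hτ).cexp.const_mul p₀).congr_deriv (by
      simp only [hp]; ring)
  have hpc : ContinuousOn p (Ioo a b) := fun τ hτ => (hpd τ hτ).continuousAt.continuousWithinAt
  refine ⟨p, fun t => T₀ + ∫ τ in s..t, p τ ^ 2 * γ' τ, ⟨hγ, hγ', hpd, ?_, h0, fun τ hτ => ?_⟩,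
    by simp [hp], by simp⟩
  · have hr : ∀ τ ∈ Ioo a b, HasDerivAt (fun τ => p τ ^ 4 / Q (γ τ)) 0 τ := fun τ hτ => by
      have hQτ := h0 τ hτ
      refine (((hpd τ hτ).fun_pow 4).div ((hQ (γ τ)).hasDerivAt.comp τ (hγ τ hτ)) hQτ).congr_deriv ?_
      simp only [hL, Function.comp]
      field_simp
      ring
    intro τ hτ
    have := eqOn_const_of_hasDerivAt (convex_Ioo a b) hr (fun τ _ => hasDerivAt_const τ 0) hs hτ
    have e : p s = p₀ := by simp [hp]
    rw [e, hp₀, div_self (h0 s hs), sub_left_inj, div_eq_one_iff_eq (h0 τ hτ)] at this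
    exact this
  · exact (hasDerivAt_integral_of_continuousOn_Ioo ((hpc.pow 2).mul hγ') hs hτ).const_add T₀

namespace StrictlyAdmissible

variable {α : ℝ} {N : Set ℂ} {a b : Vertex} (A : StrictlyAdmissible α N a b) {ν : ℂ}

lemma hasDerivAt (hν : ν ∈ N) : ∀ τ ∈ Ioo (0 : ℝ) 1, HasDerivAt (A.γ ν) (deriv (A.γ ν) τ) τ :=
  fun _ hτ => (((A.smooth ν hν).contDiffAt (Ioo_mem_nhds hτ.1 hτ.2)).differentiableAt
    (by simp)).hasDerivAt

lemma continuousOn_deriv (hν : ν ∈ N) : ContinuousOn (deriv (A.γ ν)) (Ioo (0 : ℝ) 1) :=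
  (A.smooth ν hν).continuousOn_deriv_of_isOpen isOpen_Ioo (by simp)

lemma continuousOn (hν : ν ∈ N) : ContinuousOn (A.γ ν) (Ioo (0 : ℝ) 1) :=
  (A.smooth ν hν).continuousOn

lemma Qf_ne_zero (hν : ν ∈ N) : ∀ τ ∈ Ioo (0 : ℝ) 1, Qf α ν (A.γ ν τ) ≠ 0 := fun τ hτ => by
  rw [Qf_eq_redV]
  exact mul_ne_zero (pow_ne_zero 2 (Complex.exp_ne_zero _)) (A.ne_zero ν hν τ hτ)

/-- The branch of `√V dx / dw`. -/
def q (A : StrictlyAdmissible α N a b) (ν : ℂ) (τ : ℝ) : ℂ := A.r ν τ * Complex.exp (A.γ ν τ)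

lemma continuousOn_q (hν : ν ∈ N) : ContinuousOn (A.q ν) (Ioo (0 : ℝ) 1) :=
  (A.branch_continuous ν hν).mul (A.continuousOn hν).cexp

lemma q_sq (hν : ν ∈ N) : ∀ τ ∈ Ioo (0 : ℝ) 1, A.q ν τ ^ 2 = Qf α ν (A.γ ν τ) := fun τ hτ => by
  rw [Qf_eq_redV, q, mul_pow, A.branch_sq ν hν τ hτ, mul_comm]

/-- p² and √V dx/dw are two continuous square roots of a nonvanishing function on an interval. -/
lemma exists_sign (hν : ν ∈ N) {p T : ℝ → ℂ}
    (h : LGPath (Qf α ν) (A.γ ν) (deriv (A.γ ν)) p T (Ioo 0 1)) :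
    ∃ ε : ℝ, ε ^ 2 = 1 ∧ ∀ τ ∈ Ioo (0 : ℝ) 1, p τ ^ 2 = ε * A.q ν τ := by
  have hpc : ContinuousOn (fun τ => p τ ^ 2) (Ioo (0 : ℝ) 1) := ContinuousOn.pow
    (fun τ hτ => (h.deriv_root τ hτ).continuousAt.continuousWithinAt) 2
  have h0 : ∀ {τ : ℝ}, τ ∈ Ioo (0 : ℝ) 1 → A.q ν τ ≠ 0 := fun {τ} hτ hz => by
    have := A.q_sq hν τ hτ
    rw [hz, zero_pow two_ne_zero] at this
    exact A.Qf_ne_zero hν τ hτ this.symm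
  rcases isPreconnected_Ioo.eq_or_eq_neg_of_sq_eq hpc (A.continuousOn_q hν) (fun τ hτ => by
    simp only [Pi.pow_apply]
    rw [A.q_sq hν τ hτ, ← pow_mul, h.root τ hτ]) h0 with h1 | h1
  · exact ⟨1, by norm_num, fun τ hτ => by simpa using h1 hτ⟩
  · exact ⟨-1, by norm_num, fun τ hτ => by simpa using h1 hτ⟩

lemma action_eq (hν : ν ∈ N) {p T : ℝ → ℂ}
    (h : LGPath (Qf α ν) (A.γ ν) (deriv (A.γ ν)) p T (Ioo 0 1)) {ε : ℝ}
    (hp : ∀ τ ∈ Ioo (0 : ℝ) 1, p τ ^ 2 = ε * A.q ν τ) {s t : ℝ} (hs : s ∈ Ioo (0 : ℝ) 1)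
    (ht : t ∈ Ioo (0 : ℝ) 1) : T t - T s = ε * action (A.γ ν) (A.r ν) s t := by
  have hsub := ordConnected_Ioo.uIcc_subset hs ht
  rw [action, ← intervalIntegral.integral_const_mul, ← intervalIntegral.integral_eq_sub_of_hasDerivAt
    (f := T) (f' := fun τ => p τ ^ 2 * deriv (A.γ ν) τ) (fun τ hτ => h.deriv_action τ (hsub hτ))]
  · refine intervalIntegral.integral_congr fun τ hτ => ?_
    simp only [hp τ (hsub hτ), q]
    ring
  · refine ContinuousOn.intervalIntegrable ?_
    refine ContinuousOn.mul (ContinuousOn.pow ?_ 2) ((A.continuousOn_deriv hν).mono hsub)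
    exact fun τ hτ => (h.deriv_root τ (hsub hτ)).continuousAt.continuousWithinAt

lemma norm_errF_mul (hν : ν ∈ N) {p : ℝ → ℂ} {ε : ℝ} (hε : ε ^ 2 = 1)
    (hp : ∀ τ ∈ Ioo (0 : ℝ) 1, p τ ^ 2 = ε * A.q ν τ) {τ : ℝ} (hτ : τ ∈ Ioo (0 : ℝ) 1) :
    ‖errF (Qf α ν) (p τ ^ 2) (A.γ ν τ) * deriv (A.γ ν) τ‖ =
      ‖forcing α ν (A.γ ν τ) (A.r ν τ)‖ * ‖Complex.exp (A.γ ν τ) * deriv (A.γ ν) τ‖ := by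
  have hr : A.r ν τ ≠ 0 := fun h0 => by
    have := A.branch_sq ν hν τ hτ
    rw [h0, zero_pow two_ne_zero] at this
    exact A.ne_zero ν hν τ hτ this.symm
  have h1 := forcing_mul_exp (A.ne_zero ν hν τ hτ) hr
  have hee : |ε| = 1 := by rw [← sq_eq_sq₀ (abs_nonneg _) zero_le_one, sq_abs, hε, one_pow]
  have h2 : ‖errF (Qf α ν) (p τ ^ 2) (A.γ ν τ)‖ =
      ‖errF (Qf α ν) (A.r ν τ * Complex.exp (A.γ ν τ)) (A.γ ν τ)‖ := by
    rw [hp τ hτ, q, errF, errF, norm_div, norm_div _ (A.r ν τ * _), norm_mul (ε : ℂ),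
      Complex.norm_real, Real.norm_eq_abs, hee, one_mul]
  rw [norm_mul, h2, ← h1, norm_mul, norm_mul, mul_assoc]

/-- The roots `(p, S)` near the vertex `a` and `(p', S')` near the vertex `b` are obtained from each
other by continuation along the side, on which `p² = ε √V dx / dw`. -/
structure Linked (A : StrictlyAdmissible α N a b) (ν : ℂ) (M : ℝ) (s t : ℝ) (p S p' S' : ℂ → ℂ)
    (P T : ℝ → ℂ) (ε : ℝ) : Prop where
  mem : ν ∈ N
  sign : ε ^ 2 = 1
  s_mem : s ∈ Ioo (0 : ℝ) 1
  t_mem : t ∈ Ioo (0 : ℝ) 1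
  rootOn : RootOn (Qf α ν) p S (vertexNhd α M a)
  rootOn' : RootOn (Qf α ν) p' S' (vertexNhd α M b)
  path : LGPath (Qf α ν) (A.γ ν) (deriv (A.γ ν)) P T (Ioo 0 1)
  root_sq : ∀ τ ∈ Ioo (0 : ℝ) 1, P τ ^ 2 = ε * A.q ν τ
  start : ∀ τ ∈ Ioc 0 s, P τ = p (A.γ ν τ) ∧ T τ = S (A.γ ν τ)
  finish : ∀ τ ∈ Ico t 1, P τ = p' (A.γ ν τ) ∧ T τ = S' (A.γ ν τ)

/-- Continue the root along the curve from the cut s, then extend its value at the cut t to the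
convex neighbourhood of b. Uniqueness of continuation makes the root along the curve agree with the
two local ones on the cut-off ends. -/
lemma exists_linked (hν : ν ∈ N) {M s t : ℝ} (hst : 0 < s ∧ s < t ∧ t < 1)
    (hs : ∀ τ, 0 < τ → τ ≤ s → A.γ ν τ ∈ vertexNhd α M a)
    (ht : ∀ τ, t ≤ τ → τ < 1 → A.γ ν τ ∈ vertexNhd α M b)
    (hb : ∀ w ∈ vertexNhd α M b, redV α ν w ≠ 0) {p S : ℂ → ℂ}
    (h : RootOn (Qf α ν) p S (vertexNhd α M a)) :
    ∃ p' S' P T ε, A.Linked ν M s t p S p' S' P T ε := by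
  have hs' : s ∈ Ioo (0 : ℝ) 1 := ⟨hst.1, hst.2.1.trans hst.2.2⟩
  have ht' : t ∈ Ioo (0 : ℝ) 1 := ⟨hst.1.trans hst.2.1, hst.2.2⟩
  have hsa := hs s hst.1 le_rfl
  have htb := ht t le_rfl hst.2.2
  obtain ⟨P, T, hPT, hP, hT⟩ := exists_lgPath (Qf_differentiable α ν) (A.hasDerivAt hν)
    (A.continuousOn_deriv hν) (A.Qf_ne_zero hν) hs' (h.root _ hsa) (S (A.γ ν s))
  obtain ⟨p', S', hpS', hp', hS'⟩ := exists_rootOn (Qf_differentiable α ν) (convex_vertexNhd α M b)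
    (isOpen_vertexNhd α M b) (fun w hw => by
      rw [Qf_eq_redV]
      exact mul_ne_zero (pow_ne_zero 2 (Complex.exp_ne_zero _)) (hb w hw)) htb
    (hPT.root t ht') (T t)
  obtain ⟨ε, hε, hPε⟩ := A.exists_sign hν hPT
  have sub1 : Ioc 0 s ⊆ Ioo (0 : ℝ) 1 := fun τ hτ => ⟨hτ.1, hτ.2.trans_lt hs'.2⟩
  have sub2 : Ico t 1 ⊆ Ioo (0 : ℝ) 1 := fun τ hτ => ⟨ht'.1.trans_le hτ.1, hτ.2⟩
  refine ⟨p', S', P, T, ε, hν, hε, hs', ht', h, hpS', hPT, hPε, ?_, ?_⟩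
  · exact (hPT.mono sub1).unique (convex_Ioc 0 s) (h.lgPath (fun τ hτ => A.hasDerivAt hν τ (sub1 hτ))
      ((A.continuousOn_deriv hν).mono sub1) fun τ hτ => hs τ hτ.1 hτ.2) ⟨hst.1, le_rfl⟩ hP hT
  · exact (hPT.mono sub2).unique (convex_Ico t 1) (hpS'.lgPath
      (fun τ hτ => A.hasDerivAt hν τ (sub2 hτ))
      ((A.continuousOn_deriv hν).mono sub2) fun τ hτ => ht τ hτ.1 hτ.2) ⟨le_rfl, hst.2.2⟩
      hp'.symm hS'.symm

end StrictlyAdmissible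

end

/-! ### Wronskian of the two subdominant solutions along a side -/

section

lemma eq_or_eq_neg_of_sq {s ε : ℝ} (hs : s ^ 2 = 1) (hε : ε ^ 2 = 1) : s = ε ∨ s = -ε :=
  sq_eq_sq_iff_eq_or_eq_neg.1 (hs.trans hε.symm)

namespace StrictlyAdmissible.Linked

variable {α : ℝ} {N : Set ℂ} {a b : Vertex} {A : StrictlyAdmissible α N a b} {ν : ℂ} {M s t : ℝ}
  {p S p' S' : ℂ → ℂ} {P T : ℝ → ℂ} {ε : ℝ}

lemma start_eventually (h : A.Linked ν M s t p S p' S' P T ε) :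
    ∀ᶠ τ in 𝓝[>] (0 : ℝ), τ ∈ Ioc 0 s := Ioc_mem_nhdsGT h.s_mem.1

lemma finish_eventually (h : A.Linked ν M s t p S p' S' P T ε) :
    ∀ᶠ τ in 𝓝[<] (1 : ℝ), τ ∈ Ico t 1 := Ico_mem_nhdsLT h.t_mem.2

lemma re_action (h : A.Linked ν M s t p S p' S' P T ε) {x y : ℝ} (hx : x ∈ Ioo (0 : ℝ) 1)
    (hy : y ∈ Ioo (0 : ℝ) 1) :
    ε * (T y).re - ε * (T x).re = (action (A.γ ν) (A.r ν) x y).re := by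
  have h1 := congrArg Complex.re (A.action_eq h.mem h.path h.root_sq hx hy)
  rw [Complex.sub_re, Complex.re_ofReal_mul] at h1
  linear_combination ε * h1 + (action (A.γ ν) (A.r ν) x y).re * h.sign

/-- Both σ Re T and ε Re T tend to +∞ at the end of the side, the second by the divergence of Re ∫√V
dx there; opposite signs would make their sum 0. -/
lemma sign_finish (h : A.Linked ν M s t p S p' S' P T ε) {σ : ℝ} (hσ : σ ^ 2 = 1)
    (hS : Tendsto (fun w => σ * (S' w).re) (vertexFilter α b) atTop) : σ = ε := by
  refine (eq_or_eq_neg_of_sq hσ h.sign).resolve_right fun hneg => ?_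
  have h1 : Tendsto (fun τ => σ * (T τ).re) (𝓝[<] (1 : ℝ)) atTop := by
    refine (hS.comp (A.finish ν h.mem)).congr' ?_
    filter_upwards [h.finish_eventually] with τ hτ
    simp only [Function.comp, (h.finish τ hτ).2]
  have hhalf : (1 / 2 : ℝ) ∈ Ioo (0 : ℝ) 1 := by norm_num
  have h2 : Tendsto (fun τ => ε * (T τ).re) (𝓝[<] (1 : ℝ)) atTop := by
    refine (tendsto_atTop_add_const_right _ (ε * (T (1 / 2)).re)
      (A.levinson ν h.mem (1 / 2) hhalf)).congr' ?_
    filter_upwards [h.finish_eventually] with τ hτ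
    rw [← h.re_action hhalf ⟨h.t_mem.1.trans_le hτ.1, hτ.2⟩]
    ring
  have h3 := h1.atTop_add_atTop h2
  rw [hneg] at h3
  exact not_tendsto_const_atTop (0 : ℝ) _ (h3.congr fun τ => by ring)

/-- Divergence of Re ∫√V dx is not assumed at the start, but monotonicity is enough: a function
increasing along the side cannot tend to +∞ at its beginning. -/
lemma sign_start (h : A.Linked ν M s t p S p' S' P T ε) {σ : ℝ} (hσ : σ ^ 2 = 1)
    (hS : Tendsto (fun w => σ * (S w).re) (vertexFilter α a) atTop) : σ = -ε := by
  refine (eq_or_eq_neg_of_sq hσ h.sign).resolve_left fun hpos => ?_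
  have h1 : Tendsto (fun τ => ε * (T τ).re) (𝓝[>] (0 : ℝ)) atTop := by
    rw [hpos] at hS
    refine (hS.comp (A.start ν h.mem)).congr' ?_
    filter_upwards [h.start_eventually] with τ hτ
    simp only [Function.comp, (h.start τ hτ).2]
  obtain ⟨τ, h2, h3⟩ := ((h1.eventually (eventually_gt_atTop (ε * (T s).re))).and
    h.start_eventually).exists
  have hτ : τ ∈ Ioo (0 : ℝ) 1 := ⟨h3.1, h3.2.trans_lt h.s_mem.2⟩
  rcases h3.2.eq_or_lt with h4 | h4
  · rw [h4] at h2; exact lt_irrefl _ h2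
  · have h5 := A.strictMono ν h.mem τ hτ s h.s_mem h4
    rw [← h.re_action hτ h.s_mem] at h5
    linarith

/-- The Wronskian of the subdominant solutions at the ends of a side. -/
lemma norm_wr_sub_one_le (h : A.Linked ν M s t p S p' S' P T ε) {ħ : ℂ} (hħ : ħ ≠ 0)
    (hmono : ∀ x ∈ Ioo (0 : ℝ) 1, ∀ y ∈ Ioo (0 : ℝ) 1, x < y →
      0 ≤ (action (A.γ ν) (A.r ν) x y / ħ).re)
    {φ : ℝ → ℝ} (hφ : MeasureTheory.IntegrableOn φ (Icc 0 1))
    (hφb : ∀ t ∈ Ioo (0 : ℝ) 1,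
      ‖forcing α ν (A.γ ν t) (A.r ν t)‖ * ‖Complex.exp (A.γ ν t) * deriv (A.γ ν) t‖ ≤ φ t)
    {χ χ' : ℂ → ℂ} (hχ : IsSol (fun w => Qf α ν w / ħ ^ 2) χ)
    (hχ' : IsSol (fun w => Qf α ν w / ħ ^ 2) χ')
    (hd : Tendsto (fun w => dev (Qf α ν) (ε * ħ) (p w) (S w) χ w) (vertexFilter α a) (𝓝 0))
    (hd' : Tendsto (fun w => dev (Qf α ν) (-(ε * ħ)) (p' w) (S' w) χ' w) (vertexFilter α b) (𝓝 0)) :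
    ‖-(ε * ħ) / 2 * wr χ χ' 0 - 1‖ ≤ Real.exp (‖ħ‖ * ∫ τ in Icc (0 : ℝ) 1, φ τ) - 1 := by
  set H := ∫ τ in Icc (0 : ℝ) 1, φ τ with hH
  have hee : (ε : ℂ) * ε = 1 := by rw [← Complex.ofReal_mul, ← sq, h.sign, Complex.ofReal_one]
  have hε0 : (ε : ℂ) ≠ 0 := by intro h; simp [h] at hee
  have hεn : ‖(ε : ℂ) * ħ‖ = ‖ħ‖ := by
    rw [norm_mul, Complex.norm_real, Real.norm_eq_abs,
      show |ε| = 1 by rw [← sq_eq_sq₀ (abs_nonneg _) zero_le_one, sq_abs, h.sign, one_pow], one_mul]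
  have hh : (ε * ħ) ^ 2 = ħ ^ 2 := by rw [mul_pow, sq (ε : ℂ), hee, one_mul]
  have hh0 : (ε : ℂ) * ħ ≠ 0 := mul_ne_zero hε0 hħ
  have hφ0 : ∀ t ∈ Ioo (0 : ℝ) 1, 0 ≤ φ t := fun t ht => le_trans (by positivity) (hφb t ht)
  have step : ∀ x ∈ Ioo (0 : ℝ) 1, ∀ y ∈ Ioo (0 : ℝ) 1, x ≤ y →
      1 + dev (Qf α ν) (ε * ħ) (P y) (T y) χ (A.γ ν y) ≤
      (1 + dev (Qf α ν) (ε * ħ) (P x) (T x) χ (A.γ ν x)) * Real.exp (‖ħ‖ * H) := by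
    intro x hx y hy hxy
    have hsub : Icc x y ⊆ Ioo (0 : ℝ) 1 := fun τ hτ => ⟨hx.1.trans_le hτ.1, hτ.2.trans_lt hy.2⟩
    have hsub' : Icc x y ⊆ Icc (0 : ℝ) 1 := hsub.trans Ioo_subset_Icc_self
    have h1 := (h.path.mono hsub).transport (Qf_differentiable α ν) hxy hh0 (g := χ)
      (by rw [hh]; exact hχ) (fun u hu w hw huw => by
        rw [A.action_eq h.mem h.path h.root_sq (hsub hu) (hsub hw), mul_div_mul_left _ _ hε0]
        rcases huw.eq_or_lt with rfl | huw
        · simp [action]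
        · exact hmono u (hsub hu) w (hsub hw) huw)
    refine h1.trans ?_
    rw [hεn]
    have := dev_nonneg (Qf α ν) (ε * ħ) (P x) (T x) χ (A.γ ν x)
    gcongr
    have hint : IntervalIntegrable φ MeasureTheory.volume x y := by
      rw [intervalIntegrable_iff_integrableOn_Icc_of_le hxy]
      exact hφ.mono_set hsub'
    calc ∫ τ in x..y, ‖errF (Qf α ν) (P τ ^ 2) (A.γ ν τ) * deriv (A.γ ν) τ‖
        ≤ ∫ τ in x..y, φ τ := by
          refine intervalIntegral.integral_mono_on hxy ?_ hint fun τ hτ => ?_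
          · exact (((h.path.mono hsub).continuousOn_errF
              (Qf_differentiable α ν)).norm).intervalIntegrable_of_Icc hxy
          · rw [A.norm_errF_mul h.mem h.sign h.root_sq (hsub hτ)]
            exact hφb τ (hsub hτ)
      _ = ∫ τ in Ioc x y, φ τ := intervalIntegral.integral_of_le hxy
      _ ≤ ∫ τ in Ioo (0 : ℝ) 1, φ τ := by
          refine MeasureTheory.setIntegral_mono_set (hφ.mono_set Ioo_subset_Icc_self) ?_
            (Eventually.of_forall (Ioc_subset_Icc_self.trans hsub))
          exact (MeasureTheory.ae_restrict_iff' measurableSet_Ioo).2 (Eventually.of_forall hφ0)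
      _ = H := by rw [hH, MeasureTheory.integral_Icc_eq_integral_Ioo]
  -- Let the starting point tend to the vertex a, where the deviation of χ vanishes: only the
  -- amplification factor remains.
  have hstart : ∀ y ∈ Ioo (0 : ℝ) 1,
      1 + dev (Qf α ν) (ε * ħ) (P y) (T y) χ (A.γ ν y) ≤ Real.exp (‖ħ‖ * H) := by
    intro y hy
    have h1 : Tendsto (fun x => (1 + dev (Qf α ν) (ε * ħ) (P x) (T x) χ (A.γ ν x)) *
        Real.exp (‖ħ‖ * H)) (𝓝[>] (0 : ℝ)) (𝓝 (Real.exp (‖ħ‖ * H))) := by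
      have := ((hd.comp (A.start ν h.mem)).const_add 1).mul_const (Real.exp (‖ħ‖ * H))
      rw [add_zero, one_mul] at this
      refine this.congr' ?_
      filter_upwards [h.start_eventually] with τ hτ
      simp only [Function.comp, (h.start τ hτ).1, (h.start τ hτ).2]
    refine ge_of_tendsto h1 ?_
    filter_upwards [Ioc_mem_nhdsGT hy.1] with x hx
    exact step x ⟨hx.1, hx.2.trans_lt hy.2⟩ y hy hx.2
  have hfin : Tendsto (fun y => dev (Qf α ν) (-(ε * ħ)) (P y) (T y) χ' (A.γ ν y))
      (𝓝[<] (1 : ℝ)) (𝓝 0) := by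
    refine (hd'.comp (A.finish ν h.mem)).congr' ?_
    filter_upwards [h.finish_eventually] with τ hτ
    simp only [Function.comp, (h.finish τ hτ).1, (h.finish τ hτ).2]
  -- The bound for the Wronskian evaluated at γ y. Since the Wronskian is constant, y may tend to 1,
  -- where the deviation of χ' vanishes.
  have hlim : Tendsto (fun y => (Real.exp (‖ħ‖ * H) - 1) *
      (1 + dev (Qf α ν) (-(ε * ħ)) (P y) (T y) χ' (A.γ ν y)) +
      dev (Qf α ν) (-(ε * ħ)) (P y) (T y) χ' (A.γ ν y)) (𝓝[<] (1 : ℝ))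
      (𝓝 (Real.exp (‖ħ‖ * H) - 1)) := by
    simpa using ((hfin.const_add 1).const_mul (Real.exp (‖ħ‖ * H) - 1)).add hfin
  refine ge_of_tendsto hlim ?_
  filter_upwards [h.finish_eventually] with y hy
  have hy' : y ∈ Ioo (0 : ℝ) 1 := ⟨h.t_mem.1.trans_le hy.1, hy.2⟩
  have e1 := hstart y hy'
  have e2 := wr_eq_lg (Qf α ν) (ħ := ε * ħ) (h.path.root_ne_zero hy') χ χ' (A.γ ν y)
  rw [wr_const hχ hχ' _ 0] at e2
  rw [e2]
  simp only [dev, neg_neg] at e1 ⊢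
  rw [div_neg, neg_neg]
  set X := Complex.exp (T y / (ε * ħ)) with hX
  rw [Complex.exp_neg, ← hX] at e1
  have hX0 : X ≠ 0 := Complex.exp_ne_zero _
  generalize lg (Qf α ν) (ε * ħ) (P y) χ (A.γ ν y) = u1 at *
  generalize lg (Qf α ν) (-(ε * ħ)) (P y) χ (A.γ ν y) = u2 at *
  generalize lg (Qf α ν) (ε * ħ) (P y) χ' (A.γ ν y) = v1 at *
  generalize lg (Qf α ν) (-(ε * ħ)) (P y) χ' (A.γ ν y) = v2 at *
  have e3 : u1 * v2 - u2 * v1 - 1 = (u1 * X⁻¹ - 1) * (v2 * X) + (v2 * X - 1) -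
      (u2 * X⁻¹) * (v1 * X) := by
    field_simp
    ring
  rw [e3]
  have e4 : ‖v2 * X‖ ≤ ‖v2 * X - 1‖ + 1 := by simpa using norm_le_norm_sub_add (v2 * X) 1
  calc _ ≤ ‖(u1 * X⁻¹ - 1) * (v2 * X)‖ + ‖v2 * X - 1‖ + ‖(u2 * X⁻¹) * (v1 * X)‖ :=
        (norm_sub_le _ _).trans (by gcongr; exact norm_add_le _ _)
    _ ≤ ‖u1 * X⁻¹ - 1‖ * (‖v2 * X - 1‖ + 1) + ‖v2 * X - 1‖ + ‖u2 * X⁻¹‖ * ‖v1 * X‖ := by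
        rw [norm_mul, norm_mul (u2 * X⁻¹)]
        gcongr
    _ ≤ _ := by
        have p1 := norm_nonneg (u1 * X⁻¹ - 1)
        have p2 := norm_nonneg (u2 * X⁻¹)
        have p3 := norm_nonneg (v1 * X)
        have p4 := norm_nonneg (v2 * X - 1)
        nlinarith

end StrictlyAdmissible.Linked

end

section

/-! ### Rescaling, and asymptotic values -/

/-- The logarithm of the scaling factor. -/
def shift (α : ℝ) (ħ : ℂ) : ℂ := Complex.log ħ / (α + 1)

/-- A solution of the anharmonic oscillator in rescaled logarithmic Liouville form. -/
def rescale (α : ℝ) (ħ : ℂ) (ψ : ℂ → ℂ) (w : ℂ) : ℂ :=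
  Complex.exp (-(1 / 2) * w) * ψ (w - shift α ħ)

/-- The factor e^{-w/2} removes the first-order term caused by d/dx = e^{-w} d/dw and adds 1/4 to
ℓ(ℓ+1), giving (ℓ + 1/2)² = ħ⁻². The translation gives the terms in x^{2α} and E the same factor
ħ⁻². -/
lemma IsSolution.isSol_rescale {α : ℝ} (hα : 0 < α) {ν ħ : ℂ} (hħ : ħ ≠ 0) {ψ : ℂ → ℂ}
    (h : IsSolution α (ν * ħ ^ (-(2 * α / (α + 1)) : ℂ)) (1 / ħ - 1 / 2) ψ) :
    IsSol (fun w => Qf α ν w / ħ ^ 2) (rescale α ħ ψ) := by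
  obtain ⟨hd, he⟩ := h
  have hα1 : (α + 1 : ℂ) ≠ 0 := by
    have : (α + 1 : ℂ) = ((α + 1 : ℝ) : ℂ) := by push_cast; rfl
    rw [this, Complex.ofReal_ne_zero]
    linarith
  set z := shift α ħ with hz
  have hψ : ∀ w, HasDerivAt ψ (deriv ψ w) w := fun w => (hd w).hasDerivAt
  have hψ' : ∀ w, HasDerivAt (deriv ψ) (deriv (deriv ψ) w) w := fun w =>
    (differentiable_deriv hd w).hasDerivAt
  have hode : ∀ w, deriv (deriv ψ) w = deriv ψ w + Complex.exp w ^ 2 *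
      potential α (ν * ħ ^ (-(2 * α / (α + 1)) : ℂ)) (1 / ħ - 1 / 2) w * ψ w := fun w => by
    have h1 : ddx (ddx ψ) w = Complex.exp (-w) * (Complex.exp (-w) * -1 * deriv ψ w +
        Complex.exp (-w) * deriv (deriv ψ) w) := by
      rw [ddx]
      congr 1
      exact ((hasDerivAt_neg w).cexp.fun_mul (hψ' w)).deriv
    have h2 := he w
    rw [h1, Complex.exp_neg] at h2
    have := Complex.exp_ne_zero w
    generalize potential α (ν * ħ ^ (-(2 * α / (α + 1)) : ℂ)) (1 / ħ - 1 / 2) w = U at h2 ⊢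
    field_simp at h2
    linear_combination h2
  have hc : ∀ w, HasDerivAt (fun w => ψ (w - z)) (deriv ψ (w - z)) w := fun w =>
    (hψ (w - z)).comp_sub_const w z
  have hc' : ∀ w, HasDerivAt (fun w => deriv ψ (w - z)) (deriv (deriv ψ) (w - z)) w := fun w =>
    (hψ' (w - z)).comp_sub_const w z
  have hg : ∀ w, HasDerivAt (rescale α ħ ψ)
      (Complex.exp (-(1 / 2) * w) * (-(1 / 2) * ψ (w - z) + deriv ψ (w - z))) w := fun w =>
    ((hasDerivAt_cexp_const_mul _ w).mul (hc w)).congr_deriv (by ring)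
  have hg' : ∀ w, HasDerivAt (deriv (rescale α ħ ψ))
      (Complex.exp (-(1 / 2) * w) * (1 / 4 * ψ (w - z) - deriv ψ (w - z) +
        deriv (deriv ψ) (w - z))) w := fun w => by
    rw [funext fun w => (hg w).deriv]
    exact ((hasDerivAt_cexp_const_mul _ w).mul
      (((hc w).const_mul (-(1 / 2))).fun_add (hc' w))).congr_deriv (by ring)
  refine ⟨fun w => (hg w).differentiableAt, fun w => ?_⟩
  have hlog : ∀ a : ℂ, Complex.exp (a * ((α + 1) * z)) = Complex.exp (a * Complex.log ħ) := fun a => by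
    congr 2
    rw [hz, shift]
    field_simp
  have e1 : Complex.exp (w - z) ^ 2 * Complex.exp (2 * α * (w - z)) =
      Complex.exp (2 * (α + 1) * w) / ħ ^ 2 := by
    have : (ħ ^ 2)⁻¹ = Complex.exp (-2 * ((α + 1) * z)) := by
      rw [hlog, neg_mul, Complex.exp_neg, two_mul, Complex.exp_add, Complex.exp_log hħ, sq]
    rw [div_eq_mul_inv, this, ← Complex.exp_nat_mul, ← Complex.exp_add, ← Complex.exp_add]
    congr 1
    push_cast
    ring
  have e2 : Complex.exp (w - z) ^ 2 * ħ ^ (-(2 * α / (α + 1)) : ℂ) =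
      Complex.exp (2 * w) / ħ ^ 2 := by
    have : (ħ ^ 2)⁻¹ = Complex.exp (-2 * Complex.log ħ) := by
      rw [neg_mul, Complex.exp_neg, two_mul, Complex.exp_add, Complex.exp_log hħ, sq]
    rw [div_eq_mul_inv (Complex.exp (2 * w)), this, Complex.cpow_def_of_ne_zero hħ, ← Complex.exp_nat_mul,
      ← Complex.exp_add, ← Complex.exp_add]
    congr 1
    rw [hz, shift]
    push_cast
    field_simp
    ring
  have hE := Complex.exp_ne_zero (w - z)
  rw [(hg' w).deriv, hode]
  simp only [rescale, Qf, potential]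
  have e3 : Complex.exp (w - z) ^ 2 * (Complex.exp (2 * α * (w - z)) +
      (1 / ħ - 1 / 2) * ((1 / ħ - 1 / 2) + 1) / Complex.exp (w - z) ^ 2 -
      ν * ħ ^ (-(2 * α / (α + 1)) : ℂ)) = Complex.exp (2 * (α + 1) * w) / ħ ^ 2 +
        (1 / ħ - 1 / 2) * ((1 / ħ - 1 / 2) + 1) - ν * (Complex.exp (2 * w) / ħ ^ 2) := by
    rw [← e1, ← e2]
    field_simp
  rw [e3]
  field_simp
  ring

lemma linearIndependent_rescale {α : ℝ} {ħ : ℂ} {ψ φ : ℂ → ℂ}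
    (h : LinearIndependent ℂ ![ψ, φ]) :
    LinearIndependent ℂ ![rescale α ħ ψ, rescale α ħ φ] := by
  rw [LinearIndependent.pair_iff] at h ⊢
  intro a b hab
  refine h a b (funext fun w => ?_)
  have h1 := congrFun hab (w + shift α ħ)
  simp only [Pi.add_apply, Pi.smul_apply, smul_eq_mul, rescale, add_sub_cancel_right,
    Pi.zero_apply] at h1 ⊢
  have := Complex.exp_ne_zero (-(1 / 2) * (w + shift α ħ))
  have h2 : Complex.exp (-(1 / 2) * (w + shift α ħ)) * (a * ψ w + b * φ w) = 0 := by
    linear_combination h1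
  exact (mul_eq_zero.1 h2).resolve_left this

lemma quot_mul {a : ℂ} (ha : a ≠ 0) (x y : ℂ) : quot (a * x) (a * y) = quot x y := by
  by_cases hy : y = 0
  · simp [quot, hy]
  · simp [quot, hy, ha, mul_div_mul_left]

lemma quot_rescale (α : ℝ) (ħ : ℂ) (ψ φ : ℂ → ℂ) (w : ℂ) :
    quot (rescale α ħ ψ (w + shift α ħ)) (rescale α ħ φ (w + shift α ħ)) = quot (ψ w) (φ w) := by
  simp only [rescale, add_sub_cancel_right]
  exact quot_mul (Complex.exp_ne_zero _) _ _

/-- A nonzero solution which is dominated at the vertex `a` by all those independent of it. -/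
structure IsSubdominant (α : ℝ) (ν ħ : ℂ) (a : Vertex) (χ : ℂ → ℂ) : Prop where
  isSol : IsSol (fun w => Qf α ν w / ħ ^ 2) χ
  tendsto : ∀ g, IsSol (fun w => Qf α ν w / ħ ^ 2) g → wr g χ 0 ≠ 0 →
    Tendsto (fun w => χ (w + shift α ħ) / g (w + shift α ħ)) (vertexFilter α a) (𝓝 0)

lemma wr_lin {P g h : ℂ → ℂ} (hg : IsSol P g) (hh : IsSol P h) (a b c d w : ℂ) :
    wr (fun w => a * g w + b * h w) (fun w => c * g w + d * h w) w =
      (a * d - b * c) * wr g h w := by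
  simp only [wr, deriv_lin hg hh]; ring

/-- The sum g + χ is also independent of χ, so χ/(g + χ) tends to 0; at a zero of g this quotient
would be 1. -/
lemma IsSubdominant.eventually_ne_zero {α : ℝ} {ν ħ : ℂ} {a : Vertex} {χ : ℂ → ℂ}
    (h : IsSubdominant α ν ħ a χ) {g : ℂ → ℂ} (hg : IsSol (fun w => Qf α ν w / ħ ^ 2) g)
    (hw : wr g χ 0 ≠ 0) : ∀ᶠ w in vertexFilter α a, g (w + shift α ħ) ≠ 0 := by
  have h1 := hg.lin h.isSol 1 1
  have h2 : wr (fun w => 1 * g w + 1 * χ w) χ 0 ≠ 0 := by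
    have : χ = fun w => 0 * g w + 1 * χ w := by funext w; ring
    have e := wr_lin hg h.isSol 1 1 0 1 0
    rw [← this] at e
    rw [e]
    simpa using hw
  have h3 := (h.tendsto _ h1 h2).norm
  rw [norm_zero] at h3
  filter_upwards [h3.eventually (eventually_lt_nhds one_pos)] with w hw1 h0
  simp only [h0, mul_zero, zero_add, one_mul] at hw1
  have hχ : χ (w + shift α ħ) ≠ 0 := by
    intro h4
    apply hw
    rw [← wr_const hg h.isSol (w + shift α ħ)]
    simp [wr, h0, h4]
  rw [div_self hχ, norm_one] at hw1
  exact lt_irrefl _ hw1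

/-- The asymptotic value is determined by the coefficients of the subdominant solution. -/
lemma IsSubdominant.tendsto_quot {α : ℝ} {ν ħ : ℂ} {v : Vertex} {g h : ℂ → ℂ}
    (hg : IsSol (fun w => Qf α ν w / ħ ^ 2) g) (hh : IsSol (fun w => Qf α ν w / ħ ^ 2) h)
    (hw : wr g h 0 ≠ 0) {a b : ℂ} (hab : a ≠ 0 ∨ b ≠ 0)
    (hχ : IsSubdominant α ν ħ v (fun w => a * g w + b * h w)) :
    Tendsto (fun w => quot (g (w + shift α ħ)) (h (w + shift α ħ))) (vertexFilter α v)
      (𝓝 (quot (-b) a)) := by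
  -- If a = 0, the subdominant solution is proportional to h, so h/g → 0 and g/h leaves every
  -- compact set. Otherwise (a g + b h)/h → 0, which solves for the limit of g/h.
  by_cases ha : a = 0
  · have hb : b ≠ 0 := hab.resolve_left (not_not.2 ha)
    have hw' : wr g (fun w => a * g w + b * h w) 0 ≠ 0 := by
      have : g = fun w => 1 * g w + 0 * h w := by funext w; ring
      have e := wr_lin hg hh 1 0 a b 0
      rw [← this] at e
      rw [e]
      simpa using ⟨hb, hw⟩
    have h1 := hχ.tendsto g hg hw'
    have h2 := hχ.eventually_ne_zero hg hw'
    subst ha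
    simp only [quot, if_true]
    rw [Tendsto, OnePoint.le_nhds_infty]
    intro K _ hK
    obtain ⟨B, hB⟩ := hK.isBounded.exists_norm_le
    have h3 := (h1.const_mul (b⁻¹ * (|B| + 1))).norm
    rw [mul_zero, norm_zero] at h3
    rw [Filter.mem_map]
    filter_upwards [h3.eventually (eventually_lt_nhds one_pos), h2] with w hw1 hw2
    rw [mem_preimage]
    split_ifs with h0
    · exact Or.inr rfl
    · refine Or.inl ⟨_, fun hz => ?_, rfl⟩
      have h4 := hB _ hz
      rw [norm_div, div_le_iff₀ (norm_pos_iff.2 h0)] at h4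
      have h5 : b⁻¹ * (|B| + 1) * ((0 * g (w + shift α ħ) + b * h (w + shift α ħ)) / g (w + shift α ħ)) =
          (|B| + 1) * h (w + shift α ħ) / g (w + shift α ħ) := by
        field_simp
        ring
      rw [h5, norm_div, norm_mul, div_lt_one (norm_pos_iff.2 hw2)] at hw1
      have h6 : ‖((|B| : ℝ) : ℂ) + 1‖ = |B| + 1 := by
        rw [← Complex.ofReal_one, ← Complex.ofReal_add, Complex.norm_real,
          Real.norm_of_nonneg (by positivity)]
      rw [h6] at hw1
      have h7 := norm_nonneg (h (w + shift α ħ))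
      nlinarith [le_abs_self B]
  · have hw' : wr h (fun w => a * g w + b * h w) 0 ≠ 0 := by
      have : h = fun w => 0 * g w + 1 * h w := by funext w; ring
      have e := wr_lin hg hh 0 1 a b 0
      rw [← this] at e
      rw [e]
      simpa using ⟨ha, hw⟩
    have h1 := hχ.tendsto h hh hw'
    have h2 := hχ.eventually_ne_zero hh hw'
    have h3 : Tendsto (fun w => g (w + shift α ħ) / h (w + shift α ħ)) (vertexFilter α v)
        (𝓝 (-b / a)) := by
      have h4 : Tendsto (fun w => ((a * g (w + shift α ħ) + b * h (w + shift α ħ)) /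
          h (w + shift α ħ) - b) / a) (vertexFilter α v) (𝓝 (-b / a)) := by
        simpa using (h1.sub_const b).div_const a
      refine h4.congr' ?_
      filter_upwards [h2] with w hw
      field_simp
      ring
    have h5 : Tendsto (fun w => ((g (w + shift α ħ) / h (w + shift α ħ) : ℂ) : OnePoint ℂ))
        (vertexFilter α v) (𝓝 ((-b / a : ℂ) : OnePoint ℂ)) :=
      (OnePoint.continuous_coe.tendsto _).comp h3
    have e : quot (-b) a = ((-b / a : ℂ) : OnePoint ℂ) := by simp [quot, ha]
    rw [e]
    refine h5.congr' ?_
    filter_upwards [h2] with w hw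
    simp [quot, hw]

lemma exists_homCoord_quot {x y : ℂ} (h : x ≠ 0 ∨ y ≠ 0) :
    ∃ k : ℂ, k ≠ 0 ∧ x = k * (homCoord (quot x y)).1 ∧ y = k * (homCoord (quot x y)).2 := by
  by_cases hy : y = 0
  · refine ⟨x, h.resolve_right (not_not.2 hy), ?_⟩
    have : homCoord (quot x y) = (1, 0) := by simp only [quot, hy, if_true]; rfl
    rw [this, hy]
    simp
  · refine ⟨y, hy, ?_⟩
    have : homCoord (quot x y) = (x / y, 1) := by simp only [quot, hy, if_false]; rfl
    simp [this]
    field_simp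

/-- The asymptotic values and their cross-ratio, in terms of the Wronskians of the subdominant
solutions. -/
lemma exists_crossRatio {α : ℝ} {ν ħ : ℂ} {v : Fin 4 → Vertex} {χ : Fin 4 → ℂ → ℂ}
    (hχ : ∀ i, IsSubdominant α ν ħ (v i) (χ i)) (h03 : wr (χ 0) (χ 3) 0 ≠ 0)
    (h12 : wr (χ 1) (χ 2) 0 ≠ 0) {g h : ℂ → ℂ} (hg : IsSol (fun w => Qf α ν w / ħ ^ 2) g)
    (hh : IsSol (fun w => Qf α ν w / ħ ^ 2) h) (hw : wr g h 0 ≠ 0) :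
    ∃ W : Fin 4 → OnePoint ℂ, (∀ i, Tendsto
      (fun w => quot (g (w + shift α ħ)) (h (w + shift α ħ))) (vertexFilter α (v i)) (𝓝 (W i))) ∧
      crossRatio (W 0) (W 1) (W 2) (W 3) =
        ((wr (χ 0) (χ 1) 0 * wr (χ 2) (χ 3) 0 / (wr (χ 0) (χ 3) 0 * wr (χ 1) (χ 2) 0) : ℂ) :
          OnePoint ℂ) := by
  choose a b hab using fun i => eq_lin hg hh (hχ i).isSol hw
  have hwr : ∀ i j, wr (χ i) (χ j) 0 = (a i * b j - b i * a j) * wr g h 0 := fun i j => by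
    rw [hab i, hab j, wr_lin hg hh]
  -- The two nonzero Wronskians involve all four indices, so no χ i has zero coefficients.
  have h0 : ∀ i, a i ≠ 0 ∨ b i ≠ 0 := by
    rw [hwr] at h03 h12
    intro i
    by_contra! hi
    fin_cases i <;> simp_all
  have h0' : ∀ i, -b i ≠ 0 ∨ a i ≠ 0 := fun i => by
    rw [neg_ne_zero]
    exact (h0 i).symm
  choose k hk hk1 hk2 using fun i => exists_homCoord_quot (h0' i)
  -- The proportionality factors k cancel in the cross-ratio, where every index occurs once above
  -- and once below.
  have hbr : ∀ i j, wr (χ i) (χ j) 0 =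
      k i * k j * bracket (quot (-b i) (a i)) (quot (-b j) (a j)) * wr g h 0 := fun i j => by
    rw [hwr, bracket]
    have e : a i * b j - b i * a j = (-b i) * a j - (-b j) * a i := by ring
    rw [e]
    linear_combination (exp := 1) wr g h 0 * ((homCoord (quot (-b j) (a j))).2 * k j * hk1 i +
      (-b i) * hk2 j - (homCoord (quot (-b j) (a j))).1 * k j * hk2 i - a i * hk1 j)
  refine ⟨fun i => quot (-b i) (a i), fun i => ?_, ?_⟩
  · refine IsSubdominant.tendsto_quot hg hh hw (h0 i) ?_
    rw [← hab i]
    exact hχ i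
  · have := hbr 0 3
    rw [hbr] at h03 h12
    simp only [ne_eq, mul_eq_zero, not_or] at h03 h12
    rw [crossRatio, quot, if_neg (mul_ne_zero h03.1.2 h12.1.2), hbr 0 1, hbr 2 3, hbr 0 3, hbr 1 2]
    congr 1
    have k0 := hk 0
    have k1 := hk 1
    have k2 := hk 2
    have k3 := hk 3
    have b1 := h03.1.2
    have b2 := h12.1.2
    field_simp

end

section

/-! ### Continuation of the fourth root around the quadrilateral -/

/-- Fourth roots of `Qf` and action functions near the vertices, continued along the four sides;
after one turn the root is multiplied by `μ`, and the action increases by `d`. -/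
structure Chain {α : ℝ} {N : Set ℂ} {v : Fin 4 → Vertex} (Q : Realization α N v) (ν : ℂ) (M : ℝ)
    (s t : Fin 4 → ℝ) (p S : Fin 5 → ℂ → ℂ) (P T : Fin 4 → ℝ → ℂ) (μ d : ℂ) : Prop where
  link : ∀ i : Fin 4, (Q i).Linked ν M (s i) (t i) (p i.castSucc) (S i.castSucc) (p i.succ)
    (S i.succ) (P i) (T i) ((-1) ^ ((i : ℕ) + 1))
  jump : ∀ w ∈ vertexNhd α M (v 0), p 4 w = μ * p 0 w ∧ S 4 w = S 0 w + d
  sq : μ ^ 2 = 1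

/-- At each vertex a single sign tells whether Re S grows, and it equals ε of the incoming side and
-ε of the outgoing one. Hence the signs alternate around the quadrilateral. -/
lemma exists_chain {α : ℝ} (hα : 0 < α) {N : Set ℂ} {v : Fin 4 → Vertex} (Q : Realization α N v)
    {ν : ℂ} (hν : ν ∈ N) {M : ℝ} {s t : Fin 4 → ℝ} (hst : ∀ i, 0 < s i ∧ s i < t i ∧ t i < 1)
    (h0 : ∀ i, ∀ w ∈ vertexNhd α M (v i), redV α ν w ≠ 0)
    (hs : ∀ i, ∀ τ, 0 < τ → τ ≤ s i → (Q i).γ ν τ ∈ vertexNhd α M (v i))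
    (ht : ∀ i, ∀ τ, t i ≤ τ → τ < 1 → (Q i).γ ν τ ∈ vertexNhd α M (v (i + 1))) :
    ∃ p S P T μ d, Chain Q ν M s t p S P T μ d := by
  have hs0 : s 0 ∈ Ioo (0 : ℝ) 1 := ⟨(hst 0).1, (hst 0).2.1.trans (hst 0).2.2⟩
  have hw₀ := hs 0 (s 0) hs0.1 le_rfl
  -- The sign of p₀² starts the chain with ε = -1, in agreement with the loop branch, along which Re
  -- ∫√V dx decreases on the first side.
  obtain ⟨p₀, hp₀⟩ := IsAlgClosed.exists_pow_nat_eq (-(Q 0).q ν (s 0)) (n := 2) two_pos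
  obtain ⟨p0, S0, hpS, hp, -⟩ := exists_rootOn (Qf_differentiable α ν) (convex_vertexNhd α M (v 0))
    (isOpen_vertexNhd α M (v 0)) (fun w hw => by
      rw [Qf_eq_redV]
      exact mul_ne_zero (pow_ne_zero 2 (Complex.exp_ne_zero _)) (h0 0 w hw)) hw₀
    (p₀ := p₀) (by
      rw [show p₀ ^ 4 = (p₀ ^ 2) ^ 2 by ring, hp₀, neg_sq, (Q 0).q_sq hν _ hs0]) 0
  obtain ⟨p1, S1, P0, T0, ε0, l0⟩ := (Q 0).exists_linked hν (hst 0) (hs 0) (ht 0) (h0 1) hpS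
  obtain ⟨p2, S2, P1, T1, ε1, l1⟩ :=
    (Q 1).exists_linked hν (hst 1) (hs 1) (ht 1) (h0 2) l0.rootOn'
  obtain ⟨p3, S3, P2, T2, ε2, l2⟩ :=
    (Q 2).exists_linked hν (hst 2) (hs 2) (ht 2) (h0 3) l1.rootOn'
  obtain ⟨p4, S4, P3, T3, ε3, l3⟩ :=
    (Q 3).exists_linked hν (hst 3) (hs 3) (ht 3) (h0 0) l2.rootOn'
  have e0 : ε0 = -1 := by
    have h1 := l0.root_sq (s 0) hs0
    rw [(l0.start (s 0) ⟨hs0.1, le_rfl⟩).1, hp, hp₀] at h1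
    have hq : (Q 0).q ν (s 0) ≠ 0 := fun hq => by
      have := (Q 0).q_sq hν _ hs0
      rw [hq] at this
      exact (Q 0).Qf_ne_zero hν _ hs0 (by rw [← this]; simp)
    have h2 : ((ε0 : ℂ) + 1) * (Q 0).q ν (s 0) = 0 := by linear_combination -h1
    have h3 : (ε0 : ℂ) = ((-1 : ℝ) : ℂ) := by
      push_cast
      exact eq_neg_of_add_eq_zero_left ((mul_eq_zero.1 h2).resolve_right hq)
    exact_mod_cast h3
  obtain ⟨σ0, hσ0, hS0, -⟩ := exists_normalized_subdominant hα ν (v 0) l0.rootOn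
  obtain ⟨σ1, hσ1, hS1, -⟩ := exists_normalized_subdominant hα ν (v 1) l1.rootOn
  obtain ⟨σ2, hσ2, hS2, -⟩ := exists_normalized_subdominant hα ν (v 2) l2.rootOn
  obtain ⟨σ3, hσ3, hS3, -⟩ := exists_normalized_subdominant hα ν (v 3) l3.rootOn
  obtain ⟨σ4, hσ4, hS4, -⟩ := exists_normalized_subdominant hα ν (v 0) l3.rootOn'
  have a0 := l0.sign_start hσ0 hS0
  have e1 : ε1 = 1 := by linarith [l1.sign_start hσ1 hS1, l0.sign_finish hσ1 hS1]
  have e2 : ε2 = -1 := by linarith [l2.sign_start hσ2 hS2, l1.sign_finish hσ2 hS2]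
  have e3 : ε3 = 1 := by linarith [l3.sign_start hσ3 hS3, l2.sign_finish hσ3 hS3]
  have a4 := l3.sign_finish hσ4 hS4
  subst e0 e1 e2 e3 a0 a4
  obtain ⟨c, d, hc, hcd⟩ := RootOn.unique (convex_vertexNhd α M (v 0))
    (isOpen_vertexNhd α M (v 0)) l0.rootOn l3.rootOn' hw₀
  -- The real parts of S0 and S4 both tend to +∞ at v 0. With c² = -1 their sum would be constant.
  have hc2 : c ^ 2 = 1 := by
    have : (c ^ 2 - 1) * (c ^ 2 + 1) = 0 := by linear_combination hc
    rcases mul_eq_zero.1 this with h | h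
    · linear_combination h
    · exfalso
      have := hS0.atTop_add_atTop hS4
      have := vertexFilter_neBot α (v 0)
      refine not_tendsto_const_atTop d.re (vertexFilter α (v 0))
        ((hS0.atTop_add_atTop hS4).congr' ?_)
      filter_upwards [eventually_mem_vertexNhd hα M (v 0)] with w hw
      rw [(hcd w hw).2, eq_neg_of_add_eq_zero_left h]
      simp
  refine ⟨![p0, p1, p2, p3, p4], ![S0, S1, S2, S3, S4], ![P0, P1, P2, P3], ![T0, T1, T2, T3], c, d,
    ?_, fun w hw => ?_, hc2⟩
  · intro i
    fin_cases i
    · change (Q 0).Linked _ _ _ _ _ _ _ _ _ _ ((-1) ^ (0 + 1))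
      norm_num
      exact l0
    · change (Q 1).Linked _ _ _ _ _ _ _ _ _ _ ((-1) ^ (1 + 1))
      norm_num
      exact l1
    · change (Q 2).Linked _ _ _ _ _ _ _ _ _ _ ((-1) ^ (2 + 1))
      norm_num
      exact l2
    · change (Q 3).Linked _ _ _ _ _ _ _ _ _ _ ((-1) ^ (3 + 1))
      norm_num
      exact l3
  · have := hcd w hw
    rw [hc2, one_mul] at this
    exact this

lemma exists_vertexNhd_ne_zero {α : ℝ} (hα : 0 < α) (ν : ℂ) (v : Vertex) :
    ∃ M₀, ∀ M ≥ M₀, ∀ w ∈ vertexNhd α M v, redV α ν w ≠ 0 := by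
  have key : ∃ M₀, ∀ M ≥ M₀, ∀ w ∈ vertexNhd α M v, Qf α ν w ≠ 0 := by
    cases v with
    | zero =>
      obtain ⟨M, p, S, hpS, -⟩ := exists_endData_zero hα ν
      refine ⟨M, fun M' hM w hw => hpS.ne_zero w ?_⟩
      simp only [vertexNhd, halfPlane, mem_ofPred_eq] at hw ⊢
      linarith
    | infty k =>
      obtain ⟨M, p, S, hpS, -⟩ := exists_endData_infty hα ν k
      refine ⟨M, fun M' hM w hw => hpS.ne_zero w ?_⟩
      simp only [vertexNhd, halfPlane, mem_ofPred_eq] at hw ⊢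
      linarith [hw.1]
  obtain ⟨M₀, h⟩ := key
  refine ⟨M₀, fun M hM w hw h0 => h M hM w hw ?_⟩
  rw [Qf_eq_redV, h0, mul_zero]

lemma exists_cut {α : ℝ} (hα : 0 < α) {N : Set ℂ} {v : Fin 4 → Vertex} (Q : Realization α N v)
    {ν : ℂ} (hν : ν ∈ N) : ∃ (M : ℝ) (s t : Fin 4 → ℝ),
      (∀ i, 0 < s i ∧ s i < t i ∧ t i < 1) ∧
      (∀ i, ∀ w ∈ vertexNhd α M (v i), redV α ν w ≠ 0) ∧
      (∀ i, ∀ τ, 0 < τ → τ ≤ s i → (Q i).γ ν τ ∈ vertexNhd α M (v i)) ∧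
      (∀ i, ∀ τ, t i ≤ τ → τ < 1 → (Q i).γ ν τ ∈ vertexNhd α M (v (i + 1))) := by
  choose M₀ hM₀ using fun i => exists_vertexNhd_ne_zero hα ν (v i)
  set M := ∑ i, |M₀ i| with hM
  have hle : ∀ i, M₀ i ≤ M := fun i => (le_abs_self _).trans
    (Finset.single_le_sum (f := fun i => |M₀ i|) (fun i _ => abs_nonneg _) (Finset.mem_univ i))
  have h1 : ∀ i, ∃ s, 0 < s ∧ s < 1 / 2 ∧
      ∀ τ, 0 < τ → τ ≤ s → (Q i).γ ν τ ∈ vertexNhd α M (v i) := fun i => by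
    obtain ⟨u, hu, hu'⟩ := mem_nhdsGT_iff_exists_Ioo_subset.1
      (((Q i).start ν hν).eventually (eventually_mem_vertexNhd hα M (v i)))
    have hu0 : 0 < u := hu
    refine ⟨min (u / 2) (1 / 4), by positivity, (min_le_right _ _).trans_lt (by norm_num),
      fun τ h0 hτ => hu' ⟨h0, ?_⟩⟩
    linarith [min_le_left (u / 2) (1 / 4)]
  have h2 : ∀ i, ∃ t, 1 / 2 < t ∧ t < 1 ∧
      ∀ τ, t ≤ τ → τ < 1 → (Q i).γ ν τ ∈ vertexNhd α M (v (i + 1)) := fun i => by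
    obtain ⟨u, hu, hu'⟩ := mem_nhdsLT_iff_exists_Ioo_subset.1
      (((Q i).finish ν hν).eventually (eventually_mem_vertexNhd hα M (v (i + 1))))
    have hu0 : u < 1 := hu
    refine ⟨max ((u + 1) / 2) (3 / 4), (by norm_num : (1 / 2 : ℝ) < 3 / 4).trans_le
      (le_max_right _ _), max_lt (by linarith) (by norm_num), fun τ hτ h1 => hu' ⟨?_, h1⟩⟩
    linarith [le_max_left ((u + 1) / 2) (3 / 4)]
  choose s hs0 hs1 hs using h1
  choose t ht0 ht1 ht using h2
  exact ⟨M, s, t, fun i => ⟨hs0 i, (hs1 i).trans (ht0 i), ht1 i⟩, fun i => hM₀ i M (hle i), hs, ht⟩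

/-! ### The estimate obtained from one realization -/

/-- The integrals of the error control function along the sides are bounded by `H`. -/
def ErrorBound {α : ℝ} {N : Set ℂ} {v : Fin 4 → Vertex} (Q : Realization α N v) (H : ℝ) : Prop :=
  ∀ i, ∃ φ : ℝ → ℝ, MeasureTheory.IntegrableOn φ (Icc 0 1) ∧
    (∀ ν ∈ N, ∀ t ∈ Ioo (0 : ℝ) 1, ‖forcing α ν ((Q i).γ ν t) ((Q i).r ν t)‖ *
      ‖Complex.exp ((Q i).γ ν t) * deriv ((Q i).γ ν) t‖ ≤ φ t) ∧
    ∫ τ in Icc (0 : ℝ) 1, φ τ ≤ H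

lemma exists_errorBound {α : ℝ} {N : Set ℂ} {v : Fin 4 → Vertex} (Q : Realization α N v) :
    ∃ H, 0 ≤ H ∧ ErrorBound Q H := by
  choose φ hφ hb using fun i => (Q i).integrable
  refine ⟨∑ i, |∫ τ in Icc (0 : ℝ) 1, φ i τ|, Finset.sum_nonneg fun i _ => abs_nonneg _,
    fun i => ⟨φ i, hφ i, hb i, (le_abs_self _).trans ?_⟩⟩
  exact Finset.single_le_sum (f := fun i => |∫ τ in Icc (0 : ℝ) 1, φ i τ|)
    (fun i _ => abs_nonneg _) (Finset.mem_univ i)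

/-- `Re (∫ √V dx / ħ)` does not decrease along the sides. -/
def ActionMono {α : ℝ} {N : Set ℂ} {v : Fin 4 → Vertex} (Q : Realization α N v) (ν ħ : ℂ) : Prop :=
  ∀ i, ∀ x ∈ Ioo (0 : ℝ) 1, ∀ y ∈ Ioo (0 : ℝ) 1, x < y →
    0 ≤ (action ((Q i).γ ν) ((Q i).r ν) x y / ħ).re

/-- Each product is within 5δ/2 of 1 and the denominator is at least 1/4, whence the factor 5 · 4 =
20. -/
lemma norm_one_sub_quot_le {x y z u : ℂ} {δ : ℝ} (hδ : δ ≤ 1 / 2) (hx : ‖x - 1‖ ≤ δ)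
    (hy : ‖y - 1‖ ≤ δ) (hz : ‖z - 1‖ ≤ δ) (hu : ‖u - 1‖ ≤ δ) :
    ‖1 - x * z / (y * u)‖ ≤ 20 * δ := by
  have hδ0 : 0 ≤ δ := (norm_nonneg _).trans hx
  have hlow : ∀ a : ℂ, ‖a - 1‖ ≤ δ → 1 / 2 ≤ ‖a‖ := fun a ha => by
    have := norm_sub_norm_le 1 a
    rw [norm_one, norm_sub_rev] at this
    linarith
  have hprod : ∀ a b : ℂ, ‖a - 1‖ ≤ δ → ‖b - 1‖ ≤ δ → ‖a * b - 1‖ ≤ 5 / 2 * δ := fun a b ha hb => by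
    have : a * b - 1 = (a - 1) * (b - 1) + (a - 1) + (b - 1) := by ring
    rw [this]
    refine (norm_add₃_le).trans ?_
    rw [norm_mul]
    nlinarith [norm_nonneg (a - 1), norm_nonneg (b - 1)]
  have hyu : 1 / 4 ≤ ‖y * u‖ := by
    rw [norm_mul]
    nlinarith [hlow y hy, hlow u hu]
  have h0 : y * u ≠ 0 := fun h => by rw [h, norm_zero] at hyu; norm_num at hyu
  rw [show 1 - x * z / (y * u) = (y * u - 1 - (x * z - 1)) / (y * u) by
      rw [sub_sub_sub_cancel_right, sub_div, div_self h0], norm_div,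
    div_le_iff₀ (by linarith)]
  refine (norm_sub_le _ _).trans ?_
  nlinarith [hprod y u hy hu, hprod x z hx hz]

namespace Chain

variable {α : ℝ} {N : Set ℂ} {v : Fin 4 → Vertex} {Q : Realization α N v} {ν : ℂ} {M : ℝ}
  {s t : Fin 4 → ℝ} {p S : Fin 5 → ℂ → ℂ} {P T : Fin 4 → ℝ → ℂ} {μ d : ℂ}

/-- The asymptotic values exist, and the cross-ratio is given by the monodromy of the root. -/
lemma exists_estimate (h : Chain Q ν M s t p S P T μ d) (hα : 0 < α) {ħ : ℂ} (hħ : ħ ≠ 0)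
    (harg : |ħ.arg| < Real.pi / 2) (hmono : ActionMono Q ν ħ) {H : ℝ} (hH : ErrorBound Q H)
    (hħH : ‖ħ‖ * H ≤ 1 / 4) {g k : ℂ → ℂ} (hg : IsSol (fun w => Qf α ν w / ħ ^ 2) g)
    (hk : IsSol (fun w => Qf α ν w / ħ ^ 2) k) (hw : wr g k 0 ≠ 0) :
    ∃ (W : Fin 4 → OnePoint ℂ) (R : ℂ), (∀ i, Tendsto
      (fun w => quot (g (w + shift α ħ)) (k (w + shift α ħ))) (vertexFilter α (v i)) (𝓝 (W i))) ∧
      crossRatio (W 0) (W 1) (W 2) (W 3) = (R : OnePoint ℂ) ∧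
      ‖R * Complex.exp (d / ħ) + μ‖ ≤ 40 * H * ‖ħ‖ := by
  have key : ∀ i : Fin 4, ∃ χ, IsSubdominant α ν ħ (v i) χ ∧ Tendsto (fun w => dev (Qf α ν)
      (((-1) ^ ((i : ℕ) + 1) : ℝ) * ħ) (p i.castSucc w) (S i.castSucc w) χ w)
      (vertexFilter α (v i)) (𝓝 0) := fun i => by
    obtain ⟨σ, hσ, hS, hχ⟩ := exists_normalized_subdominant hα ν (v i) (h.link i).rootOn
    obtain ⟨χ, h1, h2, h3⟩ := hχ ħ hħ harg
    refine ⟨χ, ⟨h1, h3⟩, ?_⟩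
    rw [(h.link i).sign_start hσ hS] at h2
    simpa using h2
  choose χ hχ hdev using key
  have hμ := h.sq
  have hμ0 : μ ≠ 0 := by rintro rfl; simp at hμ
  -- The multiple of χ 0 that is normalized with respect to the root and action obtained after one
  -- full turn.
  set c := μ * Complex.exp (-(d / ħ)) with hc
  have hc0 : c ≠ 0 := mul_ne_zero hμ0 (Complex.exp_ne_zero _)
  have hlast : Tendsto (fun w => dev (Qf α ν) (-ħ) (p 4 w) (S 4 w) (fun w => c * χ 0 w) w)
      (vertexFilter α (v 0)) (𝓝 0) := by
    have h0 := hdev 0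
    simp only [Fin.val_zero, zero_add, pow_one, Complex.ofReal_neg, Complex.ofReal_one, neg_mul,
      one_mul] at h0
    refine h0.congr' ?_
    filter_upwards [eventually_mem_vertexNhd hα M (v 0)] with w hw
    have e : ∀ κ, lg (Qf α ν) κ (p 4 w) (fun w => c * χ 0 w) w =
        Complex.exp (-(d / ħ)) * lg (Qf α ν) κ (p 0 w) (χ 0) w := fun κ => by
      have h1 := lg_root_mul (Qf α ν) κ (p 0 w) μ (by linear_combination (μ ^ 2 + 1) * hμ) (χ 0) w
      rw [hμ, one_mul, ← (h.jump w hw).1] at h1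
      rw [lg_const_mul _ _ _ _ (hχ 0).isSol.1, h1, hc]
      linear_combination Complex.exp (-(d / ħ)) * lg (Qf α ν) κ (p 0 w) (χ 0) w * hμ
    have e2 : Complex.exp (-(S 4 w / -ħ)) = Complex.exp (d / ħ) * Complex.exp (-(S 0 w / -ħ)) := by
      rw [(h.jump w hw).2, ← Complex.exp_add]
      congr 1
      field_simp
      ring
    have e3 : ∀ a b : ℂ, Complex.exp (-(d / ħ)) * a * (Complex.exp (d / ħ) * b) = a * b :=
      fun a b => by
        rw [Complex.exp_neg]
        have := Complex.exp_ne_zero (d / ħ)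
        field_simp
    simp only [dev, e, e2, e3]
    rfl
  have side : ∀ (i : Fin 4) (χ' : ℂ → ℂ), IsSol (fun w => Qf α ν w / ħ ^ 2) χ' →
      Tendsto (fun w => dev (Qf α ν) (-(((-1) ^ ((i : ℕ) + 1) : ℝ) * ħ)) (p i.succ w) (S i.succ w)
        χ' w) (vertexFilter α (v (i + 1))) (𝓝 0) →
      ‖-(((-1) ^ ((i : ℕ) + 1) : ℝ) * ħ) / 2 * wr (χ i) χ' 0 - 1‖ ≤ 2 * (‖ħ‖ * H) := by
    intro i χ' hχ' hd'
    obtain ⟨φ, hφ, hφb, hφH⟩ := hH i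
    have h1 := (h.link i).norm_wr_sub_one_le hħ (hmono i) hφ (hφb ν (h.link i).mem) (hχ i).isSol
      hχ' (hdev i) hd'
    refine h1.trans ?_
    have h2 : Real.exp (‖ħ‖ * ∫ τ in Icc (0 : ℝ) 1, φ τ) ≤ Real.exp (‖ħ‖ * H) := by gcongr
    have h3 : 0 ≤ ‖ħ‖ * ∫ τ in Icc (0 : ℝ) 1, φ τ := by
      have := (norm_nonneg _).trans h1
      rwa [sub_nonneg, Real.one_le_exp_iff] at this
    have h4 : 0 ≤ ‖ħ‖ * H := h3.trans (by gcongr)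
    -- The amplification factor minus 1 is at most 2‖ħ‖H.
    have h5 := Real.abs_exp_sub_one_le (x := ‖ħ‖ * H) (by rw [abs_of_nonneg h4]; linarith)
    rw [abs_of_nonneg h4] at h5
    linarith [le_abs_self (Real.exp (‖ħ‖ * H) - 1)]
  have s3 : (-1 : ℂ) ^ 3 = -1 := by norm_num
  have s4 : (-1 : ℂ) ^ 4 = 1 := by norm_num
  have x0 := side 0 (χ 1) (hχ 1).isSol (by simpa using hdev 1)
  have x1 := side 1 (χ 2) (hχ 2).isSol (by simpa [s3] using hdev 2)
  have x2 := side 2 (χ 3) (hχ 3).isSol (by simpa [s3, s4] using hdev 3)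
  have x3 := side 3 (fun w => c * χ 0 w) ((hχ 0).isSol.const_mul c) (by simpa [s4] using hlast)
  have ewr : wr (χ 3) (fun w => c * χ 0 w) 0 = -(c * wr (χ 0) (χ 3) 0) := by
    have := wr_lin (hχ 0).isSol (hχ 3).isSol 0 1 c 0 0
    simp only [zero_mul, zero_add, add_zero, one_mul] at this
    rw [this]
    ring
  rw [ewr] at x3
  simp only [Fin.val_zero, Fin.val_one, Fin.val_two, zero_add, pow_one, Complex.ofReal_neg,
    Complex.ofReal_one, neg_mul, one_mul, neg_neg, Nat.reduceAdd, Complex.ofReal_pow, s3,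
    even_two, Even.neg_pow, one_pow, show ((3 : Fin 4) : ℕ) = 3 from rfl, s4] at x0 x1 x2 x3
  have hlow : ∀ a : ℂ, ‖a - 1‖ ≤ 2 * (‖ħ‖ * H) → a ≠ 0 := by
    rintro a ha rfl
    simp at ha
    linarith
  have y1 := hlow _ x1
  have y3 := hlow _ x3
  -- The Wronskians in the denominator do not vanish, so the coordinate is finite.
  have w12 : wr (χ 1) (χ 2) 0 ≠ 0 := fun h0 => y1 (by rw [h0, mul_zero])
  have w03 : wr (χ 0) (χ 3) 0 ≠ 0 := fun h0 => y3 (by rw [h0]; simp)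
  obtain ⟨W, hW, hR⟩ := exists_crossRatio hχ w03 w12 hg hk hw
  refine ⟨W, _, hW, hR, ?_⟩
  have hfin := norm_one_sub_quot_le (by linarith) x0 x1 x2 x3
  -- The sign in R e^{d/ħ} ≈ -μ comes from wr (χ 3) (c χ 0) = -c wr (χ 0) (χ 3), the swap needed to
  -- close the cycle.
  have e : wr (χ 0) (χ 1) 0 * wr (χ 2) (χ 3) 0 / (wr (χ 0) (χ 3) 0 * wr (χ 1) (χ 2) 0) *
      Complex.exp (d / ħ) + μ = μ * (1 - ħ / 2 * wr (χ 0) (χ 1) 0 * (ħ / 2 * wr (χ 2) (χ 3) 0) /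
        (-ħ / 2 * wr (χ 1) (χ 2) 0 * (-ħ / 2 * -(c * wr (χ 0) (χ 3) 0)))) := by
    have hE : Complex.exp (d / ħ) = μ / c := by
      rw [hc, Complex.exp_neg]
      field_simp
    rw [hE]
    field_simp
    ring
  have hμn : ‖μ‖ = 1 := by
    have := congrArg norm hμ
    rw [norm_pow, norm_one] at this
    exact (pow_eq_one_iff_of_nonneg (norm_nonneg _) two_ne_zero).1 this
  rw [e, norm_mul, hμn, one_mul]
  calc _ ≤ _ := hfin
    _ = _ := by ring

end Chain

end

section

/-! ### Continuation of the fourth root along piecewise smooth curves -/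

/-- Along the piecewise smooth curve `Γ` on `[a, b]`, which avoids the zeros of `Q`, the fourth root
of `Q` with the value `R` at `a` is continued to the value `R'`, and a primitive of its square
along `Γ` increases by `D`. -/
structure Arc (Q : ℂ → ℂ) (Γ : ℝ → ℂ) (a b : ℝ) (R R' D : ℂ) : Prop where
  lt : a < b
  cont : ContinuousOn Γ (Icc a b)
  ne_zero : ∀ τ ∈ Icc a b, Q (Γ τ) ≠ 0
  integrable : ∀ f : ℝ → ℂ, ContinuousOn f (Icc a b) →
    IntervalIntegrable (fun τ => f τ * deriv Γ τ) MeasureTheory.volume a b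
  integral_eq : ∀ K k : ℂ → ℂ, ContinuousOn (fun τ => k (Γ τ)) (Icc a b) →
    (∀ τ ∈ Icc a b, HasDerivAt K (k (Γ τ)) (Γ τ)) →
    ∫ τ in a..b, k (Γ τ) * deriv Γ τ = K (Γ b) - K (Γ a)
  root : R' = R * Complex.exp (∫ τ in a..b, deriv Q (Γ τ) / (4 * Q (Γ τ)) * deriv Γ τ)
  action : ∀ σ : ℝ → ℂ, ContinuousOn σ (Icc a b) → (∀ τ ∈ Icc a b, σ τ ^ 2 = Q (Γ τ)) →
    σ a = R ^ 2 → σ b = R' ^ 2 ∧ ∫ τ in a..b, σ τ * deriv Γ τ = D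

namespace Arc

variable {Q : ℂ → ℂ} {Γ : ℝ → ℂ} {a b c : ℝ} {R R' R'' D D' : ℂ}

lemma continuousOn_logDeriv (h : Arc Q Γ a b R R' D) (hQ : Differentiable ℂ Q) :
    ContinuousOn (fun τ => deriv Q (Γ τ) / (4 * Q (Γ τ))) (Icc a b) :=
  ((differentiable_deriv hQ).continuous.comp_continuousOn h.cont).div
    (continuousOn_const.mul (hQ.continuous.comp_continuousOn h.cont))
    fun τ hτ => mul_ne_zero (by norm_num) (h.ne_zero τ hτ)

lemma trans (h : Arc Q Γ a b R R' D) (h' : Arc Q Γ b c R' R'' D') (hQ : Differentiable ℂ Q) :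
    Arc Q Γ a c R R'' (D + D') := by
  have hu : Icc a b ∪ Icc b c = Icc a c := Icc_union_Icc_eq_Icc h.lt.le h'.lt.le
  have s1 : Icc a b ⊆ Icc a c := Icc_subset_Icc_right h'.lt.le
  have s2 : Icc b c ⊆ Icc a c := Icc_subset_Icc_left h.lt.le
  refine ⟨h.lt.trans h'.lt, ?_, ?_, ?_, ?_, ?_, ?_⟩
  · rw [← hu]
    exact h.cont.union_of_isClosed h'.cont isClosed_Icc isClosed_Icc
  · intro τ hτ
    rw [← hu] at hτ
    exact hτ.elim (h.ne_zero τ) (h'.ne_zero τ)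
  · exact fun f hf => (h.integrable f (hf.mono s1)).trans (h'.integrable f (hf.mono s2))
  · intro K k hk hK
    rw [← intervalIntegral.integral_add_adjacent_intervals
      (h.integrable (fun τ => k (Γ τ)) (hk.mono s1)) (h'.integrable (fun τ => k (Γ τ)) (hk.mono s2)),
      h.integral_eq K k (hk.mono s1) fun τ hτ => hK τ (s1 hτ),
      h'.integral_eq K k (hk.mono s2) fun τ hτ => hK τ (s2 hτ)]
    ring
  · rw [← intervalIntegral.integral_add_adjacent_intervals
      (h.integrable _ (h.continuousOn_logDeriv hQ)) (h'.integrable _ (h'.continuousOn_logDeriv hQ)),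
      Complex.exp_add, ← mul_assoc, ← h.root]
    exact h'.root
  · intro σ hσ hsq ha
    obtain ⟨e1, e2⟩ := h.action σ (hσ.mono s1) (fun τ hτ => hsq τ (s1 hτ)) ha
    obtain ⟨e3, e4⟩ := h'.action σ (hσ.mono s2) (fun τ hτ => hsq τ (s2 hτ)) e1
    refine ⟨e3, ?_⟩
    rw [← intervalIntegral.integral_add_adjacent_intervals (h.integrable σ (hσ.mono s1))
      (h'.integrable σ (hσ.mono s2)), e2, e4]

/-- Derivatives are needed only in the open interval: at a junction of two pieces `deriv Γ` may be a
default value, which the integrals do not see. -/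
lemma of_contDiffOn (hQ : Differentiable ℂ Q) (hab : a < b) (hΓ : ContDiffOn ℝ 1 Γ (Icc a b))
    {ρ A : ℝ → ℂ} (hρ : ContinuousOn ρ (Icc a b)) (hA : ContinuousOn A (Icc a b))
    (h0 : ∀ τ ∈ Icc a b, Q (Γ τ) ≠ 0) (hroot : ∀ τ ∈ Icc a b, ρ τ ^ 4 = Q (Γ τ))
    (hρ' : ∀ τ ∈ Ioo a b, HasDerivAt ρ (deriv Q (Γ τ) / (4 * Q (Γ τ)) * deriv Γ τ * ρ τ) τ)
    (hA' : ∀ τ ∈ Ioo a b, HasDerivAt A (ρ τ ^ 2 * deriv Γ τ) τ) :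
    Arc Q Γ a b (ρ a) (ρ b) (A b - A a) := by
  have hd : ∀ τ ∈ Ioo a b, HasDerivAt Γ (deriv Γ τ) τ := fun τ hτ =>
    ((hΓ.differentiableOn one_ne_zero).differentiableAt (Icc_mem_nhds hτ.1 hτ.2)).hasDerivAt
  have hint : ∀ f : ℝ → ℂ, ContinuousOn f (Icc a b) →
      IntervalIntegrable (fun τ => f τ * deriv Γ τ) MeasureTheory.volume a b := fun f hf => by
    refine IntervalIntegrable.congr_uIoo (f := fun τ => f τ * derivWithin Γ (Icc a b) τ)
      (ContinuousOn.intervalIntegrable_of_Icc hab.le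
        (hf.mul (hΓ.continuousOn_derivWithin (uniqueDiffOn_Icc hab) le_rfl))) ?_
    rw [uIoo_of_le hab.le]
    intro τ hτ
    simp only
    rw [derivWithin_of_mem_nhds (Icc_mem_nhds hτ.1 hτ.2)]
  have hk : ContinuousOn (fun τ => deriv Q (Γ τ) / (4 * Q (Γ τ))) (Icc a b) :=
    ((differentiable_deriv hQ).continuous.comp_continuousOn hΓ.continuousOn).div
      (continuousOn_const.mul (hQ.continuous.comp_continuousOn hΓ.continuousOn))
      fun τ hτ => mul_ne_zero (by norm_num) (h0 τ hτ)
  have ha : a ∈ Icc a b := left_mem_Icc.2 hab.le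
  have hb : b ∈ Icc a b := right_mem_Icc.2 hab.le
  refine ⟨hab, hΓ.continuousOn, h0, hint, ?_, ?_, ?_⟩
  · intro K k hk hK
    refine intervalIntegral.integral_eq_sub_of_hasDerivAt_of_le (f := fun τ => K (Γ τ)) hab.le
      (fun τ hτ => (hK τ hτ).continuousAt.comp_continuousWithinAt (hΓ.continuousOn τ hτ))
      (fun τ hτ => (hK τ (Ioo_subset_Icc_self hτ)).comp τ (hd τ hτ))
      (hint (fun τ => k (Γ τ)) hk)
  · set k := fun τ => deriv Q (Γ τ) / (4 * Q (Γ τ)) * deriv Γ τ with hkdef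
    have hki : IntervalIntegrable k MeasureTheory.volume a b := hint _ hk
    have hkc : ContinuousOn k (Ioo a b) := by
      refine (hk.mono Ioo_subset_Icc_self).mul (((hΓ.continuousOn_derivWithin
        (uniqueDiffOn_Icc hab) le_rfl).mono Ioo_subset_Icc_self).congr fun τ hτ => ?_)
      rw [derivWithin_of_mem_nhds (Icc_mem_nhds hτ.1 hτ.2)]
    set J := fun τ => ∫ u in a..τ, k u with hJ
    have hJc : ContinuousOn J (Icc a b) := by
      have := intervalIntegral.continuousOn_primitive_interval (f := k) (a := a) (b := b)
        (μ := MeasureTheory.volume) (by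
          rw [uIcc_of_le hab.le]
          exact (intervalIntegrable_iff_integrableOn_Icc_of_le hab.le).1 hki)
      rwa [uIcc_of_le hab.le] at this
    have hJd : ∀ τ ∈ Ioo a b, HasDerivAt J (k τ) τ := fun τ hτ =>
      intervalIntegral.integral_hasDerivAt_right
        (hki.mono_set (uIcc_subset_uIcc_left (by
          rw [uIcc_of_le hab.le]; exact Ioo_subset_Icc_self hτ)))
        (hkc.stronglyMeasurableAtFilter isOpen_Ioo τ hτ)
        (hkc.continuousAt (Ioo_mem_nhds hτ.1 hτ.2))
    have h1 := intervalIntegral.integral_eq_sub_of_hasDerivAt_of_le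
      (f := fun τ => ρ τ * Complex.exp (-J τ)) (f' := fun _ => 0) hab.le
      (hρ.mul (Complex.continuous_exp.comp_continuousOn hJc.neg))
      (fun τ hτ => ((hρ' τ hτ).fun_mul (hJd τ hτ).fun_neg.cexp).congr_deriv (by
        rw [hkdef]; ring)) (by simp)
    have hJa : J a = 0 := by simp [hJ]
    simp only [intervalIntegral.integral_zero, hJa, neg_zero, Complex.exp_zero, mul_one,
      Complex.exp_neg] at h1
    have := Complex.exp_ne_zero (J b)
    change ρ b = ρ a * Complex.exp (J b)
    field_simp at h1
    linear_combination -h1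
  · intro σ hσ hsq hσa
    have heq : EqOn σ (fun τ => ρ τ ^ 2) (Icc a b) :=
      isPreconnected_Icc.eq_of_sq_eq hσ (hρ.pow 2)
        (fun τ hτ => by
          simp only [Pi.pow_apply]
          rw [hsq τ hτ, ← hroot τ hτ]
          ring)
        (fun {τ} hτ h => h0 τ hτ (by
          rw [← hroot τ hτ, show ρ τ ^ 4 = (ρ τ ^ 2) ^ 2 by ring, h]; simp)) ha hσa
    refine ⟨heq hb, ?_⟩
    rw [intervalIntegral.integral_congr (g := fun τ => ρ τ ^ 2 * deriv Γ τ) (fun τ hτ => by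
      rw [uIcc_of_le hab.le] at hτ
      simp only [heq hτ])]
    exact intervalIntegral.integral_eq_sub_of_hasDerivAt_of_le hab.le hA hA' (hint _ (hρ.pow 2))

end Arc

/-! ### The argument principle -/

/-- The quotient by (w - z)ⁿ extends holomorphically through z by the local factorization. -/
lemma exists_eq_pow_mul {f : ℂ → ℂ} (hf : Differentiable ℂ f) {z : ℂ}
    (hz : analyticOrderAt f z ≠ ⊤) :
    ∃ g : ℂ → ℂ, Differentiable ℂ g ∧ g z ≠ 0 ∧
      ∀ w, f w = (w - z) ^ analyticOrderNatAt f z * g w := by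
  set n := analyticOrderNatAt f z with hn
  have hcast : analyticOrderAt f z = n := (Nat.cast_analyticOrderNatAt hz).symm
  obtain ⟨h, hh, hh0, he⟩ := ((hf.analyticAt z).analyticOrderAt_eq_natCast).1 hcast
  simp only [smul_eq_mul] at he
  set g := Function.update (fun w => f w / (w - z) ^ n) z (h z) with hg
  have hgh : g =ᶠ[𝓝 z] h := by
    filter_upwards [he] with w hw
    by_cases hwz : w = z
    · simp [hg, hwz]
    · rw [hg, Function.update_of_ne hwz, hw,
        mul_div_cancel_left₀ _ (pow_ne_zero _ (sub_ne_zero.2 hwz))]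
  refine ⟨g, fun w => ?_, by simpa [hg] using hh0, fun w => ?_⟩
  · by_cases hwz : w = z
    · rw [hwz]
      exact hh.differentiableAt.congr_of_eventuallyEq hgh
    · refine DifferentiableAt.congr_of_eventuallyEq (f := fun w => f w / (w - z) ^ n)
        ((hf w).div (by fun_prop) (pow_ne_zero _ (sub_ne_zero.2 hwz))) ?_
      filter_upwards [isOpen_ne.mem_nhds hwz] with u hu
      rw [hg, Function.update_of_ne hu]
  · by_cases hwz : w = z
    · have := he.self_of_nhds
      rw [hwz, this]
      simp [hg]
    · rw [hg, Function.update_of_ne hwz, mul_div_cancel₀ _ (pow_ne_zero _ (sub_ne_zero.2 hwz))]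

/-- Zeros are divided out one at a time; the factors already removed do not vanish at the new point,
so the order of f there is that of the remaining quotient. -/
lemma exists_eq_prod_mul {f : ℂ → ℂ} (hf : Differentiable ℂ f)
    (hf0 : ∀ z, analyticOrderAt f z ≠ ⊤) (Z : Finset ℂ) :
    ∃ g : ℂ → ℂ, Differentiable ℂ g ∧ (∀ z ∈ Z, g z ≠ 0) ∧
      ∀ w, f w = (∏ z ∈ Z, (w - z) ^ analyticOrderNatAt f z) * g w := by
  induction Z using Finset.induction_on with
  | empty => exact ⟨f, hf, by simp, by simp⟩
  | insert z₀ Z hz ih =>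
    obtain ⟨g, hg, hg0, he⟩ := ih
    have hp : Differentiable ℂ fun w => ∏ z ∈ Z, (w - z) ^ analyticOrderNatAt f z := by fun_prop
    have ho : analyticOrderAt f z₀ = analyticOrderAt g z₀ := by
      have h1 : f = (fun w => ∏ z ∈ Z, (w - z) ^ analyticOrderNatAt f z) * g := funext he
      have h2 : analyticOrderAt (fun w => ∏ z ∈ Z, (w - z) ^ analyticOrderNatAt f z) z₀ = 0 := by
        rw [(hp.analyticAt z₀).analyticOrderAt_eq_zero, Finset.prod_ne_zero_iff]
        exact fun z hzZ => pow_ne_zero _ (sub_ne_zero.2 fun h => hz (h ▸ hzZ))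
      conv_lhs => rw [h1]
      rw [analyticOrderAt_mul (hp.analyticAt z₀) (hg.analyticAt z₀), h2, zero_add]
    obtain ⟨k, hk, hk0, hke⟩ := exists_eq_pow_mul hg (z := z₀) (ho ▸ hf0 z₀)
    refine ⟨k, hk, fun z hzZ => ?_, fun w => ?_⟩
    · rcases Finset.mem_insert.1 hzZ with rfl | h
      · exact hk0
      · intro h0
        apply hg0 z h
        rw [hke z, h0, mul_zero]
    · rw [Finset.prod_insert hz, he w, hke w, analyticOrderNatAt, analyticOrderNatAt, ho]
      ring

/-- On a ball, the logarithmic derivative of an entire function is that of the polynomial with the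
same zeros, up to a holomorphic function. -/
lemma exists_logDeriv_eq {f : ℂ → ℂ} (hf : Differentiable ℂ f)
    (hf0 : ∀ z, analyticOrderAt f z ≠ ⊤) (B : ℝ) :
    ∃ (Z : Finset ℂ) (k : ℂ → ℂ), (∀ z, z ∈ Z ↔ z ∈ Metric.closedBall 0 B ∧ f z = 0) ∧
      DifferentiableOn ℂ k (Metric.ball 0 B) ∧ ∀ w ∈ Metric.ball 0 B, f w ≠ 0 →
        deriv f w / f w = ∑ z ∈ Z, analyticOrderNatAt f z / (w - z) + k w := by
  have hfin : {z : ℂ | z ∈ Metric.closedBall 0 B ∧ f z = 0}.Finite := by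
    by_contra hinf
    -- Infinitely many zeros in a compact disc would accumulate, against finiteness of the order at
    -- the limit point.
    obtain ⟨z, -, hz⟩ := Set.Infinite.exists_accPt_of_subset_isCompact hinf
      (isCompact_closedBall (0 : ℂ) B) fun z hz => hz.1
    refine hf0 z (analyticOrderAt_eq_top.2 ?_)
    refine ((hf.analyticAt z).frequently_zero_iff_eventually_zero).1 ?_
    exact (accPt_iff_frequently_nhdsNE.1 hz).mono fun w hw => hw.2
  obtain ⟨g, hg, hg0, he⟩ := exists_eq_prod_mul hf hf0 hfin.toFinset
  have hZ : ∀ z, z ∈ hfin.toFinset ↔ z ∈ Metric.closedBall 0 B ∧ f z = 0 := fun z => by simp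
  have hgB : ∀ w ∈ Metric.ball (0 : ℂ) B, g w ≠ 0 := fun w hw h0 => by
    have : f w = 0 := by rw [he, h0, mul_zero]
    exact hg0 w ((hZ w).2 ⟨Metric.ball_subset_closedBall hw, this⟩) h0
  refine ⟨_, fun w => deriv g w / g w, hZ, fun w hw => ((differentiable_deriv hg w).div (hg w)
    (hgB w hw)).differentiableWithinAt, fun w hw hfw => ?_⟩
  have hne : ∀ z ∈ hfin.toFinset, w - z ≠ 0 := fun z hz h => hfw (by
    rw [sub_eq_zero.1 h]
    exact ((hZ z).1 hz).2)
  have h1 : logDeriv f w = logDeriv (fun w => (∏ z ∈ hfin.toFinset,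
      (w - z) ^ analyticOrderNatAt f z) * g w) w := by rw [← funext he]
  rw [logDeriv_mul w (Finset.prod_ne_zero_iff.2 fun z hz => pow_ne_zero _ (hne z hz)) (hgB w hw)
    (by fun_prop) (hg w)] at h1
  rw [← logDeriv_apply, h1]
  refine congrArg₂ (· + ·) ?_ rfl
  rw [logDeriv_prod (f := fun z w => (w - z) ^ analyticOrderNatAt f z)
    (fun z hz => pow_ne_zero _ (hne z hz)) (fun z _ => by fun_prop)]
  refine Finset.sum_congr rfl fun z hz => ?_
  rw [logDeriv_fun_pow (by fun_prop)]
  simp [logDeriv_apply, div_eq_mul_inv]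

end

section

/-! ### Period and index of the loop -/

namespace IsSurgeryLoop

variable {α : ℝ} {N : Set ℂ} {v : Fin 4 → Vertex} {Q : Realization α N v} {ν : ℂ} {Γ : ℝ → ℂ}
  {M : ℝ} {s t : Fin 4 → ℝ} {p S : Fin 5 → ℂ → ℂ} {P T : Fin 4 → ℝ → ℂ} {μ d : ℂ}

lemma arc_side (hΓ : IsSurgeryLoop Q ν Γ s t M) (h : Chain Q ν M s t p S P T μ d) (i : Fin 4) :
    Arc (Qf α ν) Γ (2 * (i : ℕ)) (2 * (i : ℕ) + 1) (p i.castSucc (Γ (2 * (i : ℕ))))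
      (p i.succ (Γ (2 * (i : ℕ) + 1)))
      (S i.succ (Γ (2 * (i : ℕ) + 1)) - S i.castSucc (Γ (2 * (i : ℕ)))) := by
  have l := h.link i
  obtain ⟨c1, c2, c3⟩ := hΓ.cut i
  set x : ℝ := 2 * (i : ℕ) with hx
  set θ : ℝ → ℝ := fun τ => s i + (t i - s i) * (τ - x) with hθ
  have hθd : ∀ τ, HasDerivAt θ (t i - s i) τ := fun τ =>
    ((((hasDerivAt_id τ).sub_const x).const_mul (t i - s i)).const_add (s i)).congr_deriv
      (mul_one _)
  have hθc : Continuous θ := by fun_prop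
  have hθm : ∀ τ ∈ Icc x (x + 1), θ τ ∈ Icc (s i) (t i) := fun τ hτ => by
    have h1 : 0 ≤ τ - x := by linarith [hτ.1]
    have h2 : τ - x ≤ 1 := by linarith [hτ.2]
    constructor
    · simp only [hθ]; nlinarith
    · simp only [hθ]; nlinarith
  have hθI : ∀ τ ∈ Icc x (x + 1), θ τ ∈ Ioo (0 : ℝ) 1 := fun τ hτ =>
    ⟨c1.trans_le (hθm τ hτ).1, (hθm τ hτ).2.trans_lt c3⟩
  have hΓθ : ∀ τ ∈ Icc x (x + 1), Γ τ = (Q i).γ ν (θ τ) := fun τ hτ => by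
    have := hΓ.side i (τ - x) ⟨by linarith [hτ.1], by linarith [hτ.2]⟩
    rwa [← hx, add_sub_cancel] at this
  have hΓd : ∀ τ ∈ Ioo x (x + 1), HasDerivAt Γ ((t i - s i : ℝ) * deriv ((Q i).γ ν) (θ τ)) τ := by
    intro τ hτ
    have h1 := ((Q i).hasDerivAt l.mem _ (hθI τ (Ioo_subset_Icc_self hτ))).scomp τ (hθd τ)
    refine (h1.congr_deriv (by rw [Complex.real_smul])).congr_of_eventuallyEq ?_
    filter_upwards [Icc_mem_nhds hτ.1 hτ.2] with u hu
    exact hΓθ u hu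
  have comp : ∀ {f : ℝ → ℂ} {f' : ℂ} {τ : ℝ}, τ ∈ Ioo x (x + 1) →
      HasDerivAt f (f' * deriv ((Q i).γ ν) (θ τ)) (θ τ) →
      HasDerivAt (fun τ => f (θ τ)) (f' * deriv Γ τ) τ := fun {f f' τ} hτ hf => by
    refine (hf.scomp τ (hθd τ)).congr_deriv ?_
    rw [(hΓd τ hτ).deriv, Complex.real_smul]
    ring
  have hl : x ∈ Icc x (x + 1) := ⟨le_rfl, by linarith⟩
  have hr : x + 1 ∈ Icc x (x + 1) := ⟨by linarith, le_rfl⟩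
  have θl : θ x = s i := by simp [hθ]
  have θr : θ (x + 1) = t i := by simp [hθ]
  have key := Arc.of_contDiffOn (Q := Qf α ν) (Γ := Γ) (ρ := fun τ => P i (θ τ))
    (A := fun τ => T i (θ τ)) (Qf_differentiable α ν) (lt_add_one x)
    ((((Q i).smooth ν l.mem).of_le (by exact_mod_cast le_top)).comp
      (f := θ) (s := Icc x (x + 1)) (by fun_prop) hθI |>.congr hΓθ)
    (fun τ hτ => (l.path.deriv_root _ (hθI τ hτ)).continuousAt.comp_continuousWithinAt
      hθc.continuousWithinAt)
    (fun τ hτ => (l.path.deriv_action _ (hθI τ hτ)).continuousAt.comp_continuousWithinAt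
      hθc.continuousWithinAt)
    (fun τ hτ => by rw [hΓθ τ hτ]; exact l.path.ne_zero _ (hθI τ hτ))
    (fun τ hτ => by rw [hΓθ τ hτ]; exact l.path.root _ (hθI τ hτ))
    (fun τ hτ => by
      have hτ' := Ioo_subset_Icc_self hτ
      have h1 : HasDerivAt (P i) (P i (θ τ) * (deriv (Qf α ν) (Γ τ) / (4 * Qf α ν (Γ τ))) *
          deriv ((Q i).γ ν) (θ τ)) (θ τ) := by
        rw [hΓθ τ hτ']
        exact (l.path.deriv_root _ (hθI τ hτ')).congr_deriv (by ring)
      exact (comp hτ h1).congr_deriv (by ring))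
    (fun τ hτ => comp hτ (l.path.deriv_action _ (hθI τ (Ioo_subset_Icc_self hτ))))
  have es := l.start (s i) ⟨c1, le_rfl⟩
  have et := l.finish (t i) ⟨le_rfl, c3⟩
  rw [hΓθ x hl, hΓθ (x + 1) hr, θl, θr, ← es.1, ← et.1, ← es.2, ← et.2]
  simpa only [θl, θr] using key

lemma arc_corner (hΓ : IsSurgeryLoop Q ν Γ s t M) (h : Chain Q ν M s t p S P T μ d) (i : Fin 4) :
    Arc (Qf α ν) Γ (2 * (i : ℕ) + 1) (2 * (i : ℕ) + 2) (p i.succ (Γ (2 * (i : ℕ) + 1)))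
      (p i.succ (Γ (2 * (i : ℕ) + 2)))
      (S i.succ (Γ (2 * (i : ℕ) + 2)) - S i.succ (Γ (2 * (i : ℕ) + 1))) := by
  have l := (h.link i).rootOn'
  have hU : ∀ τ ∈ Icc (2 * (i : ℕ) + 1 : ℝ) (2 * (i : ℕ) + 2), Γ τ ∈ vertexNhd α M (v (i + 1)) :=
    fun τ hτ => by
      have := hΓ.corner_mem i (τ - (2 * (i : ℕ) + 1)) ⟨by linarith [hτ.1], by linarith [hτ.2]⟩
      rwa [add_sub_cancel] at this
  have hΓ1 := hΓ.corner_smooth i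
  have hd : ∀ τ ∈ Ioo (2 * (i : ℕ) + 1 : ℝ) (2 * (i : ℕ) + 2), HasDerivAt Γ (deriv Γ τ) τ :=
    fun τ hτ => ((hΓ1.differentiableOn one_ne_zero).differentiableAt
      (Icc_mem_nhds hτ.1 hτ.2)).hasDerivAt
  exact Arc.of_contDiffOn (ρ := fun τ => p i.succ (Γ τ)) (A := fun τ => S i.succ (Γ τ))
    (Qf_differentiable α ν) (by linarith) hΓ1
    (fun τ hτ => (l.deriv_root _ (hU τ hτ)).continuousAt.comp_continuousWithinAt
      (hΓ1.continuousOn τ hτ))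
    (fun τ hτ => (l.deriv_action _ (hU τ hτ)).continuousAt.comp_continuousWithinAt
      (hΓ1.continuousOn τ hτ))
    (fun τ hτ => l.ne_zero _ (hU τ hτ)) (fun τ hτ => l.root _ (hU τ hτ))
    (fun τ hτ => ((l.deriv_root _ (hU τ (Ioo_subset_Icc_self hτ))).comp τ (hd τ hτ)).congr_deriv
      (by ring))
    (fun τ hτ => (l.deriv_action _ (hU τ (Ioo_subset_Icc_self hτ))).comp τ (hd τ hτ))

lemma arc (hΓ : IsSurgeryLoop Q ν Γ s t M) (h : Chain Q ν M s t p S P T μ d) :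
    Arc (Qf α ν) Γ 0 8 (p 0 (Γ 0)) (p 4 (Γ 8)) (S 4 (Γ 8) - S 0 (Γ 0)) := by
  have hQ := Qf_differentiable α ν
  have a0 : Arc (Qf α ν) Γ 0 1 (p 0 (Γ 0)) (p 1 (Γ 1)) (S 1 (Γ 1) - S 0 (Γ 0)) := by
    have := hΓ.arc_side h 0
    norm_num at this
    exact this
  have a1 : Arc (Qf α ν) Γ 1 2 (p 1 (Γ 1)) (p 1 (Γ 2)) (S 1 (Γ 2) - S 1 (Γ 1)) := by
    have := hΓ.arc_corner h 0
    norm_num at this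
    exact this
  have a2 : Arc (Qf α ν) Γ 2 3 (p 1 (Γ 2)) (p 2 (Γ 3)) (S 2 (Γ 3) - S 1 (Γ 2)) := by
    have := hΓ.arc_side h 1
    norm_num at this
    exact this
  have a3 : Arc (Qf α ν) Γ 3 4 (p 2 (Γ 3)) (p 2 (Γ 4)) (S 2 (Γ 4) - S 2 (Γ 3)) := by
    have := hΓ.arc_corner h 1
    norm_num at this
    exact this
  have a4 : Arc (Qf α ν) Γ 4 5 (p 2 (Γ 4)) (p 3 (Γ 5)) (S 3 (Γ 5) - S 2 (Γ 4)) := by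
    have := hΓ.arc_side h 2
    norm_num at this
    exact this
  have a5 : Arc (Qf α ν) Γ 5 6 (p 3 (Γ 5)) (p 3 (Γ 6)) (S 3 (Γ 6) - S 3 (Γ 5)) := by
    have := hΓ.arc_corner h 2
    norm_num at this
    exact this
  have a6 : Arc (Qf α ν) Γ 6 7 (p 3 (Γ 6)) (p 4 (Γ 7)) (S 4 (Γ 7) - S 3 (Γ 6)) := by
    have := hΓ.arc_side h 3
    norm_num [show ((3 : Fin 4) : ℕ) = 3 from rfl] at this
    exact this
  have a7 : Arc (Qf α ν) Γ 7 8 (p 4 (Γ 7)) (p 4 (Γ 8)) (S 4 (Γ 8) - S 4 (Γ 7)) := by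
    have := hΓ.arc_corner h 3
    norm_num [show ((3 : Fin 4) : ℕ) = 3 from rfl] at this
    exact this
  have := ((((((a0.trans a1 hQ).trans a2 hQ).trans a3 hQ).trans a4 hQ).trans a5 hQ).trans a6
    hQ).trans a7 hQ
  convert this using 1
  ring

lemma apply_zero (hΓ : IsSurgeryLoop Q ν Γ s t M) : Γ 0 = (Q 0).γ ν (s 0) := by
  simpa using hΓ.side 0 0 ⟨le_rfl, zero_le_one⟩

lemma apply_zero_mem (hΓ : IsSurgeryLoop Q ν Γ s t M) : Γ 0 ∈ vertexNhd α M (v 0) := by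
  rw [hΓ.apply_zero]
  exact hΓ.start_mem 0 _ (hΓ.cut 0).1 le_rfl

/-- σ e^Γ is the square of the continued fourth root: both are square roots of Q along the loop, and
the chain starts with the same sign. So the period is the increase of S after one turn. -/
lemma period_eq (hΓ : IsSurgeryLoop Q ν Γ s t M) (h : Chain Q ν M s t p S P T μ d) {σ : ℝ → ℂ}
    (hσ : IsLoopBranch Q ν Γ s t σ) : period Γ σ = d := by
  have a := hΓ.arc h
  have h1 := (a.action (fun τ => σ τ * Complex.exp (Γ τ))
    (hσ.continuous.mul (Complex.continuous_exp.comp_continuousOn a.cont))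
    (fun τ hτ => by rw [mul_pow, hσ.sq τ hτ, Qf_eq_redV]; ring) (by
      have l := h.link 0
      have h2 := hσ.side_zero 0 ⟨le_rfl, zero_le_one⟩
      rw [mul_zero, add_zero] at h2
      have h3 := l.root_sq (s 0) l.s_mem
      rw [(l.start (s 0) ⟨l.s_mem.1, le_rfl⟩).1] at h3
      change p 0 _ ^ 2 = _ at h3
      rw [h2, hΓ.apply_zero, h3, StrictlyAdmissible.q]
      simp)).2
  rw [period, WKB.action]
  simp only [← mul_assoc]
  rw [h1, hΓ.closed, (h.jump _ hΓ.apply_zero_mem).2]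
  ring

/-- The continued root is multiplied by exp of ∮ Q'/(4Q). Writing Q = e^{2w}V, the first factor
contributes a constant to Q'/Q, whose integral over a loop closed in w is 0, and the second gives
iπ/2 times the index by the argument principle. -/
lemma exp_index (hΓ : IsSurgeryLoop Q ν Γ s t M) (h : Chain Q ν M s t p S P T μ d) :
    Complex.exp (-(Complex.I * Real.pi / 2) * index α ν Γ) = μ := by
  have a := hΓ.arc h
  have hV : Differentiable ℂ (redV α ν) := fun w => by
    unfold redV
    fun_prop (disch := simp)
  have hV0 : ∀ τ ∈ Icc (0 : ℝ) 8, redV α ν (Γ τ) ≠ 0 := fun τ hτ h0 => a.ne_zero τ hτ (by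
    rw [Qf_eq_redV, h0, mul_zero])
  have hI0 : (0 : ℝ) ∈ Icc (0 : ℝ) 8 := by norm_num
  have htop : ∀ z, analyticOrderAt (redV α ν) z ≠ ⊤ := fun z hz => hV0 0 hI0 (by
    have := AnalyticOnNhd.eqOn_zero_of_preconnected_of_eventuallyEq_zero
      (f := redV α ν) (U := univ) (fun z _ => hV.analyticAt z) isPreconnected_univ (mem_univ z)
      (analyticOrderAt_eq_top.1 hz)
    exact this (mem_univ _))
  obtain ⟨B, hB⟩ : ∃ B : ℝ, ∀ τ ∈ Icc (0 : ℝ) 8, Γ τ ∈ Metric.ball (0 : ℂ) B := by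
    obtain ⟨B, hB⟩ := (isCompact_Icc.image_of_continuousOn a.cont).isBounded.exists_norm_le
    refine ⟨B + 1, fun τ hτ => ?_⟩
    rw [mem_ball_zero_iff]
    linarith [hB _ (mem_image_of_mem Γ hτ)]
  obtain ⟨Z, k, hZ, hk, hlog⟩ := exists_logDeriv_eq hV htop B
  have hprim : ∀ k : ℂ → ℂ, DifferentiableOn ℂ k (Metric.ball 0 B) →
      ∫ τ in (0 : ℝ)..8, k (Γ τ) * deriv Γ τ = 0 := fun k hk => by
    obtain ⟨K, -, hK⟩ := exists_primitive_of_convex (convex_ball (0 : ℂ) B) Metric.isOpen_ball hk 0 0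
    rw [a.integral_eq K k (hk.continuousOn.comp a.cont hB) fun τ hτ => hK _ (hB τ hτ), hΓ.closed,
      sub_self]
  -- Zeros outside the disc containing the loop have winding number 0, so the sum is over finitely
  -- many points.
  have hindex : index α ν Γ = ∑ z ∈ Z, (analyticOrderNatAt (redV α ν) z : ℂ) * winding Γ z := by
    refine finsum_eq_sum_of_support_subset _ fun z hz => ?_
    by_contra hzZ
    apply hz
    rw [Finset.mem_coe, hZ, not_and_or] at hzZ
    rcases hzZ with h1 | h1
    · have h2 : winding Γ z = 0 := by
        rw [winding, hprim (fun w => (w - z)⁻¹), mul_zero]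
        refine DifferentiableOn.inv (by fun_prop) fun w hw h0 => h1 ?_
        rw [← sub_eq_zero.1 h0]
        exact Metric.ball_subset_closedBall hw
      simp only [h2, mul_zero]
    · have h2 : analyticOrderAt (redV α ν) z = 0 := (hV.analyticAt z).analyticOrderAt_eq_zero.2 h1
      simp [analyticOrderNatAt, h2]
  have hint : ∀ z ∈ Z, IntervalIntegrable (fun τ => (Γ τ - z)⁻¹ * deriv Γ τ)
      MeasureTheory.volume 0 8 := fun z hz => a.integrable _
    ((a.cont.sub continuousOn_const).inv₀ fun τ hτ h0 => hV0 τ hτ (by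
      rw [sub_eq_zero.1 h0]
      exact ((hZ z).1 hz).2))
  have hL : ∫ τ in (0 : ℝ)..8, deriv (Qf α ν) (Γ τ) / (4 * Qf α ν (Γ τ)) * deriv Γ τ =
      Complex.I * Real.pi / 2 * index α ν Γ := by
    have e1 : ∀ τ ∈ Icc (0 : ℝ) 8, deriv (Qf α ν) (Γ τ) / (4 * Qf α ν (Γ τ)) * deriv Γ τ =
        ∑ z ∈ Z, (analyticOrderNatAt (redV α ν) z / 4 : ℂ) * ((Γ τ - z)⁻¹ * deriv Γ τ) +
          (1 / 2 + k (Γ τ) / 4) * deriv Γ τ := fun τ hτ => by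
      have h1 := hlog _ (hB τ hτ) (hV0 τ hτ)
      have h2 : deriv (Qf α ν) (Γ τ) = 2 * Complex.exp (Γ τ) ^ 2 * redV α ν (Γ τ) +
          Complex.exp (Γ τ) ^ 2 * deriv (redV α ν) (Γ τ) := by
        rw [funext (Qf_eq_redV α ν)]
        refine (((Complex.hasDerivAt_exp (Γ τ)).fun_pow 2).fun_mul
          (hV (Γ τ)).hasDerivAt).deriv.trans ?_
        push_cast
        ring
      have h3 : deriv (Qf α ν) (Γ τ) / (4 * Qf α ν (Γ τ)) =
          1 / 2 + (deriv (redV α ν) (Γ τ) / redV α ν (Γ τ)) / 4 := by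
        have := hV0 τ hτ
        have := Complex.exp_ne_zero (Γ τ)
        rw [h2, Qf_eq_redV]
        field_simp
        ring
      rw [h3, h1, add_div, Finset.sum_div, ← add_assoc, add_comm (1 / 2 : ℂ), add_assoc, add_mul,
        Finset.sum_mul]
      congr 1
      refine Finset.sum_congr rfl fun z _ => ?_
      ring
    have i1 : IntervalIntegrable (fun τ => ∑ z ∈ Z, (analyticOrderNatAt (redV α ν) z / 4 : ℂ) *
        ((Γ τ - z)⁻¹ * deriv Γ τ)) MeasureTheory.volume 0 8 := by
      simpa only [Finset.sum_fn] using IntervalIntegrable.sum Z fun z hz => (hint z hz).const_mul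
        (analyticOrderNatAt (redV α ν) z / 4 : ℂ)
    have i2 : IntervalIntegrable (fun τ => (1 / 2 + k (Γ τ) / 4) * deriv Γ τ)
        MeasureTheory.volume 0 8 := a.integrable _ (continuousOn_const.add
          ((hk.continuousOn.comp a.cont hB).div_const 4))
    rw [intervalIntegral.integral_congr (fun τ hτ => e1 τ (by
        rwa [uIcc_of_le (by norm_num : (0 : ℝ) ≤ 8)] at hτ)),
      intervalIntegral.integral_add i1 i2,
      hprim (fun w => 1 / 2 + k w / 4) ((hk.div_const 4).const_add _), add_zero,
      intervalIntegral.integral_finsetSum fun z hz => (hint z hz).const_mul _, hindex,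
      Finset.mul_sum]
    refine Finset.sum_congr rfl fun z _ => ?_
    rw [intervalIntegral.integral_const_mul, winding]
    have : (Real.pi : ℂ) ≠ 0 := Complex.ofReal_ne_zero.2 Real.pi_ne_zero
    field_simp
    ring
  have hroot := a.root
  have hp0 : p 0 (Γ 0) ≠ 0 := (h.link 0).rootOn.root_ne_zero hΓ.apply_zero_mem
  rw [hL, hΓ.closed, (h.jump _ hΓ.apply_zero_mem).1, mul_comm] at hroot
  have hμ := mul_left_cancel₀ hp0 hroot
  rw [neg_mul, Complex.exp_neg, ← hμ]
  -- The two signs of the exponent give the same value since μ² = 1.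
  exact inv_eq_of_mul_eq_one_left (by rw [← sq, h.sq])

end IsSurgeryLoop

end

section

/-! ### Independence of the realization -/

/-- Comparing x with x + y shows e^{δy} = c/c = 1 for every y; differentiate at 0. This excludes
oscillation as well as growth and decay. -/
lemma eq_zero_of_tendsto_cexp {δ c : ℂ} (hc : c ≠ 0)
    (h : Tendsto (fun x : ℝ => Complex.exp (δ * x)) atTop (𝓝 c)) : δ = 0 := by
  have h1 : ∀ y : ℝ, Complex.exp (δ * y) = 1 := fun y => by
    have h2 : Tendsto (fun x : ℝ => Complex.exp (δ * (x + y : ℝ)) / Complex.exp (δ * x)) atTop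
        (𝓝 (c / c)) := (h.comp (tendsto_atTop_add_const_right _ y tendsto_id)).div h hc
    rw [div_self hc] at h2
    refine tendsto_nhds_unique (tendsto_const_nhds.congr fun x => ?_) h2
    rw [← Complex.exp_sub]
    congr 1
    push_cast
    ring
  have h3 : HasDerivAt (fun y : ℝ => Complex.exp (δ * y)) δ 0 :=
    (hasDerivAt_cexp_const_mul δ ((0 : ℝ) : ℂ)).comp_ofReal.congr_deriv (by simp)
  simp only [h1] at h3
  exact h3.unique (hasDerivAt_const 0 1)

section

variable {α : ℝ} {N : Set ℂ} {v : Fin 4 → Vertex} {Q Q' : Realization α N v} {ν : ℂ} {M M' : ℝ}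
  {s t s' t' : Fin 4 → ℝ} {p S p' S' : Fin 5 → ℂ → ℂ} {P T P' T' : Fin 4 → ℝ → ℂ} {μ d μ' d' : ℂ}

lemma actionMono_ofReal (Q : Realization α N v) (hν : ν ∈ N) {ħ : ℝ} (hħ : 0 < ħ) :
    ActionMono Q ν ħ := fun i x hx y hy hxy => by
  rw [Complex.div_ofReal_re]
  exact (div_pos ((Q i).strictMono ν hν x hx y hy hxy) hħ).le

lemma Realization.RotatedMono.actionMono {ħ : ℂ} (h : Q.RotatedMono ħ.arg) (hν : ν ∈ N) :
    ActionMono Q ν ħ := fun i x hx y hy hxy => by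
  have e : action ((Q i).γ ν) ((Q i).r ν) x y / ħ =
      Complex.exp (-(Complex.I * ħ.arg)) * action ((Q i).γ ν) ((Q i).r ν) x y / (‖ħ‖ : ℝ) := by
    conv_lhs => rw [hbar_eq (ħ := ħ)]
    rw [Complex.exp_neg, mul_comm Complex.I, mul_comm (‖ħ‖ : ℂ), ← div_div, div_eq_inv_mul
      (action _ _ _ _)]
  rw [e, Complex.div_ofReal_re]
  exact div_nonneg (h ν hν i x hx y hy hxy).le (norm_nonneg _)

lemma Realization.Horizontal.rotatedMono (h : Q.Horizontal) {θ : ℝ} (hθ : |θ| < Real.pi / 2) :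
    Q.RotatedMono θ := fun ν hν i x hx y hy hxy => by
  have e : (Complex.exp (-(Complex.I * θ))).re = Real.cos θ := by
    rw [Complex.exp_re]
    simp
  rw [Complex.mul_re, h ν hν i x hx y hy, mul_zero, sub_zero, e]
  rw [abs_lt] at hθ
  exact mul_pos (Real.cos_pos_of_mem_Ioo ⟨by linarith [hθ.1], hθ.2⟩)
    ((Q i).strictMono ν hν x hx y hy hxy)

/-- The monodromy of the root and of the action does not depend on the realization. -/
lemma Chain.unique (hα : 0 < α) (hν : ν ∈ N) (h : Chain Q ν M s t p S P T μ d)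
    (h' : Chain Q' ν M' s' t' p' S' P' T' μ' d') : μ = μ' ∧ d = d' := by
  obtain ⟨H, hH0, hH⟩ := exists_errorBound Q
  obtain ⟨H', hH0', hH'⟩ := exists_errorBound Q'
  -- With x = 1/ħ real, both realizations estimate the same R: the asymptotic values are limits,
  -- hence unique.
  have key : ∀ x : ℝ, 4 * (H + H' + 1) ≤ x → ∃ R : ℂ,
      ‖R * Complex.exp (d * x) + μ‖ ≤ 40 * H * x⁻¹ ∧
      ‖R * Complex.exp (d' * x) + μ'‖ ≤ 40 * H' * x⁻¹ := fun x hx => by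
    have hx0 : 0 < x := by linarith
    have hħ : ((x⁻¹ : ℝ) : ℂ) ≠ 0 := Complex.ofReal_ne_zero.2 (inv_ne_zero hx0.ne')
    have harg : |((x⁻¹ : ℝ) : ℂ).arg| < Real.pi / 2 := by
      rw [Complex.arg_ofReal_of_nonneg (inv_nonneg.2 hx0.le), abs_zero]
      exact Real.pi_div_two_pos
    have hn : ‖((x⁻¹ : ℝ) : ℂ)‖ = x⁻¹ := by
      rw [Complex.norm_real, Real.norm_of_nonneg (inv_nonneg.2 hx0.le)]
    have hP : Differentiable ℂ (fun w => Qf α ν w / ((x⁻¹ : ℝ) : ℂ) ^ 2) :=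
      (Qf_differentiable α ν).div_const _
    obtain ⟨g, hg, hg0, hg1⟩ := exists_isSol hP 1 0
    obtain ⟨k, hk, hk0, hk1⟩ := exists_isSol hP 0 1
    have hw : wr g k 0 ≠ 0 := by simp [wr, hg0, hg1, hk0, hk1]
    have hx1 : x⁻¹ * H ≤ 1 / 4 := by
      rw [inv_mul_le_iff₀ hx0]
      linarith
    have hx2 : x⁻¹ * H' ≤ 1 / 4 := by
      rw [inv_mul_le_iff₀ hx0]
      linarith
    have hm := inv_pos.2 hx0
    obtain ⟨W, R, hW, hR, hE⟩ := h.exists_estimate hα hħ harg (actionMono_ofReal Q hν hm) hH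
      (by rwa [hn]) hg hk hw
    obtain ⟨W', R', hW', hR', hE'⟩ := h'.exists_estimate hα hħ harg (actionMono_ofReal Q' hν hm) hH'
      (by rwa [hn]) hg hk hw
    have hWW : W = W' := funext fun i => by
      have := vertexFilter_neBot α (v i)
      exact tendsto_nhds_unique (hW i) (hW' i)
    rw [hWW, hR', OnePoint.coe_eq_coe] at hR
    subst hR
    rw [hn, Complex.ofReal_inv, div_inv_eq_mul] at hE hE'
    exact ⟨_, hE, hE'⟩
  choose! R hR hR' using key
  have lim : ∀ (δ m : ℂ) (C : ℝ), (∀ x : ℝ, 4 * (H + H' + 1) ≤ x →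
      ‖R x * Complex.exp (δ * x) + m‖ ≤ C * x⁻¹) →
      Tendsto (fun x : ℝ => R x * Complex.exp (δ * x)) atTop (𝓝 (-m)) := fun δ m C hb => by
    rw [tendsto_iff_norm_sub_tendsto_zero]
    have h0 : Tendsto (fun x : ℝ => C * x⁻¹) atTop (𝓝 0) := by
      simpa using tendsto_inv_atTop_zero.const_mul C
    refine squeeze_zero' (Eventually.of_forall fun x => norm_nonneg _) ?_ h0
    filter_upwards [eventually_ge_atTop (4 * (H + H' + 1))] with x hx
    rw [sub_neg_eq_add]
    exact hb x hx
  have hμ0 : μ ≠ 0 := by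
    rintro rfl
    simpa using h.sq
  have hμ0' : μ' ≠ 0 := by
    rintro rfl
    simpa using h'.sq
  have l1 := lim d μ _ hR
  have l2 := lim d' μ' _ hR'
  -- Dividing the two limits eliminates R.
  have l3 : Tendsto (fun x : ℝ => Complex.exp ((d' - d) * x)) atTop (𝓝 (μ' / μ)) := by
    have := l2.div l1 (neg_ne_zero.2 hμ0)
    rw [neg_div_neg_eq] at this
    refine this.congr' ?_
    filter_upwards [l1.eventually_ne (neg_ne_zero.2 hμ0)] with x hx
    have hRx := left_ne_zero_of_mul hx
    simp only [Pi.div_apply]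
    rw [mul_div_mul_left _ _ hRx, ← Complex.exp_sub, sub_mul]
  have hδ := eq_zero_of_tendsto_cexp (div_ne_zero hμ0' hμ0) l3
  rw [hδ] at l3
  simp only [zero_mul, Complex.exp_zero] at l3
  have h1 := tendsto_nhds_unique tendsto_const_nhds l3
  rw [eq_div_iff hμ0, one_mul] at h1
  exact ⟨h1, (sub_eq_zero.1 hδ).symm⟩

/-- A realization `Q` provides the constants for all the others. -/
lemma exists_const (hα : 0 < α) (Q : Realization α N v) :
    ∃ C > 0, ∃ ħ₀ > 0, ∀ Q' : Realization α N v, ∀ ν ∈ N, ∀ ħ : ℂ, ħ ≠ 0 → ‖ħ‖ < ħ₀ →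
      |ħ.arg| < Real.pi / 2 → ActionMono Q ν ħ → Estimate Q' ν ħ C := by
  obtain ⟨H, hH0, hH⟩ := exists_errorBound Q
  -- The summand 1 keeps the constant positive when H = 0; the threshold ensures ‖ħ‖H ≤ 1/4.
  refine ⟨40 * H + 1, by positivity, 1 / (4 * (H + 1)), by positivity,
    fun Q' ν hν ħ hħ hsmall harg hmono ψ φ hb => ?_⟩
  obtain ⟨hψ, hφ, hli⟩ := hb
  obtain ⟨M, s, t, hst, h0, hs, ht⟩ := exists_cut hα Q hν
  obtain ⟨p, S, P, T, μ, d, h⟩ := exists_chain hα Q hν hst h0 hs ht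
  have hg := hψ.isSol_rescale hα hħ
  have hk := hφ.isSol_rescale hα hħ
  have hħH : ‖ħ‖ * H ≤ 1 / 4 := by
    rw [lt_div_iff₀ (by positivity)] at hsmall
    nlinarith [norm_nonneg ħ]
  obtain ⟨W, R, hW, hR, hE⟩ := h.exists_estimate hα hħ harg hmono hH hħH hg hk
    (wr_ne_zero_of_linearIndependent ((Qf_differentiable α ν).div_const _) hg hk
      (linearIndependent_rescale hli) 0)
  simp only [quot_rescale] at hW
  refine ⟨W, hW, fun _ => ⟨R, hR, fun Γ σ s' t' M' hΓ hσ => ?_⟩⟩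
  obtain ⟨p', S', P', T', μ', d', h'⟩ := exists_chain hα Q' hν hΓ.cut hΓ.nhd_ne_zero hΓ.start_mem
    hΓ.finish_mem
  -- The loop belongs to Q' and the error bound to Q; they meet because the monodromy data coincide.
  obtain ⟨rfl, rfl⟩ := h.unique hα hν h'
  rw [hΓ.period_eq h' hσ, hΓ.exp_index h', mul_comm ħ⁻¹, ← div_eq_mul_inv]
  refine hE.trans ?_
  gcongr
  linarith

end

end

end

end WKB

/-! ### The theorem -/

theorem mainTheorem4 (α : ℝ) (hα : 0 < α) (N : Set ℂ) (v : Fin 4 → WKB.Vertex)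
    (hv : Function.Injective v) :
    (∃ C > 0, ∃ ħ₀ > 0, ∀ Q : WKB.Realization α N v, ∀ ν ∈ N, ∀ ħ : ℝ, 0 < ħ → ħ < ħ₀ →
      WKB.Estimate Q ν (ħ : ℂ) C) ∧
    (∀ θ₀ : ℝ, 0 ≤ θ₀ → θ₀ < Real.pi / 2 →
      ∃ C > 0, ∃ ħ₀ > 0, ∀ Q : WKB.Realization α N v, (∀ θ : ℝ, |θ| ≤ θ₀ → Q.RotatedMono θ) →
        ∀ ν ∈ N, ∀ ħ : ℂ, ħ ≠ 0 → ‖ħ‖ < ħ₀ → |ħ.arg| ≤ θ₀ → WKB.Estimate Q ν ħ C) ∧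
    (∀ θ₀ : ℝ, 0 ≤ θ₀ → θ₀ < Real.pi / 2 →
      ∃ C > 0, ∃ ħ₀ > 0, ∀ Q : WKB.Realization α N v, Q.Horizontal →
        ∀ ν ∈ N, ∀ ħ : ℂ, ħ ≠ 0 → ‖ħ‖ < ħ₀ → |ħ.arg| ≤ θ₀ → WKB.Estimate Q ν ħ C) := by
  refine ⟨?_, fun θ₀ hθ₀ hθ₁ => ?_, fun θ₀ hθ₀ hθ₁ => ?_⟩
  -- Any one realization fixes the constants for all; if there is none, the claim is vacuous. The
  -- same device is used for the other two assertions.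
  · by_cases hQ : Nonempty (WKB.Realization α N v)
    · obtain ⟨Q⟩ := hQ
      obtain ⟨C, hC, ħ₀, hħ₀, h⟩ := WKB.exists_const hα Q
      refine ⟨C, hC, ħ₀, hħ₀, fun Q' ν hν ħ hħ hlt => h Q' ν hν ħ
        (Complex.ofReal_ne_zero.2 hħ.ne') ?_ ?_ (WKB.actionMono_ofReal Q hν hħ)⟩
      · rwa [Complex.norm_real, Real.norm_of_nonneg hħ.le]
      · rw [Complex.arg_ofReal_of_nonneg hħ.le, abs_zero]
        exact Real.pi_div_two_pos
    · exact ⟨1, one_pos, 1, one_pos, fun Q => (hQ ⟨Q⟩).elim⟩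
  · by_cases hQ : ∃ Q : WKB.Realization α N v, ∀ θ : ℝ, |θ| ≤ θ₀ → Q.RotatedMono θ
    · obtain ⟨Q, hmono⟩ := hQ
      obtain ⟨C, hC, ħ₀, hħ₀, h⟩ := WKB.exists_const hα Q
      exact ⟨C, hC, ħ₀, hħ₀, fun Q' _ ν hν ħ hħ hlt harg => h Q' ν hν ħ hħ hlt
        (harg.trans_lt hθ₁) ((hmono _ harg).actionMono hν)⟩
    · exact ⟨1, one_pos, 1, one_pos, fun Q hmono => (hQ ⟨Q, hmono⟩).elim⟩
  · by_cases hQ : ∃ Q : WKB.Realization α N v, Q.Horizontal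
    · obtain ⟨Q, hor⟩ := hQ
      obtain ⟨C, hC, ħ₀, hħ₀, h⟩ := WKB.exists_const hα Q
      exact ⟨C, hC, ħ₀, hħ₀, fun Q' _ ν hν ħ hħ hlt harg => h Q' ν hν ħ hħ hlt
        (harg.trans_lt hθ₁) ((hor.rotatedMono (harg.trans_lt hθ₁)).actionMono hν)⟩
    · exact ⟨1, one_pos, 1, one_pos, fun Q hor => (hQ ⟨Q, hor⟩).elim⟩
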